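/- **Notation.** Let $d\ge 1$. Points of $\mathbb{R}^{1+2d}$ are written $z=(t,x,v)$; $z_0\circ z=(t_0+t,\;x_0+x+tv_0,\;v_0+v)$, $z^{-1}=(-t,-x+tv,-v)$, $\sigma_r(z)=(r^2t,r^3x,rv)$; $B_r$ is the open ball of $\mathbb{R}^d$ centred at $0$; $Q_r=(-r^2,0]\times B_{r^3}\times B_r$ and $Q_r(z_0)=z_0\circ Q_r$. Moreover $a_\pm=\max(\pm a,0)$, $\Gamma$ is the fundamental solution of $\partial_t f+v\cdot\nabla_x f=\Delta_v f$, $$\Gamma(t,x,v)=\Big(\frac{3}{4\pi^2}\Big)^{d/2}t^{-2d}\exp\Big(-\frac{3|x-\frac t2 v|^2}{t^3}-\frac{|v|^2}{4t}\Big)\ (t>0),\qquad \Gamma=0\ (t\le 0),$$ and $\Gamma*_{\rm kin}h(z)=\int\Gamma(\zeta^{-1}\circ z)h(\zeta)\,d\zeta$. Gradients $\nabla_v$ are weak gradients. Fix $p_c>2$, $C_+\ge1$, $C_->0$ and a function $\varpi$ with $\varpi(R)\to0$ as $R\to\infty$. Let $\Omega=(a,b]\times\Omega_x\times\Omega_v$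 with $\Omega_x,\Omega_v\subset\mathbb{R}^d$ open. **The class $\mathrm{kDG}^+(\Omega,S)$**, $S\in L^2(\Omega)$, consists of the $f\in L^\infty((a,b],L^2(\Omega_x\times\Omega_v))$ with $\nabla_vf\in L^2(\Omega)$ such that, for all $z_0\in\Omega$, $\kappa\in\mathbb{R}$ and $0<r<R<1$ with $Q_R(z_0)\subset\Omega$, $$\|(f-\kappa)_+\|_{L^{p_c}(Q_r(z_0))}^2\le C_+(R-r)^{-4}\int_{Q_R(z_0)}(f-\kappa)_+^2+C_+(R-r)^{-2}\int_{Q_R(z_0)}|S|^2\mathbf 1_{\{f\ge\kappa\}}.$$ **The class $\mathrm{kDG}^-(\Omega,S)$**, $S\in L^\infty(\Omega)$, consists of the $f$ such that: 1. $-f\in\mathrm{kDG}^+(\Omega,S)$. 2. For all $\kappa\in\mathbb{R}$, all $z_0$, $T$, $0<\tau_-<\tau_+$, $0<r_x<R_x$, $0<r_v<R_v$, with $Q_{\rm int}=z_0\circ\big((T-\tau_-,T]\times B_{r_x}\times B_{r_v}\big)$ and $Q_{\rm ext}=z_0\circ\big((T-\tau_+,T]\times B_{R_x}\times B_{R_v}\big)\subset\Omega$,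 $$\|\nabla_v(f-\kappa)_-\|_{L^2(Q_{\rm int})}\le C_-\Big(e^{-1}\|(f-\kappa)_-\|_{L^2(Q_{\rm ext})}+\|S\mathbf 1_{\{f\le\kappa\}}\|_{L^2(Q_{\rm ext})}\Big),$$ where $e=\min\big((\tau_+-\tau_-)^{1/2},R_v^{-1/2}(R_x-r_x)^{1/2},R_v-r_v\big)$. 3. Let $R>1$, $\eta\in(0,1)$, $T_{\rm mid}\in(-1-2\eta^2,-1-\eta^2)$, $Q_{\rm mid}=(T_{\rm mid},0]\times B_{8R}\times B_{2R}$, $Q_-=Q_\eta(-1-\eta^2,0,0)$, $Q_+=Q_1$. For all $z_0$, $\rho>0$ and $\kappa>0$ such that $z_0\circ\sigma_\rho(Q_{\rm mid})\subset\Omega$ and $f\ge0$ a.e. in $z_0\circ\sigma_\rho(Q_{\rm mid})$, the function $g(z)=\min(f,\kappa)(z_0\circ\sigma_\rho(z))$ satisfies $$\Big\|\big(g-\Gamma*_{\rm kin}(g\mathbf 1_{Q_-\cap Q_{\rm mid}})+\kappa\,\varpi(R)\big)_-\Big\|_{L^1(Q_+)}\le C_-\Big(\|\nabla_vg\|_{L^1(Q_{\rm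 mid})}+\|S\|_{L^\infty(z_0\circ\sigma_\rho(Q_{\rm mid}))}\Big).$$ **Theorem (kinetic weak Harnack inequality).** There exist $R_0>1$, $\omega\in(0,1)$, $C>0$ and $p>0$, depending only on $d,p_c,C_+,C_-$ and $\varpi$, such that the following holds. Let $Q_{\rm whi}=(-1,0]\times B_{R_0}\times B_{R_0}$, $Q_{\rm past}=Q_\omega(-1+\omega^2,0,0)$ and $Q_{\rm future}=Q_\omega$. For all $S\in L^\infty(Q_{\rm whi})$ and all $f\in\mathrm{kDG}^-(Q_{\rm whi},S)$ with $f\ge0$ a.e. in $Q_{\rm whi}$, $$\Big(\int_{Q_{\rm past}}f^p\Big)^{1/p}\le C\Big(\operatorname*{ess\,inf}_{Q_{\rm future}}f+\|S\|_{L^\infty(Q_{\rm whi})}\Big).$$ -/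

import Mathlib

open MeasureTheory Filter Set
open scoped ENNReal Topology

noncomputable section

namespace Kinetic

/-- The phase space `ℝ × ℝᵈ × ℝᵈ`; a point is `z = (t, x, v)`. -/
abbrev Ph (d : ℕ) : Type :=
  ℝ × EuclideanSpace ℝ (Fin d) × EuclideanSpace ℝ (Fin d)

variable {d : ℕ}

/-- Galilean composition `z₀ ∘ z = (t₀ + t, x₀ + x + t v₀, v₀ + v)`. -/
def comp (z₀ z : Ph d) : Ph d :=
  (z₀.1 + z.1, z₀.2.1 + z.2.1 + z.1 • z₀.2.2, z₀.2.2 + z.2.2)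

/-- Inverse for the Galilean composition, `z⁻¹ = (-t, -x + t v, -v)`. -/
def inv (z : Ph d) : Ph d :=
  (-z.1, -z.2.1 + z.1 • z.2.2, -z.2.2)

/-- Kinetic scaling `σ_r(z) = (r² t, r³ x, r v)`. -/
def scale (r : ℝ) (z : Ph d) : Ph d :=
  (r ^ 2 * z.1, r ^ 3 • z.2.1, r • z.2.2)

/-- The product domain `(a, b] × Ω_x × Ω_v`. -/
def domain (a b : ℝ) (Ωx Ωv : Set (EuclideanSpace ℝ (Fin d))) : Set (Ph d) :=
  Ioc a b ×ˢ (Ωx ×ˢ Ωv)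

/-- The box `(a, b] × B_ρx × B_ρv`, with open balls centred at the origin. -/
def box (d : ℕ) (a b ρx ρv : ℝ) : Set (Ph d) :=
  domain a b (Metric.ball 0 ρx) (Metric.ball 0 ρv)

/-- The kinetic cylinder `Q_r(z₀) = z₀ ∘ Q_r`, where `Q_r = (-r², 0] × B_{r³} × B_r`. -/
def cyl (r : ℝ) (z₀ : Ph d) : Set (Ph d) :=
  comp z₀ '' box d (-r ^ 2) 0 (r ^ 3) r

/-- `G` is the weak (distributional) gradient of `f` in the variable `v`, in the set `Ω`. -/
structure HasWeakGradV (Ω : Set (Ph d)) (f : Ph d → ℝ)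
    (G : Ph d → EuclideanSpace ℝ (Fin d)) : Prop where
  locallyIntegrable : LocallyIntegrableOn f Ω volume
  locallyIntegrable_grad : LocallyIntegrableOn G Ω volume
  integral_eq : ∀ φ : Ph d → ℝ, ContDiff ℝ ((⊤ : ℕ∞) : WithTop ℕ∞) φ → HasCompactSupport φ → tsupport φ ⊆ Ω →
    ∀ i : Fin d,
      ∫ z in Ω, f z * fderiv ℝ φ z (0, 0, EuclideanSpace.single i 1) = - ∫ z in Ω, G z i * φ z

/-- The fundamental solution of the Kolmogorov equation `∂ₜ f + v · ∇ₓ f = Δᵥ f`. -/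
def Gam (z : Ph d) : ℝ :=
  if 0 < z.1 then
    (3 / (4 * Real.pi ^ 2)) ^ ((d : ℝ) / 2) * (z.1 ^ (2 * d))⁻¹ *
      Real.exp (-(3 * ‖z.2.1 - (z.1 / 2) • z.2.2‖ ^ 2 / z.1 ^ 3) - ‖z.2.2‖ ^ 2 / (4 * z.1))
  else 0

/-- The kinetic convolution of `Γ` with `g 1_A`, that is `∫_A Γ(ζ⁻¹ ∘ z) g(ζ) dζ`. -/
def localMean (A : Set (Ph d)) (g : Ph d → ℝ) (z : Ph d) : ℝ :=
  ∫ ζ in A, Gam (comp (inv ζ) z) * g ζ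

/-- The kinetic De Giorgi class `kDG⁺(Ω, S)`, `Ω = (a, b] × Ω_x × Ω_v`, with exponent `pc` and
constant `Cp`. -/
structure KDGPlus (pc Cp a b : ℝ) (Ωx Ωv : Set (EuclideanSpace ℝ (Fin d)))
    (f S : Ph d → ℝ) : Prop where
  source : MemLp S 2 (volume.restrict (domain a b Ωx Ωv))
  aestronglyMeasurable : AEStronglyMeasurable f (volume.restrict (domain a b Ωx Ωv))
  bounded_in_time : ∃ K : ℝ≥0∞, K < ∞ ∧ ∀ᵐ t ∂(volume.restrict (Ioc a b)),
    ∫⁻ y in Ωx ×ˢ Ωv, ‖f (t, y)‖ₑ ^ 2 ≤ K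
  grad : ∃ G : Ph d → EuclideanSpace ℝ (Fin d), HasWeakGradV (domain a b Ωx Ωv) f G ∧
    MemLp G 2 (volume.restrict (domain a b Ωx Ωv))
  gain : ∀ z₀ ∈ domain a b Ωx Ωv, ∀ κ r R : ℝ, 0 < r → r < R → R < 1 →
    cyl R z₀ ⊆ domain a b Ωx Ωv →
    eLpNorm (fun z => max (f z - κ) 0) (ENNReal.ofReal pc) (volume.restrict (cyl r z₀)) ^ 2 ≤
      ENNReal.ofReal (Cp / (R - r) ^ 4) *
          ∫⁻ z in cyl R z₀, ENNReal.ofReal ((max (f z - κ) 0) ^ 2) +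
        ENNReal.ofReal (Cp / (R - r) ^ 2) *
          ∫⁻ z in cyl R z₀, {z | κ ≤ f z}.indicator (fun z => ENNReal.ofReal (S z ^ 2)) z

/-- The kinetic De Giorgi class `kDG⁻(Ω, S)`, `Ω = (a, b] × Ω_x × Ω_v`, with exponent `pc`,
constants `Cp`, `Cm` and modulus `ϖ`.

* `gradient` is the local energy estimate in all boxes moved by a Galilean translation.
* `poincare` is the weak Poincaré-Wirtinger inequality, at all positions `z₀` and scales `ρ`, for
  the truncation `min (f, κ) = κ - (f - κ)₋` of a non-negative function; it takes its values in
  `[0, κ]`, so that the error term is `κ ϖ(R)`. -/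
structure KDGMinus (pc Cp Cm : ℝ) (ϖ : ℝ → ℝ) (a b : ℝ)
    (Ωx Ωv : Set (EuclideanSpace ℝ (Fin d))) (f S : Ph d → ℝ) : Prop where
  source : MemLp S ∞ (volume.restrict (domain a b Ωx Ωv))
  neg_mem : KDGPlus pc Cp a b Ωx Ωv (fun z => -f z) S
  gradient : ∀ κ : ℝ, ∃ H : Ph d → EuclideanSpace ℝ (Fin d),
    HasWeakGradV (domain a b Ωx Ωv) (fun z => max (κ - f z) 0) H ∧
    ∀ (z₀ : Ph d) (T τi τe rx Rx rv Rv : ℝ),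
      0 < τi → τi < τe → 0 < rx → rx < Rx → 0 < rv → rv < Rv →
      comp z₀ '' box d (T - τe) T Rx Rv ⊆ domain a b Ωx Ωv →
      eLpNorm H 2 (volume.restrict (comp z₀ '' box d (T - τi) T rx rv)) ≤
        ENNReal.ofReal Cm *
          (ENNReal.ofReal (min (√(τe - τi)) (min (√((Rx - rx) / Rv)) (Rv - rv)))⁻¹ *
              eLpNorm (fun z => max (κ - f z) 0) 2
                (volume.restrict (comp z₀ '' box d (T - τe) T Rx Rv)) +
            eLpNorm ({z | f z ≤ κ}.indicator S) 2
              (volume.restrict (comp z₀ '' box d (T - τe) T Rx Rv)))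
  poincare : ∀ (R η Tmid : ℝ), 1 < R → 0 < η → η < 1 →
    -1 - 2 * η ^ 2 < Tmid → Tmid < -1 - η ^ 2 →
    ∀ (z₀ : Ph d) (ρ κ : ℝ), 0 < ρ → 0 < κ →
      (fun z => comp z₀ (scale ρ z)) '' box d Tmid 0 (8 * R) (2 * R) ⊆ domain a b Ωx Ωv →
      (∀ᵐ z ∂(volume.restrict (box d Tmid 0 (8 * R) (2 * R))), 0 ≤ f (comp z₀ (scale ρ z))) →
      ∃ H : Ph d → EuclideanSpace ℝ (Fin d),
        HasWeakGradV (box d Tmid 0 (8 * R) (2 * R))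
          (fun z => min (f (comp z₀ (scale ρ z))) κ) H ∧
        ∫⁻ z in cyl 1 0, ENNReal.ofReal
            (-(min (f (comp z₀ (scale ρ z))) κ
              - localMean (cyl η (-1 - η ^ 2, 0, 0) ∩ box d Tmid 0 (8 * R) (2 * R))
                  (fun ζ => min (f (comp z₀ (scale ρ ζ))) κ) z
              + κ * ϖ R)) ≤
          ENNReal.ofReal Cm *
            (∫⁻ z in box d Tmid 0 (8 * R) (2 * R), ‖H z‖ₑ +
              eLpNorm (fun z => S (comp z₀ (scale ρ z))) ∞
                (volume.restrict (box d Tmid 0 (8 * R) (2 * R))))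

end Kinetic

end

/-! ### Galilean translations, kinetic dilations and volumes of cylinders. -/

namespace Kinetic

variable {d : ℕ}

/-! Positivity in measure spreads forward in time. If `f ≥ κ` on a fixed proportion of a past
cylinder, the average of `min (f, κ)` against the fundamental solution is at least a multiple of
`κ`, because `Γ` is bounded below between cylinders separated in time. The weak Poincaré inequality
then forces `f ≥ θκ` on most of the later cylinder, provided that `κ ϖ(R)` is absorbed by a large
`R` and that the gradient of some truncation is small in `L¹`. The latter is a pigeonhole argument
over finitely many levels in geometric progression (`exists_level_lintegral_grad_le`): the energy
estimate bounds the gradient of `min (f, α)` by a multiple of `α`, this gradient differs from that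
of the next truncation only between the two levels, and one of these disjoint interlevel sets is
small. This rests on the vanishing of weak gradients on level sets, and hence their uniqueness. The
outcome, at every position and scale, is `KDGMinus.exists_expansion`.

Expansion is iterated along the free trajectory of a point near the initial time, with doubled
radius at each step, up to a cylinder of radius between `1/2` and `1` ending at time `0`. There the
De Giorgi iteration (`KDGPlus.exists_lower_bound`) turns smallness in measure into a pointwise bound
on the future cylinder. Let `K` dominate the essential infimum and the source. If `{f ≥ M}` has
positive density at scale `r`, then `θ^n M ≤ 2K` for some `n` with `2^n r ≤ 1` (`Expands.chain`):
high levels can be dense only at small scales.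

The first link of the chain also shows that `{f ≥ θM}` occupies a sizeable part of a slightly later
region of size comparable to `r`. A Vitali covering of `{f ≥ M}` at critical scales then bounds its
measure by half of that of `{f ≥ θM}` in a slightly larger box. As the scales decrease geometrically
with the level, the successive enlargements are summable, and the superlevel sets decay like
`2^{-k}` at levels proportional to `θ^{-k}`. This gives integrability of a small power. The filled
regions never reach below time `-1`, so the past cylinder may start at the initial time itself. -/

theorem mem_comp_box {z₀ y : Ph d} {a b p q : ℝ} :
    y ∈ comp z₀ '' box d a b p q ↔ (a < y.1 - z₀.1 ∧ y.1 - z₀.1 ≤ b) ∧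
      ‖y.2.1 - z₀.2.1 - (y.1 - z₀.1) • z₀.2.2‖ < p ∧ ‖y.2.2 - z₀.2.2‖ < q := by
  constructor
  · rintro ⟨z, ⟨h1, h2, h3⟩, rfl⟩
    simp only [mem_ball_zero_iff, mem_Ioc] at h1 h2 h3
    simp only [comp, add_sub_cancel_left]
    refine ⟨h1, ?_, h3⟩
    have e : z₀.2.1 + z.2.1 + z.1 • z₀.2.2 - z₀.2.1 - z.1 • z₀.2.2 = z.2.1 := by module
    rwa [e]
  · rintro ⟨h1, h2, h3⟩
    refine ⟨(y.1 - z₀.1, y.2.1 - z₀.2.1 - (y.1 - z₀.1) • z₀.2.2, y.2.2 - z₀.2.2),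
      ⟨h1, by simpa using h2, by simpa using h3⟩, ?_⟩
    ext1
    · simp [comp]
    · ext1
      · simp only [comp]; module
      · simp [comp]

theorem mem_box {y : Ph d} {a b p q : ℝ} :
    y ∈ box d a b p q ↔ (a < y.1 ∧ y.1 ≤ b) ∧ ‖y.2.1‖ < p ∧ ‖y.2.2‖ < q := by
  simp [box, domain, mem_prod]

theorem measurableSet_box {a b p q : ℝ} : MeasurableSet (box d a b p q) :=
  measurableSet_Ioc.prod (measurableSet_ball.prod measurableSet_ball)

theorem comp_assoc (a b c : Ph d) : comp (comp a b) c = comp a (comp b c) := by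
  simp only [comp, smul_add, add_smul]
  ext1
  · simp [add_assoc]
  · ext1
    · simp only; abel
    · simp [add_assoc]

theorem inv_comp_cancel (a b : Ph d) : comp (inv a) (comp a b) = b := by
  simp only [comp, inv, add_smul, smul_neg]
  ext1
  · simp
  · ext1
    · simp only; abel
    · simp

theorem comp_inv_cancel (a b : Ph d) : comp a (comp (inv a) b) = b := by
  simp only [comp, inv, add_smul, smul_neg, neg_smul]
  ext1
  · simp
  · ext1
    · simp only; abel
    · simp

/-- The affine change of variables `z ↦ z₀ ∘ σ_ρ(z)`. -/
def dil (z₀ : Ph d) (ρ : ℝ) (z : Ph d) : Ph d := comp z₀ (scale ρ z)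

theorem scale_scale_inv {ρ : ℝ} (hρ : ρ ≠ 0) (z : Ph d) : scale ρ (scale ρ⁻¹ z) = z := by
  simp [scale, smul_smul, hρ]

theorem scale_inv_scale {ρ : ℝ} (hρ : ρ ≠ 0) (z : Ph d) : scale ρ⁻¹ (scale ρ z) = z := by
  simp [scale, smul_smul, hρ]

theorem continuous_comp (z₀ : Ph d) : Continuous (comp z₀) := by
  unfold comp; fun_prop

theorem continuous_scale (ρ : ℝ) : Continuous (scale ρ : Ph d → Ph d) := by
  unfold scale; fun_prop

/-- `dil` as a homeomorphism. -/
noncomputable def dilHomeo (z₀ : Ph d) {ρ : ℝ} (hρ : ρ ≠ 0) : Ph d ≃ₜ Ph d where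
  toFun := dil z₀ ρ
  invFun z := scale ρ⁻¹ (comp (inv z₀) z)
  left_inv z := by simp only; rw [dil, inv_comp_cancel, scale_inv_scale hρ]
  right_inv z := by rw [dil, scale_scale_inv hρ, comp_inv_cancel]
  continuous_toFun := (continuous_comp z₀).comp (continuous_scale ρ)
  continuous_invFun := (continuous_scale ρ⁻¹).comp (continuous_comp _)

/-- A translation in time, and at each fixed time a translation in `(x, v)`: a skew product of
measure preserving maps. -/
theorem measurePreserving_comp (z₀ : Ph d) : MeasurePreserving (comp z₀) volume volume := by
  have h1 : MeasurePreserving (fun t : ℝ => z₀.1 + t) volume volume :=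
    measurePreserving_add_left volume z₀.1
  refine MeasurePreserving.skew_product (μa := (volume : Measure ℝ)) (μb := volume)
    (μc := (volume : Measure (EuclideanSpace ℝ (Fin d) × EuclideanSpace ℝ (Fin d))))
    (μd := volume) (f := fun t => z₀.1 + t)
    (g := fun t w => (z₀.2.1 + w.1 + t • z₀.2.2, z₀.2.2 + w.2)) h1 ?_ ?_
  · unfold Function.uncurry; fun_prop
  · refine Eventually.of_forall fun t => ?_
    have : (fun w : EuclideanSpace ℝ (Fin d) × EuclideanSpace ℝ (Fin d) =>
        (z₀.2.1 + w.1 + t • z₀.2.2, z₀.2.2 + w.2)) =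
        fun w => (z₀.2.1 + t • z₀.2.2, z₀.2.2) + w := by
      ext1 w
      ext1
      · simp only [Prod.fst_add]; abel
      · simp
    rw [this]
    exact map_add_left_eq_self ((volume : Measure (EuclideanSpace ℝ (Fin d))).prod volume) _

/-- The weights `2`, `3d` and `d` add up to the homogeneous dimension `4d + 2`, the exponent of the
radius in every measure estimate below. -/
theorem map_scale {ρ : ℝ} (hρ : 0 < ρ) :
    Measure.map (scale ρ : Ph d → Ph d) volume =
      ENNReal.ofReal ((ρ ^ (4 * d + 2))⁻¹) • (volume : Measure (Ph d)) := by
  have e : (scale ρ : Ph d → Ph d) =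
      Prod.map (fun t : ℝ => ρ ^ 2 • t) (Prod.map (fun x => ρ ^ 3 • x) (fun x => ρ • x)) := by
    ext1 z; rfl
  have hE : Module.finrank ℝ (EuclideanSpace ℝ (Fin d)) = d := by simp
  rw [e, Measure.volume_eq_prod, Measure.volume_eq_prod,
    ← Measure.map_prod_map _ _ (by fun_prop) (by fun_prop),
    ← Measure.map_prod_map _ _ (by fun_prop) (by fun_prop),
    Measure.map_addHaar_smul _ (by positivity), Measure.map_addHaar_smul _ (by positivity),
    Measure.map_addHaar_smul _ (by positivity), hE]
  simp only [Module.finrank_self, pow_one]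
  rw [Measure.prod_smul_left, Measure.prod_smul_right, Measure.prod_smul_left,
    Measure.prod_smul_right, Measure.prod_smul_right, smul_smul, smul_smul]
  congr 1
  rw [← ENNReal.ofReal_mul (by positivity), ← ENNReal.ofReal_mul (by positivity)]
  congr 1
  rw [abs_of_pos (by positivity), abs_of_pos (by positivity), abs_of_pos (by positivity),
    ← mul_inv, ← mul_inv]
  ring_nf

theorem map_dil (z₀ : Ph d) {ρ : ℝ} (hρ : 0 < ρ) :
    Measure.map (dil z₀ ρ) volume =
      ENNReal.ofReal ((ρ ^ (4 * d + 2))⁻¹) • (volume : Measure (Ph d)) := by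
  have : dil z₀ ρ = comp z₀ ∘ scale ρ := rfl
  rw [this, ← Measure.map_map (continuous_comp z₀).measurable (continuous_scale ρ).measurable,
    map_scale hρ, Measure.map_smul, (measurePreserving_comp z₀).map_eq]

theorem dil_image_box (z₀ : Ph d) {ρ : ℝ} (hρ : 0 < ρ) (a b p q : ℝ) :
    dil z₀ ρ '' box d a b p q =
      comp z₀ '' box d (ρ ^ 2 * a) (ρ ^ 2 * b) (ρ ^ 3 * p) (ρ * q) := by
  have : dil z₀ ρ = comp z₀ ∘ scale ρ := rfl
  rw [this, image_comp]
  congr 1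
  ext z
  constructor
  · rintro ⟨w, hw, rfl⟩
    rw [mem_box] at hw ⊢
    simp only [scale, norm_smul, norm_pow, Real.norm_of_nonneg hρ.le]
    have : 0 < ρ ^ 2 := by positivity
    have : 0 < ρ ^ 3 := by positivity
    obtain ⟨⟨h1, h2⟩, h3, h4⟩ := hw
    refine ⟨⟨?_, ?_⟩, ?_, ?_⟩ <;> gcongr
  · intro hz
    refine ⟨scale ρ⁻¹ z, ?_, scale_scale_inv hρ.ne' z⟩
    rw [← scale_scale_inv hρ.ne' z] at hz
    rw [mem_box] at hz ⊢
    generalize scale ρ⁻¹ z = w at *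
    simp only [scale, norm_smul, norm_pow, Real.norm_of_nonneg hρ.le] at hz
    obtain ⟨⟨h1, h2⟩, h3, h4⟩ := hz
    exact ⟨⟨lt_of_mul_lt_mul_left h1 (by positivity), le_of_mul_le_mul_left h2 (by positivity)⟩,
      lt_of_mul_lt_mul_left h3 (by positivity), lt_of_mul_lt_mul_left h4 (by positivity)⟩

/-- The volume of the unit cylinder. -/
noncomputable def unitVol (d : ℕ) : ℝ :=
  (volume (Metric.ball (0 : EuclideanSpace ℝ (Fin d)) 1)).toReal ^ 2

theorem unitVol_pos : 0 < unitVol d := by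
  have := Metric.measure_ball_pos (volume : Measure (EuclideanSpace ℝ (Fin d))) 0 one_pos
  have h := measure_ball_lt_top (μ := (volume : Measure (EuclideanSpace ℝ (Fin d)))) (x := 0) (r := 1)
  have := ENNReal.toReal_pos this.ne' h.ne
  unfold unitVol; positivity

theorem volume_box {a b p q : ℝ} (hp : 0 < p) (hq : 0 < q) :
    volume (box d a b p q) = ENNReal.ofReal ((b - a) * (p ^ d * q ^ d) * unitVol d) := by
  have h := measure_ball_lt_top (μ := (volume : Measure (EuclideanSpace ℝ (Fin d)))) (x := 0) (r := 1)
  have hE : Module.finrank ℝ (EuclideanSpace ℝ (Fin d)) = d := by simp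
  rw [box, domain, Measure.volume_eq_prod, Measure.volume_eq_prod, Measure.prod_prod,
    Measure.prod_prod, Measure.addHaar_ball_of_pos _ _ hp, Measure.addHaar_ball_of_pos _ _ hq, hE,
    Real.volume_Ioc, mul_assoc, ENNReal.ofReal_mul' (unitVol_pos (d := d)).le,
    ENNReal.ofReal_mul' (by positivity), ENNReal.ofReal_mul (by positivity), unitVol,
    ENNReal.ofReal_pow (p := (volume _).toReal) (by positivity), ENNReal.ofReal_toReal h.ne]
  ring

theorem measurableEmbedding_comp (z₀ : Ph d) : MeasurableEmbedding (comp z₀) := by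
  have : dil z₀ 1 = comp z₀ := by ext1 z; simp [dil, scale]
  rw [← this]
  exact (dilHomeo z₀ one_ne_zero).measurableEmbedding

theorem measurableSet_comp_box {z₀ : Ph d} {a b p q : ℝ} :
    MeasurableSet (comp z₀ '' box d a b p q) :=
  (measurableEmbedding_comp z₀).measurableSet_image.2 measurableSet_box

theorem volume_comp_box (z₀ : Ph d) {a b p q : ℝ} (hp : 0 < p) (hq : 0 < q) :
    volume (comp z₀ '' box d a b p q) =
      ENNReal.ofReal ((b - a) * (p ^ d * q ^ d) * unitVol d) := by
  rw [← volume_box hp hq, ← (measurePreserving_comp z₀).measure_preimage_emb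
    (measurableEmbedding_comp z₀), preimage_image_eq _ (measurableEmbedding_comp z₀).injective]

theorem measurableSet_cyl {r : ℝ} {z₀ : Ph d} : MeasurableSet (cyl r z₀) := measurableSet_comp_box

theorem volume_cyl (z₀ : Ph d) {r : ℝ} (hr : 0 < r) :
    volume (cyl r z₀) = ENNReal.ofReal (unitVol d * r ^ (4 * d + 2)) := by
  rw [cyl, volume_comp_box z₀ (by positivity) hr]
  ring_nf

end Kinetic

/-! ### Weak derivatives vanish on level sets. -/

section WeakDerivative

variable {E : Type*} [NormedAddCommGroup E] [NormedSpace ℝ E] [FiniteDimensional ℝ E]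
  [MeasurableSpace E] [BorelSpace E] {μ : Measure E} [μ.IsAddHaarMeasure]

/-- Translations are continuous in `L¹`. -/
theorem exists_forall_integral_translate_sub_le {g : E → ℝ} (hg : Integrable g μ) (e : E) {ε : ℝ}
    (hε : 0 < ε) :
    ∃ h₀ > 0, ∀ s : ℝ, |s| ≤ h₀ → ∫ z, ‖g (z + s • e) - g z‖ ∂μ ≤ ε := by
  let T : ℝ → C(E, E) := fun s => ⟨fun z => z + s • e, by fun_prop⟩
  have hT : Continuous T := by
    refine ContinuousMap.continuous_of_continuous_uncurry _ ?_
    unfold Function.uncurry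
    simp only [T, ContinuousMap.coe_mk]
    fun_prop
  have hm : ∀ s, MeasurePreserving (T s) μ μ := fun s => measurePreserving_add_right μ (s • e)
  have hc : Continuous fun s => Lp.compMeasurePreserving (T s) (hm s) (hg.toL1 g) :=
    continuous_const.compMeasurePreservingLp hT hm ENNReal.one_ne_top
  have h0 := Metric.continuousAt_iff.1 (hc.continuousAt (x := 0)) ε hε
  obtain ⟨δ, hδ, H⟩ := h0
  refine ⟨δ / 2, by positivity, fun s hs => ?_⟩
  have h1 := (H (x := s) (by rw [Real.dist_eq, sub_zero]; linarith)).le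
  rw [dist_eq_norm, L1.norm_eq_integral_norm] at h1
  refine le_trans (le_of_eq (integral_congr_ae ?_)) h1
  have a1 := Lp.coeFn_compMeasurePreserving (hg.toL1 g) (hm s)
  have a2 := Lp.coeFn_compMeasurePreserving (hg.toL1 g) (hm 0)
  have a3 := hg.coeFn_toL1
  have a4 := (hm s).quasiMeasurePreserving.ae_eq_comp a3
  have a5 := (hm 0).quasiMeasurePreserving.ae_eq_comp a3
  filter_upwards [Lp.coeFn_sub (Lp.compMeasurePreserving (T s) (hm s) (hg.toL1 g))
    (Lp.compMeasurePreserving (T 0) (hm 0) (hg.toL1 g)), a1, a2, a4, a5] with z h1 h2 h3 h4 h5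
  rw [h1, Pi.sub_apply, h2, h3, h4, h5]
  simp [T]

/-- Indicators of bounded sets are almost everywhere limits of bounded test functions. -/
theorem exists_contDiff_tendsto_indicator {W : Set E} (hW : MeasurableSet W) {z₀ : E} {r : ℝ}
    (hr : 0 < r) (hWr : W ⊆ Metric.ball z₀ r) :
    ∃ ψ : ℕ → E → ℝ, (∀ n, ContDiff ℝ ((⊤ : ℕ∞) : WithTop ℕ∞) (ψ n)) ∧ (∀ n z, ‖ψ n z‖ ≤ 2) ∧
      (∀ n z, z ∉ Metric.ball z₀ (2 * r) → ψ n z = 0) ∧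
      ∀ᵐ z ∂μ, Tendsto (fun n => ψ n z) atTop (𝓝 (W.indicator (fun _ => (1 : ℝ)) z)) := by
  -- The ratio of outer to inner radius stays equal to `2`, as differentiation of integrals requires
  -- for almost everywhere convergence; outer radii at most `r` keep the supports within the ball of
  -- radius `2r`.
  let φ : ℕ → ContDiffBump (0 : E) := fun n =>
    { rIn := r / (2 * ((n : ℝ) + 2)), rOut := r / ((n : ℝ) + 2), rIn_pos := by positivity
      rIn_lt_rOut := by gcongr; linarith [n.cast_nonneg (α := ℝ)] }
  set w : E → ℝ := W.indicator (fun _ => (1 : ℝ)) with hw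
  have hwi : Integrable w μ := by
    refine (integrable_indicator_iff hW).2 (integrableOn_const ?_)
    exact ((measure_mono hWr).trans_lt measure_ball_lt_top).ne
  have hw01 : ∀ z, 0 ≤ w z ∧ w z ≤ 1 := fun z => by
    by_cases hz : z ∈ W <;> simp [hw, hz]
  refine ⟨fun n => convolution ((φ n).normed μ) w (ContinuousLinearMap.lsmul ℝ ℝ) μ, ?_, ?_, ?_, ?_⟩
  · intro n
    exact (φ n).hasCompactSupport_normed.contDiff_convolution_left _ (φ n).contDiff_normed
      hwi.locallyIntegrable
  · intro n z
    have := ContDiffBump.dist_normed_convolution_le (φ := φ n) (μ := μ) (g := w) (x₀ := z) (ε := 1)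
      hwi.1 (fun x _ => by
        rw [Real.dist_eq, abs_le]; constructor <;> linarith [hw01 x, hw01 z])
    rw [Real.dist_eq, abs_le] at this
    rw [Real.norm_eq_abs, abs_le]
    constructor <;> linarith [hw01 z]
  · intro n z hz
    have hz0 : w z = 0 := indicator_of_notMem (fun h => hz
      (Metric.ball_subset_ball (by linarith) (hWr h))) _
    refine (ContDiffBump.normed_convolution_eq_right (φ := φ n) (μ := μ) (g := w) (x₀ := z) ?_).trans hz0
    intro x hx
    rw [hz0]
    refine indicator_of_notMem (fun h => hz ?_) _
    have h1 := hWr h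
    rw [Metric.mem_ball] at h1 hx ⊢
    have : (φ n).rOut ≤ r := by
      simp only [φ]
      exact div_le_self hr.le (by linarith [n.cast_nonneg (α := ℝ)])
    have := dist_triangle_left z z₀ x
    linarith
  · refine ContDiffBump.ae_convolution_tendsto_right_of_locallyIntegrable (K := 2) ?_ ?_
      hwi.locallyIntegrable
    · simp only [φ]
      exact (tendsto_natCast_atTop_atTop.atTop_add tendsto_const_nhds).const_div_atTop r
    · refine Eventually.of_forall fun n => le_of_eq ?_
      simp only [φ]
      field_simp

variable {u g : E → ℝ} {e : E}

/-- The difference quotient of a function is close to its weak derivative, tested with a smooth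
function. -/
theorem abs_integral_translate_sub_le {z₀ : E} {r : ℝ} (hu : Integrable u μ) (hg : Integrable g μ)
    (h : ∀ φ : E → ℝ, ContDiff ℝ ((⊤ : ℕ∞) : WithTop ℕ∞) φ → HasCompactSupport φ →
      tsupport φ ⊆ Metric.ball z₀ (3 * r) →
      ∫ z, u z * fderiv ℝ φ z e ∂μ = - ∫ z, g z * φ z ∂μ)
    {φ : E → ℝ} (hφ : ContDiff ℝ ((⊤ : ℕ∞) : WithTop ℕ∞) φ) {C : ℝ} (hφC : ∀ z, ‖φ z‖ ≤ C)
    (hφs : ∀ z, z ∉ Metric.ball z₀ (2 * r) → φ z = 0) {k ε : ℝ} (hk : 0 ≤ k) (hkr : k * ‖e‖ < r)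
    (hε : ∀ s : ℝ, |s| ≤ k → ∫ z, ‖g (z + s • e) - g z‖ ∂μ ≤ ε) :
    |∫ z, (u (z + k • e) - u z) * φ z ∂μ - k * ∫ z, g z * φ z ∂μ| ≤ k * (C * ε) := by
  have hsupp : ∀ s ∈ Icc (0 : ℝ) k, tsupport (fun z => φ (z - s • e)) ⊆ Metric.ball z₀ (3 * r) := by
    intro s hs
    have h1 : tsupport (fun z => φ (z - s • e)) ⊆ Metric.closedBall z₀ (2 * r + k * ‖e‖) := by
      refine closure_minimal (fun z hz => ?_) Metric.isClosed_closedBall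
      have h2 : z - s • e ∈ Metric.ball z₀ (2 * r) := by
        by_contra h3; exact hz (hφs _ h3)
      rw [Metric.mem_ball, dist_eq_norm] at h2
      rw [Metric.mem_closedBall, dist_eq_norm]
      have h3 : ‖s • e‖ ≤ k * ‖e‖ := by
        rw [norm_smul, Real.norm_of_nonneg hs.1]; gcongr; exact hs.2
      calc ‖z - z₀‖ = ‖(z - s • e - z₀) + s • e‖ := by congr 1; abel
        _ ≤ _ := (norm_add_le _ _).trans (by linarith)
    exact h1.trans (Metric.closedBall_subset_ball (by linarith))
  have hcs : ∀ s ∈ Icc (0 : ℝ) k, HasCompactSupport (fun z => φ (z - s • e)) := fun s hs =>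
    HasCompactSupport.of_support_subset_isCompact (isCompact_closedBall z₀ (3 * r))
      ((subset_tsupport _).trans ((hsupp s hs).trans Metric.ball_subset_closedBall))
  have hφd : Differentiable ℝ φ := hφ.differentiable (by simp)
  have hφcs : HasCompactSupport φ := by simpa using hcs 0 ⟨le_rfl, hk⟩
  have hfc : Continuous (fderiv ℝ φ) := hφ.continuous_fderiv (by simp)
  obtain ⟨D, hD⟩ := (hφcs.fderiv (𝕜 := ℝ)).exists_bound_of_continuous hfc
  have hfd : ∀ (s : ℝ) (z : E), fderiv ℝ (fun z => φ (z - s • e)) z = fderiv ℝ φ (z - s • e) := fun s z => by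
    rw [fderiv_comp_sub]
  have hsm : ∀ s : ℝ, AEStronglyMeasurable (fun z => φ (z - s • e)) μ := fun s =>
    (hφ.continuous.comp (continuous_id.sub continuous_const)).aestronglyMeasurable
  have hint : ∀ s : ℝ, Integrable (fun z => u z * φ (z - s • e)) μ := fun s =>
    hu.mul_bdd (c := C) (hsm s) (Eventually.of_forall fun z => hφC _)
  have hintg : ∀ s : ℝ, Integrable (fun z => g z * φ (z - s • e)) μ := fun s =>
    hg.mul_bdd (c := C) (hsm s) (Eventually.of_forall fun z => hφC _)
  -- The weak derivative is tested with the translate `φ(· - s e)`, whose support stays in the ball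
  -- of radius `3r`.
  have hder : ∀ s ∈ Icc (0 : ℝ) k, HasDerivAt (fun s : ℝ => ∫ z, u z * φ (z - s • e) ∂μ)
      (∫ z, g z * φ (z - s • e) ∂μ) s := by
    intro s hs
    have key := (hasDerivAt_integral_of_dominated_loc_of_deriv_le (μ := μ)
      (F := fun s z => u z * φ (z - s • e))
      (F' := fun s z => u z * -(fderiv ℝ φ (z - s • e) e)) (x₀ := s) (s := univ)
      (bound := fun z => ‖u z‖ * (D * ‖e‖)) univ_mem
      (Eventually.of_forall fun t => (hint t).1) (hint s) ?_ ?_ ?_ ?_).2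
    · have := h (fun z => φ (z - s • e)) (hφ.comp (contDiff_id.sub contDiff_const)) (hcs s hs)
        (hsupp s hs)
      simp only [hfd] at this
      simp only [mul_neg, integral_neg, this, neg_neg] at key
      exact key
    · refine hu.1.mul (Continuous.aestronglyMeasurable ?_)
      fun_prop
    · refine Eventually.of_forall fun z t _ => ?_
      rw [norm_mul, norm_neg]
      gcongr
      exact (ContinuousLinearMap.le_opNorm _ _).trans (by gcongr; exact hD _)
    · exact hu.norm.mul_const _
    · refine Eventually.of_forall fun z t _ => ?_
      refine HasDerivAt.const_mul _ ?_
      have h1 : HasDerivAt (fun t : ℝ => z - t • e) (-e) t := by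
        simpa using ((hasDerivAt_id t).smul_const e).const_sub z
      have := (hφd (z - t • e)).hasFDerivAt.comp_hasDerivAt t h1
      rw [map_neg] at this
      exact this
  have htr : ∀ (w : E → ℝ) (s : ℝ), ∫ z, w z * φ (z - s • e) ∂μ = ∫ z, w (z + s • e) * φ z ∂μ := by
    intro w s
    rw [← integral_add_right_eq_self _ (s • e)]
    simp
  have hbound : ∀ s ∈ Icc (0 : ℝ) k,
      ‖∫ z, g z * φ (z - s • e) ∂μ - ∫ z, g z * φ z ∂μ‖ ≤ C * ε := by
    intro s hs
    have hgs : Integrable (fun z => g (z + s • e)) μ := hg.comp_add_right _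
    have hgi : Integrable (fun z => g (z + s • e) * φ z) μ :=
      hgs.mul_bdd (c := C) hφ.continuous.aestronglyMeasurable (Eventually.of_forall fun z => hφC _)
    have hg0 : Integrable (fun z => g z * φ z) μ := by simpa using hintg 0
    rw [htr, ← integral_sub hgi hg0]
    calc ‖∫ z, (g (z + s • e) * φ z - g z * φ z) ∂μ‖
        ≤ ∫ z, C * ‖g (z + s • e) - g z‖ ∂μ := by
          refine norm_integral_le_of_norm_le ((hgs.sub hg).norm.const_mul C)
            (Eventually.of_forall fun z => ?_)
          rw [← sub_mul, norm_mul, mul_comm]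
          gcongr
          exact hφC z
      _ ≤ C * ε := by
          rw [integral_const_mul]
          have : 0 ≤ C := (norm_nonneg _).trans (hφC 0)
          gcongr
          exact hε s (by rw [abs_of_nonneg hs.1]; exact hs.2)
  -- Mean value inequality for the integral minus its linear part in `s`; the derivative of the
  -- difference is the error made in translating `g`.
  have hmv := Convex.norm_image_sub_le_of_norm_hasDerivWithin_le
    (f := fun s : ℝ => ∫ z, u z * φ (z - s • e) ∂μ - s * ∫ z, g z * φ z ∂μ)
    (f' := fun s => ∫ z, g z * φ (z - s • e) ∂μ - ∫ z, g z * φ z ∂μ)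
    (s := Icc 0 k) (x := 0) (y := k) (C := C * ε)
    (fun s hs => ((hder s hs).sub (hasDerivAt_mul_const _)).hasDerivWithinAt) hbound
    (convex_Icc 0 k) ⟨le_rfl, hk⟩ ⟨hk, le_rfl⟩
  simp only [zero_smul, sub_zero, zero_mul, Real.norm_eq_abs, abs_of_nonneg hk] at hmv
  have h1 : ∫ z, (u (z + k • e) - u z) * φ z ∂μ =
      ∫ z, u z * φ (z - k • e) ∂μ - ∫ z, u z * φ z ∂μ := by
    rw [htr, ← integral_sub]
    · simp only [sub_mul]
    · exact (hu.comp_add_right _).mul_bdd (c := C) hφ.continuous.aestronglyMeasurable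
        (Eventually.of_forall fun z => hφC _)
    · simpa using hint 0
  rw [h1]
  refine le_trans (le_of_eq ?_) (hmv.trans (le_of_eq (by ring)))
  congr 1
  ring

/-- Dominated convergence replaces the test function by the indicator of a merely measurable set, as
is needed for level sets. The factor `2` is the uniform bound on the approximations. -/
theorem abs_setIntegral_translate_sub_le {z₀ : E} {r : ℝ} (hr : 0 < r) (hu : Integrable u μ)
    (hg : Integrable g μ)
    (h : ∀ φ : E → ℝ, ContDiff ℝ ((⊤ : ℕ∞) : WithTop ℕ∞) φ → HasCompactSupport φ →
      tsupport φ ⊆ Metric.ball z₀ (3 * r) →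
      ∫ z, u z * fderiv ℝ φ z e ∂μ = - ∫ z, g z * φ z ∂μ)
    {W : Set E} (hW : MeasurableSet W) (hWr : W ⊆ Metric.ball z₀ r)
    {k ε : ℝ} (hk : 0 ≤ k) (hkr : k * ‖e‖ < r)
    (hε : ∀ s : ℝ, |s| ≤ k → ∫ z, ‖g (z + s • e) - g z‖ ∂μ ≤ ε) :
    |∫ z in W, (u (z + k • e) - u z) ∂μ - k * ∫ z in W, g z ∂μ| ≤ k * (2 * ε) := by
  obtain ⟨ψ, h1, h2, h3, h4⟩ := exists_contDiff_tendsto_indicator (μ := μ) hW hr hWr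
  have hlim : ∀ w : E → ℝ, Integrable w μ →
      Tendsto (fun n => ∫ z, w z * ψ n z ∂μ) atTop (𝓝 (∫ z in W, w z ∂μ)) := by
    intro w hw
    rw [← integral_indicator hW]
    refine tendsto_integral_of_dominated_convergence (fun z => ‖w z‖ * 2)
      (fun n => hw.1.mul (h1 n).continuous.aestronglyMeasurable) (hw.norm.mul_const 2)
      (fun n => Eventually.of_forall fun z => ?_) ?_
    · rw [norm_mul]; gcongr; exact h2 n z
    · filter_upwards [h4] with z hz
      have := hz.const_mul (w z)
      convert this using 2
      by_cases hzW : z ∈ W <;> simp [hzW]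
  have hd := ((hlim _ ((hu.comp_add_right (k • e)).sub hu)).sub ((hlim g hg).const_mul k)).abs
  refine le_of_tendsto hd (Eventually.of_forall fun n => ?_)
  exact abs_integral_translate_sub_le hu hg h (h1 n) (h2 n) (h3 n) hk hkr hε

/-- On the part of the set that a small translation keeps inside the set, the increments of `u`
vanish, so the integral of `g` there is small. The remaining part has small measure by continuity of
translations. Hence the integral of `g` over the set is at most `0`, although `g > 0` there. No
chain rule is involved. -/
theorem measure_levelSet_inter_pos_eq_zero {z₀ : E} {r : ℝ} (hr : 0 < r) (hu : Integrable u μ)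
    (hg : Integrable g μ) (hum : Measurable u) (hgm : Measurable g)
    (h : ∀ φ : E → ℝ, ContDiff ℝ ((⊤ : ℕ∞) : WithTop ℕ∞) φ → HasCompactSupport φ →
      tsupport φ ⊆ Metric.ball z₀ (3 * r) →
      ∫ z, u z * fderiv ℝ φ z e ∂μ = - ∫ z, g z * φ z ∂μ) (c : ℝ) :
    μ ({z | u z = c} ∩ {z | 0 < g z} ∩ Metric.ball z₀ r) = 0 := by
  set Z : Set E := {z | u z = c} ∩ {z | 0 < g z} ∩ Metric.ball z₀ r with hZ
  have hu' : MeasurableSet {z | u z = c} := hum (measurableSet_singleton c)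
  have hZm : MeasurableSet Z :=
    (hu'.inter (measurableSet_lt measurable_const hgm)).inter measurableSet_ball
  have hZf : μ Z ≠ ∞ := ((measure_mono inter_subset_right).trans_lt measure_ball_lt_top).ne
  suffices H : ∫ z in Z, g z ∂μ ≤ 0 by
    have h0 : 0 ≤ᵐ[μ.restrict Z] g := by
      refine (ae_restrict_iff' hZm).2 (Eventually.of_forall fun z hz => hz.1.2.le)
    have h1 : ∫ z in Z, g z ∂μ = 0 := le_antisymm H (integral_nonneg_of_ae h0)
    rw [setIntegral_eq_zero_iff_of_nonneg_ae h0 hg.integrableOn] at h1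
    have h2 := (ae_restrict_iff' hZm).1 h1
    rw [ae_iff] at h2
    refine measure_mono_null (fun z hz => ?_) h2
    simp only [mem_ofPred_eq, Classical.not_imp]
    exact ⟨hz, hz.1.2.ne'⟩
  refine le_of_forall_pos_le_add fun ε hε => ?_
  rw [zero_add]
  -- The increment estimate on `W` costs `2 · ε/4`; the part of `Z` leaving `Z` takes the other
  -- `ε/2`.
  obtain ⟨h₀, hh₀, Hh₀⟩ := exists_forall_integral_translate_sub_le hg e (ε := ε / 4) (by positivity)
  let T : ℝ → C(E, E) := fun s => ⟨fun z => z + s • e, by fun_prop⟩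
  have hT : Continuous T := by
    refine ContinuousMap.continuous_of_continuous_uncurry _ ?_
    unfold Function.uncurry
    simp only [T, ContinuousMap.coe_mk]
    fun_prop
  have hm : ∀ s, MeasurePreserving (T s) μ μ := fun s => measurePreserving_add_right μ (s • e)
  have ht := tendsto_measure_symmDiff_preimage_nhds_zero (hT.tendsto 0)
    (Eventually.of_forall hm) (hm 0) hZm.nullMeasurableSet hZf
  have ht2 : Tendsto (fun s => ∫⁻ z in symmDiff (T s ⁻¹' Z) (T 0 ⁻¹' Z), ‖g z‖ₑ ∂μ) (𝓝 0) (𝓝 0) :=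
    tendsto_setLIntegral_zero hg.2.ne ht
  have he2 : ENNReal.ofReal (ε / 2) > 0 := by simpa using hε
  have hev := (ht2.eventually (gt_mem_nhds he2)).filter_mono
    (nhdsWithin_le_nhds (s := Ioi (0 : ℝ)))
  have hev2 : ∀ᶠ k : ℝ in 𝓝[>] 0, k ≤ h₀ ∧ k * ‖e‖ < r := by
    have a1 : ∀ᶠ k : ℝ in 𝓝 0, k * ‖e‖ < r :=
      (Continuous.tendsto' (by fun_prop) (0 : ℝ) 0 (by simp)).eventually (gt_mem_nhds hr)
    exact ((ge_mem_nhds hh₀).and a1).filter_mono nhdsWithin_le_nhds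
  obtain ⟨k, hk1, ⟨hk2, hk3⟩, hk0⟩ := (hev.and (hev2.and self_mem_nhdsWithin)).exists
  have hk0 : 0 < k := hk0
  set W := Z ∩ T k ⁻¹' Z with hWdef
  have hWm : MeasurableSet W := hZm.inter ((T k).continuous.measurable hZm)
  have hb := abs_setIntegral_translate_sub_le hr hu hg h hWm
    (inter_subset_left.trans inter_subset_right) hk0.le hk3
    (fun s hs => Hh₀ s (hs.trans hk2))
  have hz : ∫ z in W, (u (z + k • e) - u z) ∂μ = 0 := by
    rw [setIntegral_congr_fun hWm (g := fun _ => (0 : ℝ))]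
    · simp
    · intro z hz
      have e1 : u z = c := hz.1.1.1
      have e2 : u (z + k • e) = c := hz.2.1.1
      simp [e1, e2]
  rw [hz, zero_sub, abs_neg, abs_mul, abs_of_pos hk0] at hb
  have hb2 := le_of_abs_le (le_of_mul_le_mul_left hb hk0)
  have hdecomp : ∫ z in Z, g z ∂μ = ∫ z in W, g z ∂μ + ∫ z in Z \ T k ⁻¹' Z, g z ∂μ :=
    (integral_inter_add_sdiff ((T k).continuous.measurable hZm) hg.integrableOn).symm
  have hrem : ∫ z in Z \ T k ⁻¹' Z, g z ∂μ ≤ ε / 2 := by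
    refine (le_abs_self _).trans ?_
    rw [← Real.norm_eq_abs]
    refine (norm_integral_le_lintegral_norm _).trans ?_
    refine ENNReal.toReal_le_of_le_ofReal (by positivity) ?_
    simp only [ofReal_norm]
    refine le_trans (lintegral_mono_set ?_) hk1.le
    intro z hz
    refine Or.inr ⟨?_, hz.2⟩
    simpa [T] using hz.1
  linarith

/-- A weak directional derivative vanishes almost everywhere on the level sets. -/
theorem ae_weakDeriv_eq_zero_of_levelSet {U : Set E} (hU : IsOpen U)
    (hu : LocallyIntegrableOn u U μ) (hg : LocallyIntegrableOn g U μ)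
    (h : ∀ φ : E → ℝ, ContDiff ℝ ((⊤ : ℕ∞) : WithTop ℕ∞) φ → HasCompactSupport φ →
      tsupport φ ⊆ U → ∫ z in U, u z * fderiv ℝ φ z e ∂μ = - ∫ z in U, g z * φ z ∂μ) (c : ℝ) :
    ∀ᵐ z ∂μ, z ∈ U → u z = c → g z = 0 := by
  have : {z | ¬ (z ∈ U → u z = c → g z = 0)} = {z | z ∈ U ∧ u z = c ∧ g z ≠ 0} := by
    ext z; simp
  rw [ae_iff, this]
  refine measure_null_of_locally_null _ fun z₀ hz₀ => ?_
  obtain ⟨ρ, hρ, hρU⟩ := Metric.isOpen_iff.1 hU z₀ hz₀.1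
  set r := ρ / 4 with hr
  have hr0 : 0 < r := by positivity
  have hKU : Metric.closedBall z₀ (3 * r) ⊆ U :=
    (Metric.closedBall_subset_ball (by rw [hr]; linarith)).trans hρU
  set K := Metric.closedBall z₀ (3 * r) with hK
  have hKm : MeasurableSet K := measurableSet_closedBall
  have hui : IntegrableOn u K μ := hu.integrableOn_compact_subset hKU (isCompact_closedBall _ _)
  have hgi : IntegrableOn g K μ := hg.integrableOn_compact_subset hKU (isCompact_closedBall _ _)
  have hui' := (integrable_indicator_iff hKm).2 hui
  have hgi' := (integrable_indicator_iff hKm).2 hgi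
  -- Cutting off outside a compact ball makes both functions integrable on the whole space;
  -- measurable representatives make their level sets measurable.
  set u₁ := hui'.1.mk with hu₁
  set g₁ := hgi'.1.mk with hg₁
  have hue : K.indicator u =ᵐ[μ] u₁ := hui'.1.ae_eq_mk
  have hge : K.indicator g =ᵐ[μ] g₁ := hgi'.1.ae_eq_mk
  have hu₁i : Integrable u₁ μ := hui'.congr hue
  have hg₁i : Integrable g₁ μ := hgi'.congr hge
  have htest : ∀ φ : E → ℝ, ContDiff ℝ ((⊤ : ℕ∞) : WithTop ℕ∞) φ → HasCompactSupport φ →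
      tsupport φ ⊆ Metric.ball z₀ (3 * r) →
      ∫ z, u₁ z * fderiv ℝ φ z e ∂μ = - ∫ z, g₁ z * φ z ∂μ := by
    intro φ hφ hφc hφs
    have hφK : tsupport φ ⊆ K := hφs.trans Metric.ball_subset_closedBall
    have := h φ hφ hφc (hφK.trans hKU)
    rw [setIntegral_eq_integral_of_forall_compl_eq_zero,
      setIntegral_eq_integral_of_forall_compl_eq_zero] at this
    · convert this using 1
      · refine integral_congr_ae ?_
        filter_upwards [hue] with z hz
        rw [← hz]
        by_cases hzK : z ∈ K
        · simp [hzK]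
        · have : fderiv ℝ φ z = 0 := by
            by_contra h0
            exact hzK (hφK (support_fderiv_subset ℝ h0))
          simp [this]
      · congr 1
        refine integral_congr_ae ?_
        filter_upwards [hge] with z hz
        rw [← hz]
        by_cases hzK : z ∈ K
        · simp [hzK]
        · simp [image_eq_zero_of_notMem_tsupport (fun h0 => hzK (hφK h0))]
    · intro z hz
      simp [image_eq_zero_of_notMem_tsupport (fun h0 => hz (hKU (hφK h0)))]
    · intro z hz
      have : fderiv ℝ φ z = 0 := by
        by_contra h0
        exact hz (hKU (hφK (support_fderiv_subset ℝ h0)))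
      simp [this]
  have hp := measure_levelSet_inter_pos_eq_zero hr0 hu₁i hg₁i hui'.1.stronglyMeasurable_mk.measurable
    hgi'.1.stronglyMeasurable_mk.measurable htest c
  -- The part where `g < 0` is covered by the pair `-u`, `-g` at the level `-c`.
  have hn := measure_levelSet_inter_pos_eq_zero (u := fun z => -u₁ z) (g := fun z => -g₁ z) hr0
    hu₁i.neg hg₁i.neg hui'.1.stronglyMeasurable_mk.measurable.neg
    hgi'.1.stronglyMeasurable_mk.measurable.neg
    (fun φ h1 h2 h3 => by
      simp only [neg_mul, integral_neg]
      rw [htest φ h1 h2 h3]) (-c)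
  refine ⟨{z | z ∈ U ∧ u z = c ∧ g z ≠ 0} ∩ Metric.ball z₀ r,
    inter_mem_nhdsWithin _ (Metric.ball_mem_nhds z₀ hr0), ?_⟩
  have hae : ∀ᵐ z ∂μ, ¬ ((z ∈ U ∧ u z = c ∧ g z ≠ 0) ∧ z ∈ Metric.ball z₀ r) := by
    filter_upwards [hue, hge, measure_eq_zero_iff_ae_notMem.1 hp,
      measure_eq_zero_iff_ae_notMem.1 hn] with z h1 h2 h3 h4
    rintro ⟨⟨_, h5, h6⟩, h7⟩
    have hzK : z ∈ K := Metric.ball_subset_closedBall (Metric.ball_subset_ball (by linarith) h7)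
    rw [indicator_of_mem hzK] at h1 h2
    rcases lt_or_gt_of_ne h6 with h8 | h8
    · exact h4 ⟨⟨by simp [← h1, h5], by simpa [← h2] using h8⟩, h7⟩
    · exact h3 ⟨⟨by simp [← h1, h5], by simpa [← h2] using h8⟩, h7⟩
  exact measure_eq_zero_iff_ae_notMem.2 hae

end WeakDerivative

/-! ### Weak gradients in velocity: uniqueness and change of variables. -/

namespace Kinetic

variable {d : ℕ}

instance : ((volume : Measure (EuclideanSpace ℝ (Fin d))).prod
    (volume : Measure (EuclideanSpace ℝ (Fin d)))).IsAddHaarMeasure :=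
  Measure.prod.instIsAddHaarMeasure _ _

instance : (volume : Measure (Ph d)).IsAddHaarMeasure :=
  Measure.prod.instIsAddHaarMeasure (volume : Measure ℝ)
    ((volume : Measure (EuclideanSpace ℝ (Fin d))).prod
      (volume : Measure (EuclideanSpace ℝ (Fin d))))

theorem integrableOn_mul_of_tsupport_subset {Ω : Set (Ph d)} {f φ : Ph d → ℝ}
    (hf : LocallyIntegrableOn f Ω volume) (hφ : Continuous φ) (hc : HasCompactSupport φ)
    (hs : tsupport φ ⊆ Ω) : Integrable (fun z => f z * φ z) volume := by
  have hK : IntegrableOn f (tsupport φ) volume := hf.integrableOn_compact_subset hs hc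
  obtain ⟨C, hC⟩ := hc.exists_bound_of_continuous hφ
  have h1 : IntegrableOn (fun z => f z * φ z) (tsupport φ) volume :=
    hK.mul_bdd (c := C) hφ.aestronglyMeasurable (Eventually.of_forall hC)
  refine (integrableOn_iff_integrable_of_support_subset fun z hz => ?_).1 h1
  by_contra h
  exact hz (by simp [image_eq_zero_of_notMem_tsupport h])

theorem fderiv_apply_continuous {φ : Ph d → ℝ} (hφ : ContDiff ℝ ((⊤ : ℕ∞) : WithTop ℕ∞) φ)
    (e : Ph d) : Continuous fun z => fderiv ℝ φ z e :=
  (hφ.continuous_fderiv (by simp)).clm_apply continuous_const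

theorem HasWeakGradV.sub {Ω : Set (Ph d)} {f f' : Ph d → ℝ}
    {G G' : Ph d → EuclideanSpace ℝ (Fin d)} (h : HasWeakGradV Ω f G) (h' : HasWeakGradV Ω f' G') :
    HasWeakGradV Ω (fun z => f z - f' z) (fun z => G z - G' z) := by
  refine ⟨h.1.sub h'.1, h.2.sub h'.2, fun φ h1 h2 h3 i => ?_⟩
  have hd : HasCompactSupport fun z => fderiv ℝ φ z (0, 0, EuclideanSpace.single i 1) :=
    h2.fderiv_apply (𝕜 := ℝ) _
  have hds := (tsupport_fderiv_apply_subset ℝ (f := φ)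
    ((0, 0, EuclideanSpace.single i 1) : Ph d)).trans h3
  have hG : ∀ {G : Ph d → EuclideanSpace ℝ (Fin d)}, LocallyIntegrableOn G Ω volume →
      Integrable (fun z => G z i * φ z) volume := fun {G} hG =>
    integrableOn_mul_of_tsupport_subset
      (fun z hz => (hG z hz).imp fun s hs => ⟨hs.1, ContinuousLinearMap.integrable_comp (EuclideanSpace.proj (𝕜 := ℝ) i) hs.2⟩)
      h1.continuous h2 h3
  have hc := fderiv_apply_continuous h1 (0, 0, EuclideanSpace.single i 1)
  have e1 := h.3 φ h1 h2 h3 i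
  have e2 := h'.3 φ h1 h2 h3 i
  simp only [PiLp.sub_apply, sub_mul]
  rw [integral_sub (integrableOn_mul_of_tsupport_subset h.1 hc hd hds).integrableOn
    (integrableOn_mul_of_tsupport_subset h'.1 hc hd hds).integrableOn, e1, e2,
    integral_sub (hG h.2).integrableOn (hG h'.2).integrableOn]
  ring

theorem measurableSet_domain {a b : ℝ} {Ωx Ωv : Set (EuclideanSpace ℝ (Fin d))} (hx : IsOpen Ωx)
    (hv : IsOpen Ωv) : MeasurableSet (domain a b Ωx Ωv) :=
  measurableSet_Ioc.prod (hx.measurableSet.prod hv.measurableSet)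

/-- The weak gradient vanishes almost everywhere on the level sets. -/
theorem HasWeakGradV.ae_eq_zero {a b : ℝ} {Ωx Ωv : Set (EuclideanSpace ℝ (Fin d))}
    (hx : IsOpen Ωx) (hv : IsOpen Ωv) {f : Ph d → ℝ} {G : Ph d → EuclideanSpace ℝ (Fin d)}
    (h : HasWeakGradV (domain a b Ωx Ωv) f G) (c : ℝ) :
    ∀ᵐ z ∂volume.restrict (domain a b Ωx Ωv), f z = c → G z = 0 := by
  set U : Set (Ph d) := Ioo a b ×ˢ (Ωx ×ˢ Ωv) with hU
  have hUo : IsOpen U := isOpen_Ioo.prod (hx.prod hv)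
  have hUΩ : U ⊆ domain a b Ωx Ωv := prod_mono Ioo_subset_Ioc_self Subset.rfl
  have hint : ∀ w : Ph d → ℝ, (∀ z, z ∉ U → w z = 0) →
      ∫ z in domain a b Ωx Ωv, w z = ∫ z in U, w z := fun w hw => by
    rw [setIntegral_eq_integral_of_forall_compl_eq_zero fun z hz => hw z fun h => hz (hUΩ h),
      setIntegral_eq_integral_of_forall_compl_eq_zero hw]
  have key : ∀ i, ∀ᵐ z, z ∈ U → f z = c → G z i = 0 := by
    intro i
    refine ae_weakDeriv_eq_zero_of_levelSet (e := (0, 0, EuclideanSpace.single i 1)) hUo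
      (h.1.mono_set hUΩ) (fun z hz => ((h.2.mono_set hUΩ) z hz).imp fun s hs =>
        ⟨hs.1, ContinuousLinearMap.integrable_comp (EuclideanSpace.proj (𝕜 := ℝ) i) hs.2⟩) (fun φ h1 h2 h3 => ?_) c
    have := h.3 φ h1 h2 (h3.trans hUΩ) i
    rwa [hint, hint] at this
    · intro z hz
      simp [image_eq_zero_of_notMem_tsupport (fun h0 => hz (h3 h0))]
    · intro z hz
      have : fderiv ℝ φ z = 0 := by
        by_contra h0
        exact hz (h3 (support_fderiv_subset ℝ h0))
      simp [this]
  -- The domain contains its final time slice and is not open; that slice is a null set.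
  have hface : ∀ᵐ z : Ph d, z.1 ≠ b := by
    have : (volume : Measure (Ph d)) ((fun z : Ph d => z.1) ⁻¹' {b}) = 0 :=
      (Measure.quasiMeasurePreserving_fst (μ := (volume : Measure ℝ))
        (ν := (volume : Measure (EuclideanSpace ℝ (Fin d) × EuclideanSpace ℝ (Fin d))))).preimage_null
        (measure_singleton b)
    exact measure_eq_zero_iff_ae_notMem.1 this
  refine (ae_restrict_iff' (measurableSet_domain hx hv)).2 ?_
  filter_upwards [ae_all_iff.2 key, hface] with z h1 h2 hz hfz
  ext i
  exact h1 i ⟨⟨hz.1.1, lt_of_le_of_ne hz.1.2 h2⟩, hz.2⟩ hfz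

/-- Weak gradients are unique. -/
theorem HasWeakGradV.ae_eq {a b : ℝ} {Ωx Ωv : Set (EuclideanSpace ℝ (Fin d))}
    (hx : IsOpen Ωx) (hv : IsOpen Ωv) {f : Ph d → ℝ} {G G' : Ph d → EuclideanSpace ℝ (Fin d)}
    (h : HasWeakGradV (domain a b Ωx Ωv) f G) (h' : HasWeakGradV (domain a b Ωx Ωv) f G') :
    ∀ᵐ z ∂volume.restrict (domain a b Ωx Ωv), G z = G' z := by
  filter_upwards [(h.sub h').ae_eq_zero hx hv 0] with z hz
  exact sub_eq_zero.1 (hz (sub_self _))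

theorem measurableEmbedding_dil (z₀ : Ph d) {ρ : ℝ} (hρ : 0 < ρ) : MeasurableEmbedding (dil z₀ ρ) :=
  (dilHomeo z₀ hρ.ne').measurableEmbedding

theorem map_dil_restrict (z₀ : Ph d) {ρ : ℝ} (hρ : 0 < ρ) (B : Set (Ph d)) :
    Measure.map (dil z₀ ρ) (volume.restrict B) =
      ENNReal.ofReal ((ρ ^ (4 * d + 2))⁻¹) • volume.restrict (dil z₀ ρ '' B) := by
  have he := measurableEmbedding_dil z₀ hρ
  have h := he.restrict_map volume (dil z₀ ρ '' B)
  rw [preimage_image_eq _ he.injective] at h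
  rw [← h, map_dil z₀ hρ, Measure.restrict_smul]

theorem integral_dil (z₀ : Ph d) {ρ : ℝ} (hρ : 0 < ρ) (F : Ph d → ℝ) :
    ∫ z, F (dil z₀ ρ z) = (ρ ^ (4 * d + 2))⁻¹ * ∫ z, F z := by
  rw [← (measurableEmbedding_dil z₀ hρ).integral_map, map_dil z₀ hρ, integral_smul_measure,
    ENNReal.toReal_ofReal (by positivity), smul_eq_mul]

theorem dil_add_smul (z₀ : Ph d) (ρ s : ℝ) (z : Ph d) (e : EuclideanSpace ℝ (Fin d)) :
    dil z₀ ρ (z + s • (0, 0, e)) = dil z₀ ρ z + (ρ * s) • (0, 0, e) := by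
  simp only [dil, comp, scale]
  ext1
  · simp
  · ext1
    · simp
    · simp only [Prod.snd_add, Prod.smul_snd]; module

/-- Constants have zero weak gradient; this removes `κ` from the weak formulation for `κ - F ∘ dil`.
-/
theorem integral_fderiv_eq_zero {ψ : Ph d → ℝ} (hψ : ContDiff ℝ ((⊤ : ℕ∞) : WithTop ℕ∞) ψ)
    (hc : HasCompactSupport ψ) (e : Ph d) : ∫ z, fderiv ℝ ψ z e = 0 := by
  have hd : HasCompactSupport fun z => fderiv ℝ ψ z e := hc.fderiv_apply (𝕜 := ℝ) _
  have := integral_mul_fderiv_eq_neg_fderiv_mul_of_integrable (μ := (volume : Measure (Ph d)))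
    (f := fun _ : Ph d => (1 : ℝ)) (g := ψ) (v := e) (by simp)
    (by simpa using (fderiv_apply_continuous hψ e).integrable_of_hasCompactSupport hd)
    (by simpa using hψ.continuous.integrable_of_hasCompactSupport hc)
    (fun x _ => by fun_prop) (fun x _ => hψ.differentiable (by simp) x)
  simpa using this

/-- Weak gradients under the change of variables `dil`. -/
theorem HasWeakGradV.const_sub_dil {Ω B : Set (Ph d)} {F : Ph d → ℝ}
    {H : Ph d → EuclideanSpace ℝ (Fin d)} (h : HasWeakGradV Ω F H) {z₀ : Ph d} {ρ : ℝ} (hρ : 0 < ρ)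
    (hB : dil z₀ ρ '' B ⊆ Ω) (κ : ℝ)
    (hF : LocallyIntegrableOn (fun z => κ - F (dil z₀ ρ z)) B volume)
    (hH : LocallyIntegrableOn (fun z => -(ρ • H (dil z₀ ρ z))) B volume) :
    HasWeakGradV B (fun z => κ - F (dil z₀ ρ z)) (fun z => -(ρ • H (dil z₀ ρ z))) := by
  refine ⟨hF, hH, fun ψ h1 h2 h3 i => ?_⟩
  set Φ := dilHomeo z₀ hρ.ne' with hΦ
  have hΦd : ∀ z, Φ z = dil z₀ ρ z := fun z => rfl
  set ψ' : Ph d → ℝ := fun z => ψ (Φ.symm z) with hψ'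
  have hψd : ∀ z, ψ' (dil z₀ ρ z) = ψ z := fun z => by
    rw [hψ', ← hΦd]; simp
  have hsm : ContDiff ℝ ((⊤ : ℕ∞) : WithTop ℕ∞) ψ' := by
    refine h1.comp ?_
    change ContDiff ℝ _ fun z => scale ρ⁻¹ (comp (inv z₀) z)
    unfold scale comp
    fun_prop
  have hts : tsupport ψ' = dil z₀ ρ '' tsupport ψ := by
    have := tsupport_comp_eq_preimage ψ Φ.symm
    rw [show ψ' = ψ ∘ Φ.symm from rfl, this, Homeomorph.preimage_symm]
    rfl
  have hcs : HasCompactSupport ψ' := h2.comp_homeomorph Φ.symm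
  have hsub : tsupport ψ' ⊆ Ω := hts ▸ (image_mono h3).trans hB
  set e : Ph d := (0, 0, EuclideanSpace.single i 1) with he
  -- Along a velocity direction the affine map `dil` is multiplication by `ρ`, whence the factor `ρ`
  -- in the gradient.
  have hfd : ∀ z, fderiv ℝ ψ z e = ρ * fderiv ℝ ψ' (dil z₀ ρ z) e := fun z => by
    have d1 := (h1.differentiable (by simp) z).lineDeriv_eq_fderiv (v := e)
    have d2 := (hsm.differentiable (by simp) (dil z₀ ρ z)).lineDeriv_eq_fderiv (v := ρ • e)
    rw [← d1, ← smul_eq_mul, ← map_smul, ← d2, lineDeriv, lineDeriv]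
    congr 1
    ext1 s
    rw [← hψd, he, dil_add_smul, smul_smul, mul_comm]
  have key := h.3 ψ' hsm hcs hsub i
  rw [setIntegral_eq_integral_of_forall_compl_eq_zero,
    setIntegral_eq_integral_of_forall_compl_eq_zero] at key
  rotate_left
  · intro z hz
    simp [image_eq_zero_of_notMem_tsupport (fun h0 => hz (hsub h0))]
  · intro z hz
    have : fderiv ℝ ψ' z = 0 := by
      by_contra h0
      exact hz (hsub (support_fderiv_subset ℝ h0))
    simp [this]
  have c1 := integral_dil z₀ hρ fun z => F z * fderiv ℝ ψ' z e
  have c2 := integral_dil z₀ hρ fun z => H z i * ψ' z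
  simp only [hψd] at c2
  have hz1 := integral_fderiv_eq_zero h1 h2 e
  have hcd := fderiv_apply_continuous h1 e
  have hd : HasCompactSupport fun z => fderiv ℝ ψ z e := h2.fderiv_apply (𝕜 := ℝ) _
  have hds := (tsupport_fderiv_apply_subset ℝ (f := ψ) e).trans h3
  rw [setIntegral_eq_integral_of_forall_compl_eq_zero,
    setIntegral_eq_integral_of_forall_compl_eq_zero]
  rotate_left
  · intro z hz
    simp [image_eq_zero_of_notMem_tsupport (fun h0 => hz (h3 h0))]
  · intro z hz
    have : fderiv ℝ ψ z e = 0 := by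
      by_contra h0
      exact hz (hds (subset_tsupport _ h0))
    simp [this]
  have i1 := integrableOn_mul_of_tsupport_subset hF hcd hd hds
  have i2 : Integrable (fun z => κ * fderiv ℝ ψ z e) volume :=
    (hcd.integrable_of_hasCompactSupport hd).const_mul κ
  have e1 : ∫ z, F (dil z₀ ρ z) * fderiv ℝ ψ z e =
      - ∫ z, (κ - F (dil z₀ ρ z)) * fderiv ℝ ψ z e := by
    have : ∀ z, F (dil z₀ ρ z) * fderiv ℝ ψ z e =
        κ * fderiv ℝ ψ z e - (κ - F (dil z₀ ρ z)) * fderiv ℝ ψ z e := fun z => by ring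
    simp only [this]
    rw [integral_sub i2 i1, integral_const_mul, hz1]
    ring
  have e2 : ∫ z, F (dil z₀ ρ z) * fderiv ℝ ψ z e =
      ρ * ∫ z, F (dil z₀ ρ z) * fderiv ℝ ψ' (dil z₀ ρ z) e := by
    rw [← integral_const_mul]
    refine integral_congr_ae (Eventually.of_forall fun z => ?_)
    simp only [hfd]; ring
  have e3 : ∫ z, (-(ρ • H (dil z₀ ρ z))) i * ψ z = -(ρ * ∫ z, H (dil z₀ ρ z) i * ψ z) := by
    rw [← integral_const_mul, ← integral_neg]
    refine integral_congr_ae (Eventually.of_forall fun z => ?_)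
    simp only [PiLp.neg_apply, PiLp.smul_apply, smul_eq_mul]; ring
  rw [e3, c2, neg_neg]
  rw [e2, c1, key] at e1
  linarith


/-! ### Kinetic cylinders: Vitali covering and density points. -/

/-- The open kinetic cylinder of radius `r`, symmetric in time around `z`. -/
def ocyl (r : ℝ) (z : Ph d) : Set (Ph d) :=
  {y | |y.1 - z.1| < r ^ 2 ∧ ‖y.2.1 - z.2.1 - (y.1 - z.1) • z.2.2‖ < r ^ 3 ∧ ‖y.2.2 - z.2.2‖ < r}

theorem isOpen_ocyl (r : ℝ) (z : Ph d) : IsOpen (ocyl r z) := by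
  have h1 : IsOpen {y : Ph d | |y.1 - z.1| < r ^ 2} := isOpen_lt (by fun_prop) (by fun_prop)
  have h2 : IsOpen {y : Ph d | ‖y.2.1 - z.2.1 - (y.1 - z.1) • z.2.2‖ < r ^ 3} :=
    isOpen_lt (by fun_prop) (by fun_prop)
  have h3 : IsOpen {y : Ph d | ‖y.2.2 - z.2.2‖ < r} := isOpen_lt (by fun_prop) (by fun_prop)
  exact h1.inter (h2.inter h3)

theorem self_mem_ocyl {r : ℝ} (hr : 0 < r) (z : Ph d) : z ∈ ocyl r z := by
  simp [ocyl, hr]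

theorem cyl_subset_ocyl {r : ℝ} (hr : 0 < r) (z : Ph d) : cyl r z ⊆ ocyl r z := by
  intro y hy
  obtain ⟨⟨h1, h2⟩, h3, h4⟩ := mem_comp_box.1 hy
  exact ⟨abs_lt.2 ⟨h1, h2.trans_lt (by positivity)⟩, h3, h4⟩

theorem unitVol_mul_le_volume_ocyl {r : ℝ} (hr : 0 < r) (z : Ph d) :
    ENNReal.ofReal (unitVol d * r ^ (4 * d + 2)) ≤ volume (ocyl r z) :=
  (volume_cyl z hr).symm.le.trans (measure_mono (cyl_subset_ocyl hr z))

/-- The Galilean drift between the two cylinders is harmless: their velocities differ by less than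
`3s` over a duration of at most `8s²`. The factor `5` is dictated by velocity, `2s + 3s`; time and
position leave room. -/
theorem ocyl_subset_of_inter_nonempty {r s : ℝ} (hr : 0 < r) (hrs : r ≤ 2 * s) {z z' : Ph d}
    (h : (ocyl r z ∩ ocyl s z').Nonempty) : ocyl r z ⊆ ocyl (5 * s) z' := by
  obtain ⟨w, ⟨w1, w2, w3⟩, w4, w5, w6⟩ := h
  rintro y ⟨y1, y2, y3⟩
  have hs : 0 < s := by linarith
  have hr2 : r ^ 2 ≤ 4 * s ^ 2 := by nlinarith
  have hr3 : r ^ 3 ≤ 8 * s ^ 3 := by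
    calc r ^ 3 ≤ (2 * s) ^ 3 := by gcongr
      _ = _ := by ring
  have hs2 : 0 < s ^ 2 := by positivity
  have hs3 : 0 < s ^ 3 := by positivity
  have hv : ‖z.2.2 - z'.2.2‖ < 3 * s := by
    have e : z.2.2 - z'.2.2 = (w.2.2 - z'.2.2) - (w.2.2 - z.2.2) := by abel
    rw [e]
    linarith [norm_sub_le (w.2.2 - z'.2.2) (w.2.2 - z.2.2)]
  rw [abs_lt] at y1 w1 w4
  refine ⟨?_, ?_, ?_⟩
  · rw [abs_lt]; constructor <;> nlinarith
  · have e : y.2.1 - z'.2.1 - (y.1 - z'.1) • z'.2.2 =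
        (y.2.1 - z.2.1 - (y.1 - z.1) • z.2.2) - (w.2.1 - z.2.1 - (w.1 - z.1) • z.2.2) +
          (w.2.1 - z'.2.1 - (w.1 - z'.1) • z'.2.2) + (y.1 - w.1) • (z.2.2 - z'.2.2) := by
      module
    rw [e]
    have h1 : ‖(y.1 - w.1) • (z.2.2 - z'.2.2)‖ ≤ (8 * s ^ 2) * (3 * s) := by
      rw [norm_smul, Real.norm_eq_abs]
      have : |y.1 - w.1| ≤ 8 * s ^ 2 := by rw [abs_le]; constructor <;> linarith
      gcongr
    have h2 := norm_add_le ((y.2.1 - z.2.1 - (y.1 - z.1) • z.2.2) -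
      (w.2.1 - z.2.1 - (w.1 - z.1) • z.2.2) + (w.2.1 - z'.2.1 - (w.1 - z'.1) • z'.2.2))
      ((y.1 - w.1) • (z.2.2 - z'.2.2))
    have h3 := norm_add_le ((y.2.1 - z.2.1 - (y.1 - z.1) • z.2.2) -
      (w.2.1 - z.2.1 - (w.1 - z.1) • z.2.2)) (w.2.1 - z'.2.1 - (w.1 - z'.1) • z'.2.2)
    have h4 := norm_sub_le (y.2.1 - z.2.1 - (y.1 - z.1) • z.2.2)
      (w.2.1 - z.2.1 - (w.1 - z.1) • z.2.2)
    have : (8 * s ^ 2) * (3 * s) = 24 * s ^ 3 := by ring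
    have : (5 * s) ^ 3 = 125 * s ^ 3 := by ring
    linarith
  · have e : y.2.2 - z'.2.2 = (y.2.2 - z.2.2) + (z.2.2 - z'.2.2) := by abel
    rw [e]
    linarith [norm_add_le (y.2.2 - z.2.2) (z.2.2 - z'.2.2)]

/-- Covering argument: if around each point of `E'` there is a cylinder which meets `F` in a
sizeable set, and whose enlargement meets `E` in a small set, then `E'` is small compared to `F`. -/
theorem measure_le_of_forall_ocyl {E E' F : Set (Ph d)} {a b : ℝ≥0∞} {R : ℝ} (r : Ph d → ℝ)
    (hE : E' ⊆ E) (hr : ∀ z ∈ E', 0 < r z) (hrR : ∀ z ∈ E', r z ≤ R)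
    (h1 : ∀ z ∈ E', volume (E ∩ ocyl (5 * r z) z) ≤ a * ENNReal.ofReal (r z ^ (4 * d + 2)))
    (h2 : ∀ z ∈ E', b * ENNReal.ofReal (r z ^ (4 * d + 2)) ≤ volume (F ∩ ocyl (r z) z)) :
    b * volume E' ≤ a * volume F := by
  obtain ⟨u, hu, hdis, hcov⟩ := Vitali.exists_disjoint_subfamily_covering_enlargement
    (fun z => ocyl (r z) z) E' r 2 (by norm_num) (fun z hz => (hr z hz).le) R hrR
    (fun z hz => ⟨z, self_mem_ocyl (hr z hz) z⟩)
  have hcount : u.Countable := hdis.countable_of_isOpen (fun z _ => isOpen_ocyl _ _)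
    (fun z hz => ⟨z, self_mem_ocyl (hr z (hu hz)) z⟩)
  have hsub : E' ⊆ ⋃ z ∈ u, E ∩ ocyl (5 * r z) z := by
    intro z hz
    obtain ⟨w, hw, hne, hle⟩ := hcov z hz
    exact mem_biUnion hw ⟨hE hz, ocyl_subset_of_inter_nonempty (hr z hz) hle hne
      (self_mem_ocyl (hr z hz) z)⟩
  -- `F` need not be measurable: additivity over the disjoint cylinders is that of the restricted
  -- measure.
  have hF : ∑' z : u, volume (F ∩ ocyl (r z) (z : Ph d)) ≤ volume F := by
    have e : ∀ z : u, volume (F ∩ ocyl (r z) (z : Ph d)) = volume.restrict F (ocyl (r z) z) :=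
      fun z => by rw [Measure.restrict_apply (isOpen_ocyl _ _).measurableSet, inter_comm]
    simp only [e]
    rw [← measure_biUnion hcount hdis (fun z _ => (isOpen_ocyl _ _).measurableSet)]
    exact (measure_mono (subset_univ _)).trans (by simp)
  calc b * volume E' ≤ b * ∑' z : u, volume (E ∩ ocyl (5 * r z) (z : Ph d)) := by
        gcongr
        exact (measure_mono hsub).trans (measure_biUnion_le _ hcount _)
    _ ≤ b * ∑' z : u, a * ENNReal.ofReal (r z ^ (4 * d + 2)) := by
        gcongr with z
        exact h1 z (hu z.2)
    _ = a * ∑' z : u, b * ENNReal.ofReal (r z ^ (4 * d + 2)) := by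
        rw [ENNReal.tsum_mul_left, ENNReal.tsum_mul_left, ← mul_assoc, ← mul_assoc, mul_comm a b]
    _ ≤ a * ∑' z : u, volume (F ∩ ocyl (r z) (z : Ph d)) := by
        gcongr with z
        exact h2 z (hu z.2)
    _ ≤ a * volume F := by gcongr

/-- Inside an open set there are small cylinders around each point. -/
theorem exists_ocyl_subset {O : Set (Ph d)} (hO : IsOpen O) {z : Ph d} (hz : z ∈ O) :
    ∃ δ > 0, ∀ r, 0 < r → r < δ → ocyl r z ⊆ O := by
  obtain ⟨ε, hε, h⟩ := Metric.isOpen_iff.1 hO z hz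
  refine ⟨min 1 (ε / (2 + ‖z.2.2‖)), by positivity, fun r hr hrd => ?_⟩
  have hr1 : r < 1 := hrd.trans_le (min_le_left _ _)
  have hr2 : r * (2 + ‖z.2.2‖) < ε := (lt_div_iff₀ (by positivity)).1 (hrd.trans_le (min_le_right _ _))
  rintro y ⟨h1, h2, h3⟩
  have hn := norm_nonneg z.2.2
  have hrr : r ^ 2 ≤ r := by nlinarith
  have hr3 : r ^ 3 ≤ r := by nlinarith [sq_nonneg r]
  refine h ?_
  rw [Metric.mem_ball, dist_eq_norm, Prod.norm_def, Prod.norm_def]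
  simp only [Prod.fst_sub, Prod.snd_sub, Real.norm_eq_abs]
  refine max_lt ?_ (max_lt ?_ ?_)
  · nlinarith
  · have e : y.2.1 - z.2.1 = (y.2.1 - z.2.1 - (y.1 - z.1) • z.2.2) + (y.1 - z.1) • z.2.2 := by
      abel
    rw [e]
    have h4 : ‖(y.1 - z.1) • z.2.2‖ ≤ r * ‖z.2.2‖ := by
      rw [norm_smul, Real.norm_eq_abs]; gcongr; linarith
    linarith [norm_add_le (y.2.1 - z.2.1 - (y.1 - z.1) • z.2.2) ((y.1 - z.1) • z.2.2)]
  · nlinarith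

/-- A weak form of the Lebesgue density theorem for kinetic cylinders. -/
theorem measure_setOf_forall_small_density {E : Set (Ph d)} (hE : volume E ≠ ∞) {c R : ℝ}
    (hc : 0 < c) (hR : 0 < R) (hcv : 2 * (c * 5 ^ (4 * d + 2)) < unitVol d) :
    volume {z ∈ E | ∀ r, 0 < r → r ≤ R →
      volume (E ∩ ocyl r z) < ENNReal.ofReal (c * r ^ (4 * d + 2))} = 0 := by
  set N := {z ∈ E | ∀ r, 0 < r → r ≤ R →
      volume (E ∩ ocyl r z) < ENNReal.ofReal (c * r ^ (4 * d + 2))} with hN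
  have hNE : N ⊆ E := fun z hz => hz.1
  have hNf : volume N ≠ ∞ := ((measure_mono hNE).trans_lt hE.lt_top).ne
  by_contra h0
  have hlt : volume N < 2 * volume N := by
    rw [two_mul]; exact ENNReal.lt_add_right hNf h0
  -- With small cylinders inside `O`, the covering lemma bounds `unitVol d` times the measure of `N`
  -- by `c 5^(4d+2)` times that of `O`, hence by `2c 5^(4d+2)` times that of `N`. This contradicts
  -- `hcv`.
  obtain ⟨O, hNO, hO, hOlt⟩ := N.exists_isOpen_lt_of_lt _ hlt
  have hex : ∀ z ∈ N, ∃ r, 0 < r ∧ 5 * r ≤ R ∧ ocyl r z ⊆ O := by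
    intro z hz
    obtain ⟨δ, hδ, h⟩ := exists_ocyl_subset hO (hNO hz)
    refine ⟨min (δ / 2) (R / 5), by positivity, ?_, h _ (by positivity) ?_⟩
    · linarith [min_le_right (δ / 2) (R / 5)]
    · linarith [min_le_left (δ / 2) (R / 5)]
  choose! r hr0 hr1 hr2 using hex
  have key := measure_le_of_forall_ocyl (E := E) (E' := N) (F := O)
    (a := ENNReal.ofReal (c * 5 ^ (4 * d + 2))) (b := ENNReal.ofReal (unitVol d)) (R := R) r hNE hr0
    (fun z hz => by linarith [hr1 z hz, hr0 z hz])
    (fun z hz => by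
      refine (hz.2 (5 * r z) (by linarith [hr0 z hz]) (hr1 z hz)).le.trans (le_of_eq ?_)
      rw [← ENNReal.ofReal_mul (by positivity), mul_pow, mul_assoc])
    (fun z hz => by
      rw [inter_eq_self_of_subset_right (hr2 z hz), ← ENNReal.ofReal_mul unitVol_pos.le]
      exact unitVol_mul_le_volume_ocyl (hr0 z hz) z)
  have h3 : ENNReal.ofReal (c * 5 ^ (4 * d + 2)) * volume O ≤
      ENNReal.ofReal (2 * (c * 5 ^ (4 * d + 2))) * volume N := by
    rw [ENNReal.ofReal_mul (by norm_num : (0 : ℝ) ≤ 2), ENNReal.ofReal_ofNat, mul_comm (2 : ℝ≥0∞),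
      mul_assoc]
    gcongr
  have h4 := (ENNReal.mul_le_mul_iff_left h0 hNf).1 (key.trans h3)
  exact absurd h4 (not_le.2 ((ENNReal.ofReal_lt_ofReal_iff unitVol_pos).2 hcv))


/-! ### De Giorgi iteration: from measure to pointwise bounds. -/

/-- Fast geometric convergence. -/
theorem exists_forall_le_geometric {q A B : ℝ} (hq : 1 < q) (hA : 0 < A) (hB : 1 < B) :
    ∃ δ > 0, ∃ τ, 0 < τ ∧ τ < 1 ∧ ∀ y : ℕ → ℝ, (∀ k, 0 ≤ y k) → y 0 ≤ δ →
      (∀ k, y (k + 1) ≤ (A * B ^ k * y k) ^ q) → ∀ k, y k ≤ δ * τ ^ k := by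
  have hq1 : 0 < q - 1 := by linarith
  -- The rate `τ` solves `(Bτ)^q = τ`, and `δ` below solves `(Aδ)^q = δτ`, so that the recursion
  -- maps the bound `δτ^k` exactly to `δτ^(k+1)`.
  set τ : ℝ := B ^ (-(q / (q - 1))) with hτ
  have hB0 : 0 < B := by linarith
  have hτ0 : 0 < τ := Real.rpow_pos_of_pos hB0 _
  have hτ1 : τ < 1 := Real.rpow_lt_one_of_one_lt_of_neg hB (by
    have : 0 < q / (q - 1) := by positivity
    linarith)
  have hBτ : (B * τ) ^ q = τ := by
    rw [hτ, ← Real.rpow_one_add' hB0.le, ← Real.rpow_mul hB0.le]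
    · congr 1; field_simp; ring
    · have : 1 + -(q / (q - 1)) = -(1 / (q - 1)) := by field_simp; ring
      rw [this]
      have : 0 < 1 / (q - 1) := by positivity
      linarith
  set δ : ℝ := (τ / A ^ q) ^ (1 / (q - 1)) with hδ
  have hAq : 0 < A ^ q := Real.rpow_pos_of_pos hA _
  have hδ0 : 0 < δ := Real.rpow_pos_of_pos (by positivity) _
  have hδq : A ^ q * δ ^ q = δ * τ := by
    have h1 : δ ^ (q - 1) = τ / A ^ q := by
      rw [hδ, ← Real.rpow_mul (by positivity)]
      rw [one_div_mul_cancel hq1.ne', Real.rpow_one]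
    have h2 : δ ^ q = δ ^ (q - 1) * δ := by
      rw [← Real.rpow_add_one hδ0.ne']; congr 1; ring
    rw [h2, h1]
    field_simp
  refine ⟨δ, hδ0, τ, hτ0, hτ1, fun y hy h0 h k => ?_⟩
  induction k with
  | zero => simpa using h0
  | succ k ih =>
    have hnn := hy k
    calc y (k + 1) ≤ (A * B ^ k * y k) ^ q := h k
      _ ≤ (A * B ^ k * (δ * τ ^ k)) ^ q := by gcongr
      _ = (A * δ * (B * τ) ^ k) ^ q := by rw [mul_pow]; ring_nf
      _ = δ * τ ^ (k + 1) := by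
        rw [Real.mul_rpow (by positivity) (by positivity), Real.mul_rpow hA.le hδ0.le, hδq,
          ← Real.rpow_natCast, ← Real.rpow_mul (by positivity), mul_comm (k : ℝ) q,
          Real.rpow_mul (by positivity), hBτ, Real.rpow_natCast]
        ring

theorem ae_abs_le_of_eLpNorm_top_le {S : Ph d → ℝ} {Ω : Set (Ph d)} {s : ℝ} (hs : 0 ≤ s)
    (h : eLpNorm S ∞ (volume.restrict Ω) ≤ ENNReal.ofReal s) :
    ∀ᵐ z ∂volume.restrict Ω, |S z| ≤ s := by
  rw [eLpNorm_exponent_top] at h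
  filter_upwards [ae_le_eLpNormEssSup (f := S) (μ := volume.restrict Ω)] with z hz
  have := hz.trans h
  rwa [Real.enorm_eq_ofReal_abs, ENNReal.ofReal_le_ofReal_iff hs] at this

/-- One step of the De Giorgi iteration. -/
theorem KDGPlus.measure_sublevel_le {pc Cp a b : ℝ} {Ωx Ωv : Set (EuclideanSpace ℝ (Fin d))}
    {f S : Ph d → ℝ} (hpc : 2 < pc) (hCp : 1 ≤ Cp)
    (h : KDGPlus pc Cp a b Ωx Ωv (fun z => -f z) S)
    (hf : ∀ᵐ z ∂volume.restrict (domain a b Ωx Ωv), 0 ≤ f z) {s M : ℝ} (hM : 0 < M)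
    (hs : 0 ≤ s) (hsM : s ≤ M)
    (hS : eLpNorm S ∞ (volume.restrict (domain a b Ωx Ωv)) ≤ ENNReal.ofReal s) {z₀ : Ph d}
    (hz₀ : z₀ ∈ domain a b Ωx Ωv) {r R m ℓ ℓ' : ℝ} (hr : 0 < r) (hrR : r < R) (hR : R < 1)
    (hsub : cyl R z₀ ⊆ domain a b Ωx Ωv) (hm : ℓ' < m) (hm' : m < ℓ) (hℓ : ℓ ≤ M) :
    ((m - ℓ') ^ 2) ^ (pc / 2) * (volume ({z | f z < ℓ'} ∩ cyl r z₀)).toReal ≤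
      (Cp * (1 + Cp * unitVol d) / (R - r) ^ 6 * M ^ 2 * (volume ({z | f z < ℓ} ∩ cyl R z₀)).toReal) ^ (pc / 2) := by
  have hfin : ∀ (A : Set (Ph d)) (r : ℝ), 0 < r → volume (A ∩ cyl r z₀) ≠ ∞ := fun A r hr =>
    ((measure_mono inter_subset_right).trans_lt
      ((volume_cyl z₀ hr).trans_lt ENNReal.ofReal_lt_top)).ne
  set Y := volume ({z | f z < ℓ} ∩ cyl R z₀) with hY
  set Y' := volume ({z | f z < ℓ'} ∩ cyl r z₀) with hY'
  have hf' : ∀ᵐ z ∂volume.restrict (cyl R z₀), 0 ≤ f z := ae_restrict_of_ae_restrict_of_subset hsub hf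
  have hS' : ∀ᵐ z ∂volume.restrict (cyl R z₀), |S z| ≤ s :=
    ae_restrict_of_ae_restrict_of_subset hsub (ae_abs_le_of_eLpNorm_top_le hs hS)
  have hRr : 0 < R - r := by linarith
  have hrest : ∀ (A : Set (Ph d)) (r : ℝ), volume.restrict (cyl r z₀) A = volume (A ∩ cyl r z₀) :=
    fun A r => Measure.restrict_apply' measurableSet_cyl
  have hind : ∀ w : Ph d → ℝ≥0∞, (∀ᵐ z ∂volume.restrict (cyl R z₀),
      w z ≤ {z | f z < ℓ}.indicator (fun _ => ENNReal.ofReal (M ^ 2)) z) →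
      ∫⁻ z in cyl R z₀, w z ≤ ENNReal.ofReal (M ^ 2) * Y := fun w hw => by
    refine (lintegral_mono_ae hw).trans ((lintegral_indicator_const_le _ _).trans ?_)
    rw [hrest]
  have i1 : ∫⁻ z in cyl R z₀, ENNReal.ofReal ((max (-f z - -m) 0) ^ 2) ≤ ENNReal.ofReal (M ^ 2) * Y := by
    refine hind _ ?_
    filter_upwards [hf'] with z hz
    by_cases hzl : f z < ℓ
    · rw [indicator_of_mem (by exact hzl)]
      refine ENNReal.ofReal_le_ofReal ?_
      have : max (-f z - -m) 0 ≤ M := max_le (by linarith) hM.le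
      gcongr
    · have : max (-f z - -m) 0 = 0 := max_eq_right (by linarith)
      rw [this]; simp
  -- The source is counted on `{f ≤ m}`, which lies in the strict sublevel set `{f < ℓ}` only
  -- because `m < ℓ`. Hence a truncation level strictly between `ℓ'` and `ℓ`.
  have i2 : ∫⁻ z in cyl R z₀, {z | -m ≤ -f z}.indicator (fun z => ENNReal.ofReal (S z ^ 2)) z ≤
      ENNReal.ofReal (M ^ 2) * Y := by
    refine hind _ ?_
    filter_upwards [hS'] with z hz
    by_cases hzl : -m ≤ -f z
    · rw [indicator_of_mem (by exact hzl), indicator_of_mem (by simp only [mem_ofPred_eq]; linarith)]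
      refine ENNReal.ofReal_le_ofReal ?_
      rw [← sq_abs]
      have := hz.trans hsM
      gcongr
    · rw [indicator_of_notMem (by exact hzl)]
      exact zero_le
  have g := h.gain z₀ hz₀ (-m) r R hr hrR hR hsub
  have hYf : Y ≠ ∞ := hfin _ R (by linarith)
  have hYf' : Y' ≠ ∞ := hfin _ r hr
  have e1 : Y = ENNReal.ofReal Y.toReal := (ENNReal.ofReal_toReal hYf).symm
  have e2 : Y' = ENNReal.ofReal Y'.toReal := (ENNReal.ofReal_toReal hYf').symm
  have hpos : 0 ≤ Y.toReal := ENNReal.toReal_nonneg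
  have hpos' : 0 ≤ Y'.toReal := ENNReal.toReal_nonneg
  have hV := unitVol_pos (d := d)
  have hvol : volume (cyl R z₀) ≤ ENNReal.ofReal (unitVol d) := by
    rw [volume_cyl z₀ (hr.trans hrR)]
    refine ENNReal.ofReal_le_ofReal (mul_le_of_le_one_right hV.le ?_)
    exact pow_le_one₀ (hr.trans hrR).le hR.le
  -- In `gain` the source term stands under the first integral, so it also carries the factor `Cp /
  -- (R - r)^4` and the volume of the cylinder. This explains the power `6` and the constant `Cp (1
  -- + Cp unitVol)`.
  have hupper : eLpNorm (fun z => max (-f z - -m) 0) (ENNReal.ofReal pc)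
      (volume.restrict (cyl r z₀)) ^ 2 ≤
      ENNReal.ofReal (Cp * (1 + Cp * unitVol d) / (R - r) ^ 6 * M ^ 2 * Y.toReal) := by
    refine g.trans ?_
    rw [lintegral_add_right _ measurable_const, setLIntegral_const]
    calc _ ≤ ENNReal.ofReal (Cp / (R - r) ^ 4) * (ENNReal.ofReal (M ^ 2) * Y +
          ENNReal.ofReal (Cp / (R - r) ^ 2) * (ENNReal.ofReal (M ^ 2) * Y) *
            ENNReal.ofReal (unitVol d)) := by gcongr
      _ = ENNReal.ofReal (Cp / (R - r) ^ 4 * (M ^ 2 * Y.toReal +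
          Cp / (R - r) ^ 2 * (M ^ 2 * Y.toReal) * unitVol d)) := by
        rw [e1, ← ENNReal.ofReal_mul (by positivity), ← ENNReal.ofReal_mul (by positivity),
          ← ENNReal.ofReal_mul (by positivity), ← ENNReal.ofReal_add (by positivity) (by positivity),
          ← ENNReal.ofReal_mul (by positivity), ENNReal.toReal_ofReal hpos]
      _ ≤ _ := by
        refine ENNReal.ofReal_le_ofReal ?_
        have hle : 1 ≤ 1 / (R - r) ^ 2 :=
          (one_le_div (by positivity)).2 (pow_le_one₀ hRr.le (by linarith))
        calc Cp / (R - r) ^ 4 * (M ^ 2 * Y.toReal + Cp / (R - r) ^ 2 * (M ^ 2 * Y.toReal) * unitVol d)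
            = Cp / (R - r) ^ 4 * M ^ 2 * Y.toReal * (1 + Cp * unitVol d * (1 / (R - r) ^ 2)) := by ring
          _ ≤ Cp / (R - r) ^ 4 * M ^ 2 * Y.toReal *
              (1 * (1 / (R - r) ^ 2) + Cp * unitVol d * (1 / (R - r) ^ 2)) := by
            gcongr; linarith
          _ = _ := by field_simp
  have hms : AEStronglyMeasurable (fun z => max (-f z - -m) 0) (volume.restrict (cyl r z₀)) := by
    have h1 : AEStronglyMeasurable (fun z => -f z) (volume.restrict (cyl r z₀)) :=
      h.aestronglyMeasurable.mono_set (fun z hz => hsub (by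
        obtain ⟨⟨h1, h2⟩, h3, h4⟩ := mem_comp_box.1 hz
        refine mem_comp_box.2 ⟨⟨by nlinarith, h2⟩, h3.trans_le ?_, h4.trans hrR⟩
        gcongr))
    exact ((h1.sub aestronglyMeasurable_const).sup aestronglyMeasurable_const)
  have hpc0 : ENNReal.ofReal pc ≠ 0 := by simp; linarith
  have cheb := mul_meas_ge_le_pow_eLpNorm' (volume.restrict (cyl r z₀)) hpc0 ENNReal.ofReal_ne_top
    hms (ENNReal.ofReal (m - ℓ'))
  rw [ENNReal.toReal_ofReal (by linarith), hrest] at cheb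
  have hsubset : {z | f z < ℓ'} ∩ cyl r z₀ ⊆
      {x | ENNReal.ofReal (m - ℓ') ≤ ‖max (-f x - -m) 0‖ₑ} ∩ cyl r z₀ := by
    rintro z ⟨hz, hz'⟩
    refine ⟨?_, hz'⟩
    simp only [mem_ofPred_eq] at hz ⊢
    rw [Real.enorm_eq_ofReal_abs, abs_of_nonneg (le_max_right _ _)]
    exact ENNReal.ofReal_le_ofReal (le_max_of_le_left (by linarith))
  have hmain : ENNReal.ofReal (m - ℓ') ^ pc * Y' ≤
      ENNReal.ofReal (Cp * (1 + Cp * unitVol d) / (R - r) ^ 6 * M ^ 2 * Y.toReal) ^ (pc / 2) := by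
    calc ENNReal.ofReal (m - ℓ') ^ pc * Y' ≤ _ := by gcongr; exact measure_mono hsubset
      _ ≤ _ := cheb
      _ = (eLpNorm (fun z => max (-f z - -m) 0) (ENNReal.ofReal pc)
            (volume.restrict (cyl r z₀)) ^ 2) ^ (pc / 2) := by
          rw [← ENNReal.rpow_natCast, ← ENNReal.rpow_mul]; congr 1; push_cast; ring
      _ ≤ _ := ENNReal.rpow_le_rpow hupper (by linarith)
  rw [e2, ENNReal.ofReal_rpow_of_pos (by linarith), ENNReal.ofReal_rpow_of_nonneg (by positivity)
    (by linarith), ← ENNReal.ofReal_mul (Real.rpow_nonneg (by linarith) _),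
    ENNReal.ofReal_le_ofReal_iff (Real.rpow_nonneg (by positivity) _)] at hmain
  rw [← Real.rpow_natCast (m - ℓ'), ← Real.rpow_mul (by linarith)]
  convert hmain using 3
  push_cast; ring

/-- From measure to pointwise bounds at unit scale. -/
theorem KDGPlus.exists_lower_bound {pc Cp : ℝ} (hpc : 2 < pc) (hCp : 1 ≤ Cp) :
    ∃ δ > 0, ∀ (a b : ℝ) (Ωx Ωv : Set (EuclideanSpace ℝ (Fin d))) (f S : Ph d → ℝ),
      KDGPlus pc Cp a b Ωx Ωv (fun z => -f z) S →
      (∀ᵐ z ∂volume.restrict (domain a b Ωx Ωv), 0 ≤ f z) → ∀ s M : ℝ, 0 < M → 0 ≤ s → s ≤ M →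
      eLpNorm S ∞ (volume.restrict (domain a b Ωx Ωv)) ≤ ENNReal.ofReal s →
      ∀ z₀ : Ph d, z₀ ∈ domain a b Ωx Ωv → cyl (1 / 2) z₀ ⊆ domain a b Ωx Ωv →
      volume ({z | f z < M} ∩ cyl (1 / 2) z₀) ≤ ENNReal.ofReal δ →
      ∀ᵐ z ∂volume.restrict (cyl (1 / 4) z₀), M / 2 ≤ f z := by
  -- Radii and half-gaps between levels at step `k` are `2^{-k}/8` and `M 2^{-k}/8`. The power `-6`
  -- of the first and the power `-2` of the second, times `M²`, give `8^8 · (2^8)^k = 2^24 · 256^k`.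
  obtain ⟨δ, hδ, τ, hτ0, hτ1, H⟩ := exists_forall_le_geometric (q := pc / 2)
    (A := 2 ^ 24 * (Cp * (1 + Cp * unitVol d))) (B := 256) (by linarith)
    (by have := unitVol_pos (d := d); positivity) (by norm_num)
  refine ⟨δ, hδ, fun a b Ωx Ωv f S h hf s M hM hs hsM hS z₀ hz₀ hsub hδ0 => ?_⟩
  have hmono : ∀ {r R : ℝ}, 0 < r → r ≤ R → cyl r z₀ ⊆ cyl R z₀ := fun {r R} hr hrR z hz => by
    obtain ⟨⟨h1, h2⟩, h3, h4⟩ := mem_comp_box.1 hz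
    refine mem_comp_box.2 ⟨⟨by nlinarith, h2⟩, h3.trans_le ?_, h4.trans_le hrR⟩
    gcongr
  have hfin : ∀ (A : Set (Ph d)) (r : ℝ), 0 < r → volume (A ∩ cyl r z₀) ≠ ∞ := fun A r hr =>
    ((measure_mono inter_subset_right).trans_lt
      ((volume_cyl z₀ hr).trans_lt ENNReal.ofReal_lt_top)).ne
  set r : ℕ → ℝ := fun k => 1 / 4 + (1 / 2) ^ k / 4 with hr
  set ℓ : ℕ → ℝ := fun k => M * (1 / 2 + (1 / 2) ^ k / 2) with hℓ
  have hp : ∀ k : ℕ, (0 : ℝ) < (1 / 2) ^ k ∧ ((1 : ℝ) / 2) ^ k ≤ 1 := fun k =>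
    ⟨by positivity, pow_le_one₀ (by norm_num) (by norm_num)⟩
  have key := H (fun k => (volume ({z | f z < ℓ k} ∩ cyl (r k) z₀)).toReal)
    (fun k => ENNReal.toReal_nonneg) (by
      refine ENNReal.toReal_le_of_le_ofReal hδ.le ?_
      convert hδ0 using 4 <;> norm_num [hr, hℓ]) (fun k => by
      have hk := hp k
      have step := h.measure_sublevel_le hpc hCp hf hM hs hsM hS hz₀ (r := r (k + 1)) (R := r k)
        (m := ℓ (k + 1) + M * (1 / 2) ^ k / 8) (ℓ := ℓ k) (ℓ' := ℓ (k + 1))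
        (by simp only [hr]; positivity) (by simp only [hr, pow_succ]; linarith)
        (by simp only [hr]; linarith)
        ((hmono (by simp only [hr]; positivity) (by simp only [hr]; linarith)).trans hsub)
        (by have : 0 < M * (1 / 2) ^ k := by positivity
            linarith)
        (by have : 0 < M * (1 / 2) ^ k := by positivity
            simp only [hℓ, pow_succ]; nlinarith)
        (by simp only [hℓ]; nlinarith)
      set y := (volume ({z | f z < ℓ k} ∩ cyl (r k) z₀)).toReal
      set y' := (volume ({z | f z < ℓ (k + 1)} ∩ cyl (r (k + 1)) z₀)).toReal
      have hy : 0 ≤ y := ENNReal.toReal_nonneg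
      have e1 : ℓ (k + 1) + M * (1 / 2) ^ k / 8 - ℓ (k + 1) = M * (1 / 2) ^ k / 8 := by ring
      have e2 : r k - r (k + 1) = (1 / 2) ^ k / 8 := by simp only [hr, pow_succ]; ring
      have hV := unitVol_pos (d := d)
      have e3 : Cp * (1 + Cp * unitVol d) / ((1 / 2) ^ k / 8) ^ 6 * M ^ 2 * y =
          (M * (1 / 2) ^ k / 8) ^ 2 * (2 ^ 24 * (Cp * (1 + Cp * unitVol d)) * 256 ^ k * y) := by
        have : (256 : ℝ) ^ k * ((1 / 2) ^ k) ^ 8 = 1 := by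
          rw [← pow_mul, mul_comm k 8, pow_mul, ← mul_pow]; norm_num
        have hne : ((1 : ℝ) / 2) ^ k ≠ 0 := hk.1.ne'
        generalize ((1 : ℝ) / 2) ^ k = t at *
        generalize (256 : ℝ) ^ k = w at *
        rw [div_mul_eq_mul_div, div_mul_eq_mul_div, div_eq_iff (by positivity)]
        linear_combination (-(Cp * (1 + Cp * unitVol d) * M ^ 2 * y)) * this
      rw [e1, e2, e3, Real.mul_rpow (by positivity) (by positivity)] at step
      exact le_of_mul_le_mul_left step (Real.rpow_pos_of_pos (by positivity) _))
  have hz : volume ({z | f z < M / 2} ∩ cyl (1 / 4) z₀) = 0 := by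
    have h0 : (volume ({z | f z < M / 2} ∩ cyl (1 / 4) z₀)).toReal ≤ 0 := by
      refine ge_of_tendsto' (f := fun k : ℕ => δ * τ ^ k)
        (by simpa using (tendsto_pow_atTop_nhds_zero_of_lt_one hτ0.le hτ1).const_mul δ) fun k => ?_
      refine (ENNReal.toReal_mono (hfin _ _ (by simp only [hr]; positivity)) (measure_mono ?_)).trans
        (key k)
      refine inter_subset_inter (fun z hz => ?_) (hmono (by norm_num) ?_)
      · simp only [mem_ofPred_eq] at hz ⊢
        simp only [hℓ]
        nlinarith [hp k]
      · simp only [hr]; linarith [hp k]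
    have := (ENNReal.toReal_eq_zero_iff _).1 (le_antisymm h0 ENNReal.toReal_nonneg)
    exact this.resolve_right (hfin _ _ (by norm_num))
  rw [ae_iff, Measure.restrict_apply' measurableSet_cyl]
  convert hz using 3
  ext z; simp


/-! ### Expansion of positivity in measure at unit scale. -/

theorem measurable_Gam : Measurable (Gam : Ph d → ℝ) := by
  unfold Gam
  refine Measurable.ite (measurableSet_lt measurable_const measurable_fst) ?_ measurable_const
  fun_prop

/-- Bounds for the fundamental solution between the past and the future cylinders. -/
theorem exists_Gam_bounds (d : ℕ) : ∃ γ Γ : ℝ, 0 < γ ∧ ∀ ζ ∈ cyl (d := d) (1 / 2) (-1 - (1 / 2) ^ 2, 0, 0),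
    ∀ z ∈ cyl (d := d) 1 0, γ ≤ Gam (comp (inv ζ) z) ∧ Gam (comp (inv ζ) z) ≤ Γ := by
  set K : ℝ := (3 / (4 * Real.pi ^ 2)) ^ ((d : ℝ) / 2) with hK
  have hK0 : 0 < K := Real.rpow_pos_of_pos (by positivity) _
  -- Times in the two cylinders differ by at least `1/4` and at most `2`, and the position term is
  -- at most `5`, so the exponent is at most `3 · 5² · 4³ + 4 = 4804`.
  refine ⟨K * (2 ^ (2 * d))⁻¹ * Real.exp (-4804), K * ((1 / 4) ^ (2 * d))⁻¹ * 1, by positivity,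
    fun ζ hζ z hz => ?_⟩
  obtain ⟨⟨a1, a2⟩, a3, a4⟩ := mem_comp_box.1 hζ
  obtain ⟨⟨b1, b2⟩, b3, b4⟩ := mem_comp_box.1 hz
  simp only [smul_zero, sub_zero, Prod.fst_zero, Prod.snd_zero] at a1 a2 a3 a4 b1 b2 b3 b4
  set w := comp (inv ζ) z with hw
  have e1 : w.1 = z.1 - ζ.1 := by simp [hw, comp, inv]; ring
  have t1 : 1 / 4 ≤ w.1 := by rw [e1]; norm_num at *; linarith
  have t2 : w.1 ≤ 2 := by rw [e1]; norm_num at *; linarith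
  have n2 : ‖w.2.2‖ ≤ 2 := by
    have : w.2.2 = -ζ.2.2 + z.2.2 := rfl
    rw [this]
    refine (norm_add_le _ _).trans ?_
    rw [norm_neg]; linarith
  have n1 : ‖w.2.1‖ ≤ 3 := by
    have : w.2.1 = (-ζ.2.1 + ζ.1 • ζ.2.2) + z.2.1 + z.1 • (-ζ.2.2) := rfl
    rw [this]
    have c1 : ‖ζ.1 • ζ.2.2‖ ≤ 3 / 2 * (1 / 2) := by
      rw [norm_smul, Real.norm_eq_abs]
      have : |ζ.1| ≤ 3 / 2 := by rw [abs_le]; norm_num at *; constructor <;> linarith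
      gcongr
    have c2 : ‖z.1 • (-ζ.2.2)‖ ≤ 1 * (1 / 2) := by
      rw [norm_smul, norm_neg, Real.norm_eq_abs]
      have : |z.1| ≤ 1 := by rw [abs_le]; norm_num at *; constructor <;> linarith
      gcongr
    have c3 := norm_add_le (-ζ.2.1 + ζ.1 • ζ.2.2 + z.2.1) (z.1 • (-ζ.2.2))
    have c4 := norm_add_le (-ζ.2.1 + ζ.1 • ζ.2.2) z.2.1
    have c5 := norm_add_le (-ζ.2.1) (ζ.1 • ζ.2.2)
    rw [norm_neg] at c5
    norm_num at *
    linarith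
  have n3 : ‖w.2.1 - (w.1 / 2) • w.2.2‖ ≤ 5 := by
    refine (norm_sub_le _ _).trans ?_
    rw [norm_smul, Real.norm_of_nonneg (by linarith)]
    have : w.1 / 2 * ‖w.2.2‖ ≤ 1 * 2 := by gcongr; linarith
    linarith
  have hw0 : 0 < w.1 := by linarith
  have e : Gam w = K * (w.1 ^ (2 * d))⁻¹ *
      Real.exp (-(3 * ‖w.2.1 - (w.1 / 2) • w.2.2‖ ^ 2 / w.1 ^ 3) - ‖w.2.2‖ ^ 2 / (4 * w.1)) := by
    rw [Gam, if_pos hw0]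
  have x1 : 3 * ‖w.2.1 - (w.1 / 2) • w.2.2‖ ^ 2 / w.1 ^ 3 ≤ 4800 := by
    calc _ ≤ 3 * 5 ^ 2 / (1 / 4 : ℝ) ^ 3 := by gcongr
      _ = 4800 := by norm_num
  have x2 : ‖w.2.2‖ ^ 2 / (4 * w.1) ≤ 4 := by
    calc _ ≤ 2 ^ 2 / (4 * (1 / 4 : ℝ)) := by gcongr
      _ = 4 := by norm_num
  have x3 : 0 ≤ 3 * ‖w.2.1 - (w.1 / 2) • w.2.2‖ ^ 2 / w.1 ^ 3 := by positivity
  have x4 : 0 ≤ ‖w.2.2‖ ^ 2 / (4 * w.1) := by positivity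
  rw [e]
  constructor
  · gcongr; linarith
  · gcongr
    exact Real.exp_le_one_iff.2 (by linarith)

/-- The kernel is at least `γ` and `g` equals `κ` on a set of measure at least `c`; the rest
contributes a non-negative amount. The upper bound of the kernel serves integrability only. -/
theorem le_localMean {γ Γ : ℝ} (hγ : 0 < γ)
    (hΓ : ∀ ζ ∈ cyl (d := d) (1 / 2) (-1 - (1 / 2) ^ 2, 0, 0),
      ∀ z ∈ cyl (d := d) 1 0, γ ≤ Gam (comp (inv ζ) z) ∧ Gam (comp (inv ζ) z) ≤ Γ)
    {A : Set (Ph d)} (hA : A ⊆ cyl (1 / 2) (-1 - (1 / 2) ^ 2, 0, 0)) (hAm : MeasurableSet A)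
    {g : Ph d → ℝ} {κ c : ℝ} (hκ : 0 < κ)
    (hg : AEStronglyMeasurable g (volume.restrict A))
    (hg0 : ∀ᵐ z ∂volume.restrict A, 0 ≤ g z) (hg1 : ∀ z, g z ≤ κ)
    (hv : ENNReal.ofReal c ≤ volume ({z | κ ≤ g z} ∩ A)) {z : Ph d} (hz : z ∈ cyl 1 0) :
    γ * κ * c ≤ localMean A g z := by
  have hAf : volume A ≠ ∞ := ((measure_mono hA).trans_lt
    ((volume_cyl _ (by norm_num)).trans_lt ENNReal.ofReal_lt_top)).ne
  have hmeas : Measurable fun ζ : Ph d => Gam (comp (inv ζ) z) := by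
    refine measurable_Gam.comp ?_
    unfold comp inv
    fun_prop
  have hbd : ∀ᵐ ζ ∂volume.restrict A, γ ≤ Gam (comp (inv ζ) z) ∧ Gam (comp (inv ζ) z) ≤ Γ :=
    (ae_restrict_iff' hAm).2 (Eventually.of_forall fun ζ hζ => hΓ ζ (hA hζ) z hz)
  have hint : IntegrableOn (fun ζ => Gam (comp (inv ζ) z) * g ζ) A volume := by
    have : IsFiniteMeasure (volume.restrict A) := ⟨by simpa using hAf.lt_top⟩
    refine Integrable.of_bound (hmeas.aestronglyMeasurable.mul hg) (Γ * κ) ?_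
    filter_upwards [hbd, hg0] with ζ h1 h2
    rw [norm_mul, Real.norm_of_nonneg h2, Real.norm_of_nonneg (hγ.le.trans h1.1)]
    have := hγ.le.trans h1.1
    gcongr
    · exact this.trans h1.2
    · exact h1.2
    · exact hg1 ζ
  set P : Set (Ph d) := {z | κ ≤ g z} with hP
  have hPm : NullMeasurableSet P (volume.restrict A) :=
    nullMeasurableSet_le aemeasurable_const hg.aemeasurable
  have hPf : volume (P ∩ A) ≠ ∞ := ((measure_mono inter_subset_right).trans_lt hAf.lt_top).ne
  have hc' : c ≤ (volume (P ∩ A)).toReal := (ENNReal.ofReal_le_iff_le_toReal hPf).1 hv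
  have hle : ∫ ζ in A, P.indicator (fun _ => γ * κ) ζ ≤ localMean A g z := by
    refine integral_mono_ae ?_ hint ?_
    · refine IntegrableOn.integrable_indicator₀ (integrableOn_const ?_) hPm
      rw [Measure.restrict_apply' hAm]; exact hPf
    · filter_upwards [hbd, hg0] with ζ h1 h2
      by_cases h3 : ζ ∈ P
      · rw [indicator_of_mem h3]
        have : κ ≤ g ζ := h3
        have := hγ.le.trans h1.1
        gcongr
        exact h1.1
      · rw [indicator_of_notMem h3]
        exact mul_nonneg (hγ.le.trans h1.1) h2
  refine le_trans ?_ hle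
  rw [integral_indicator₀ hPm, setIntegral_const, smul_eq_mul, measureReal_def,
    Measure.restrict_apply' hAm, mul_comm]
  gcongr

/-- At one of finitely many levels, the gradient of the truncation is small in `L¹`. -/
theorem exists_level_lintegral_grad_le {B : Set (Ph d)} {a b : ℝ}
    {Ωx Ωv : Set (EuclideanSpace ℝ (Fin d))} (hx : IsOpen Ωx) (hv : IsOpen Ωv)
    (hB : B = domain a b Ωx Ωv) (hBf : volume B ≠ ∞) {C ε : ℝ} (hC : 0 < C) (hε : 0 < ε) :
    ∃ β : ℝ, 0 < β ∧ β < 1 ∧ ∀ (h : Ph d → ℝ) (H : ℝ → Ph d → EuclideanSpace ℝ (Fin d)) (s κ : ℝ),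
      AEStronglyMeasurable h (volume.restrict B) →
      (∀ κ, 0 < κ → HasWeakGradV B (fun z => min (h z) κ) (H κ)) →
      (∀ κ, 0 < κ → s ≤ κ → eLpNorm (H κ) 2 (volume.restrict B) ≤ ENNReal.ofReal (C * κ)) →
      0 < κ → s ≤ β * κ →
      ∃ κ', β * κ ≤ κ' ∧ κ' ≤ κ ∧ ∫⁻ z in B, ‖H κ' z‖ₑ ≤ ENNReal.ofReal (ε * κ') := by
  set V := (volume B).toReal with hV
  have hV0 : 0 ≤ V := ENNReal.toReal_nonneg
  have hVe : volume B = ENNReal.ofReal V := (ENNReal.ofReal_toReal hBf).symm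
  -- The ratio `q` makes the gradient at the next level contribute at most `ε/2` times the current
  -- level. The number `n` of levels does the same for an interlevel set of measure at most `V/n`.
  -- The lowest level is `q^n κ`.
  set q : ℝ := min (1 / 2) (ε / (2 * (C * (√V + 1)))) with hq
  have hq0 : 0 < q := by positivity
  have hq1 : q ≤ 1 / 2 := min_le_left _ _
  have hq2 : C * q * √V ≤ ε / 2 := by
    have h1 : q * (2 * (C * (√V + 1))) ≤ ε := (le_div_iff₀ (by positivity)).1 (min_le_right _ _)
    nlinarith [Real.sqrt_nonneg V, mul_pos hC hq0]
  obtain ⟨n, hn⟩ := exists_nat_ge ((2 * C / ε) ^ 2 * V + 1)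
  have hn0 : 0 < (n : ℝ) := by
    have : 0 ≤ (2 * C / ε) ^ 2 * V := by positivity
    linarith
  have hn2 : C * √(V / n) ≤ ε / 2 := by
    have : √(V / n) ≤ ε / (2 * C) := by
      rw [Real.sqrt_le_left (by positivity), div_le_iff₀ hn0]
      have h1 : (ε / (2 * C)) ^ 2 * ((2 * C / ε) ^ 2 * V) = V := by field_simp
      have h2 : 0 ≤ (ε / (2 * C)) ^ 2 := by positivity
      nlinarith
    calc C * √(V / n) ≤ C * (ε / (2 * C)) := by gcongr
      _ = ε / 2 := by field_simp
  refine ⟨q ^ n, by positivity, pow_lt_one₀ hq0.le (by linarith) (by rintro rfl; simp at hn0),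
    fun h H s κ hm hH hE hκ hs => ?_⟩
  set ν := volume.restrict B with hν
  have hBm : MeasurableSet B := hB ▸ measurableSet_domain hx hv
  set α : ℕ → ℝ := fun i => κ * q ^ i with hα
  have hα0 : ∀ i, 0 < α i := fun i => by simp only [hα]; positivity
  have hαs : ∀ i, α (i + 1) = q * α i := fun i => by simp only [hα, pow_succ]; ring
  have hαanti : Antitone α := antitone_nat_of_succ_le fun i => by
    rw [hαs]; nlinarith [hα0 i]
  have hsα : ∀ i, i ≤ n → s ≤ α i := fun i hi => by
    refine (hs.trans (le_of_eq ?_)).trans (hαanti hi)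
    simp only [hα]; ring
  set A : ℕ → Set (Ph d) := fun i => {z | α (i + 1) < h z ∧ h z < α i} with hA
  have hAm : ∀ i, NullMeasurableSet (A i) ν := fun i =>
    (nullMeasurableSet_lt aemeasurable_const hm.aemeasurable).inter
      (nullMeasurableSet_lt hm.aemeasurable aemeasurable_const)
  have hsum : ∑ i ∈ Finset.range n, ν (A i) ≤ ∑ i ∈ Finset.range n, ENNReal.ofReal (V / n) := by
    rw [← measure_biUnion_finset₀]
    · refine (measure_mono (subset_univ _)).trans ?_
      rw [hν, Measure.restrict_apply_univ, hVe, Finset.sum_const, Finset.card_range, nsmul_eq_mul,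
        ← ENNReal.ofReal_natCast, ← ENNReal.ofReal_mul hn0.le]
      refine le_of_eq ?_
      congr 1; field_simp
    · intro i _ j _ hij
      refine Disjoint.aedisjoint ?_
      rw [Set.disjoint_left]
      rintro z ⟨h1, h2⟩ ⟨h3, h4⟩
      rcases lt_or_gt_of_ne hij with h5 | h5
      · have := hαanti (Nat.succ_le_of_lt h5)
        simp only [Nat.succ_eq_add_one] at this
        linarith
      · have := hαanti (Nat.succ_le_of_lt h5)
        simp only [Nat.succ_eq_add_one] at this
        linarith
    · exact fun i _ => hAm i
  have hne : (Finset.range n).Nonempty := by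
    rw [Finset.nonempty_range_iff]; rintro rfl; simp at hn0
  have hAf : ∀ i, ν (A i) ≠ ∞ := fun i => ((measure_mono (subset_univ _)).trans_lt (by
    rw [hν, Measure.restrict_apply_univ]; exact hBf.lt_top)).ne
  have hsum' : ∑ i ∈ Finset.range n, (ν (A i)).toReal ≤ ∑ i ∈ Finset.range n, V / n := by
    rw [← ENNReal.toReal_sum fun i _ => hAf i]
    refine ENNReal.toReal_le_of_le_ofReal (by positivity) (hsum.trans (le_of_eq ?_))
    rw [ENNReal.ofReal_sum_of_nonneg fun i _ => by positivity]
  obtain ⟨i, hi, hAi⟩ := Finset.exists_le_of_sum_le hne hsum'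
  replace hAi : ν (A i) ≤ ENNReal.ofReal (V / n) :=
    (ENNReal.le_ofReal_iff_toReal_le (hAf i) (by positivity)).2 hAi
  have hin : i < n := Finset.mem_range.1 hi
  refine ⟨α i, ?_, ?_, ?_⟩
  · have := hαanti hin.le
    refine (le_of_eq ?_).trans this
    simp only [hα]; ring
  · simp only [hα]
    exact mul_le_of_le_one_right hκ.le (pow_le_one₀ hq0.le (by linarith))
  have hw := hH _ (hα0 i)
  have hw' := hH _ (hα0 (i + 1))
  rw [hB] at hw hw'
  -- Above `α i` the truncation is constant and its gradient vanishes; below `α (i + 1)` the two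
  -- consecutive truncations coincide, and so do their gradients. Only the set `A i` in between
  -- remains.
  have z1 := hw.ae_eq_zero hx hv (α i)
  have z2 := (hw.sub hw').ae_eq_zero hx hv 0
  rw [← hB] at z1 z2
  have hms : ∀ i, AEStronglyMeasurable (H (α i)) ν := fun i =>
    (hH _ (hα0 i)).2.aestronglyMeasurable
  have hCS : ∀ i, i ≤ n → ∀ D : Set (Ph d), NullMeasurableSet D ν → ∀ m : ℝ, 0 ≤ m →
      ν D ≤ ENNReal.ofReal m →
      ∫⁻ z in D, ‖H (α i) z‖ₑ ∂ν ≤ ENNReal.ofReal (C * α i * √m) := by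
    intro i hi D hD m hm0 hm
    have := eLpNorm_le_eLpNorm_mul_rpow_measure_univ (p := 1) (q := 2) (by norm_num)
      ((hms i).mono_measure (Measure.restrict_le_self (s := D)))
    rw [eLpNorm_one_eq_lintegral_enorm, Measure.restrict_apply_univ] at this
    refine this.trans ?_
    rw [ENNReal.ofReal_mul (by have := hα0 i; positivity), Real.sqrt_eq_rpow,
      ← ENNReal.ofReal_rpow_of_nonneg hm0 (by norm_num)]
    norm_num
    gcongr
    exact (eLpNorm_mono_measure _ Measure.restrict_le_self).trans (hE _ (hα0 i) (hsα i hi))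
  calc ∫⁻ z in B, ‖H (α i) z‖ₑ
      ≤ ∫⁻ z, (A i).indicator (fun z => ‖H (α i) z‖ₑ) z + ‖H (α (i + 1)) z‖ₑ ∂ν := by
        refine lintegral_mono_ae ?_
        filter_upwards [z1, z2] with z h1 h2
        by_cases hz1 : α i ≤ h z
        · rw [h1 (min_eq_right hz1)]; simp
        by_cases hz2 : h z ≤ α (i + 1)
        · have h3 := h2 (by rw [min_eq_left hz2, min_eq_left (by linarith [not_le.1 hz1]), sub_self])
          rw [sub_eq_zero.1 h3]
          exact le_add_self
        · rw [indicator_of_mem (by exact ⟨not_le.1 hz2, not_le.1 hz1⟩)]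
          exact le_self_add
    _ = ∫⁻ z in A i, ‖H (α i) z‖ₑ ∂ν + ∫⁻ z in univ, ‖H (α (i + 1)) z‖ₑ ∂ν := by
        rw [lintegral_add_right' _ (hms (i + 1)).enorm, lintegral_indicator₀ (hAm i),
          Measure.restrict_univ]
    _ ≤ ENNReal.ofReal (C * α i * √(V / n)) + ENNReal.ofReal (C * α (i + 1) * √V) := by
        gcongr
        · exact hCS i hin.le _ (hAm i) _ (by positivity) hAi
        · refine hCS (i + 1) hin _ MeasurableSet.univ.nullMeasurableSet _ hV0 ?_
          rw [hν, Measure.restrict_apply_univ, hVe]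
    _ ≤ ENNReal.ofReal (ε * α i) := by
        have := hα0 i
        rw [← ENNReal.ofReal_add (by positivity) (by rw [hαs]; positivity)]
        refine ENNReal.ofReal_le_ofReal ?_
        rw [hαs]
        calc C * α i * √(V / n) + C * (q * α i) * √V
            = α i * (C * √(V / n)) + α i * (C * q * √V) := by ring
          _ ≤ α i * (ε / 2) + α i * (ε / 2) := by gcongr
          _ = ε * α i := by ring


/-- Expansion of positivity in measure, at unit scale. -/
theorem exists_unit_expansion {γ Γ : ℝ} (hγ : 0 < γ)
    (hΓ : ∀ ζ ∈ cyl (d := d) (1 / 2) (-1 - (1 / 2) ^ 2, 0, 0),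
      ∀ z ∈ cyl (d := d) 1 0, γ ≤ Gam (comp (inv ζ) z) ∧ Gam (comp (inv ζ) z) ≤ Γ)
    {R T c δ C Cm w : ℝ} (hR : 1 < R) (hT : T < -1) (hc : 0 < c) (hδ : 0 < δ) (hC : 0 < C)
    (hCm : 0 < Cm) (hw : w ≤ γ * c / 4) :
    ∃ θ : ℝ, 0 < θ ∧ θ < 1 ∧
      ∀ (h : Ph d → ℝ) (H : ℝ → Ph d → EuclideanSpace ℝ (Fin d)) (s κ : ℝ),
      AEStronglyMeasurable h (volume.restrict (box d T 0 (8 * R) (2 * R))) →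
      (∀ᵐ z ∂volume.restrict (box d T 0 (8 * R) (2 * R)), 0 ≤ h z) →
      (∀ κ, 0 < κ → HasWeakGradV (box d T 0 (8 * R) (2 * R)) (fun z => min (h z) κ) (H κ)) →
      (∀ κ, 0 < κ → s ≤ κ →
        eLpNorm (H κ) 2 (volume.restrict (box d T 0 (8 * R) (2 * R))) ≤ ENNReal.ofReal (C * κ)) →
      (∀ κ, 0 < κ → ∫⁻ z in cyl 1 0, ENNReal.ofReal (-(min (h z) κ -
          localMean (cyl (1 / 2) (-1 - (1 / 2) ^ 2, 0, 0) ∩ box d T 0 (8 * R) (2 * R))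
            (fun ζ => min (h ζ) κ) z + κ * w)) ≤
        ENNReal.ofReal Cm *
          ∫⁻ z in box d T 0 (8 * R) (2 * R), (‖H κ z‖ₑ + ENNReal.ofReal s)) →
      0 < κ → s ≤ θ * κ →
      ENNReal.ofReal c ≤ volume ({z | κ ≤ h z} ∩
        (cyl (1 / 2) (-1 - (1 / 2) ^ 2, 0, 0) ∩ box d T 0 (8 * R) (2 * R))) →
      volume ({z | h z < θ * κ} ∩ cyl 1 0) ≤ ENNReal.ofReal δ := by
  set B := box d T 0 (8 * R) (2 * R) with hB
  have hBf : volume B ≠ ∞ := by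
    rw [hB, volume_box (by linarith) (by linarith)]; exact ENNReal.ofReal_ne_top
  set V := (volume B).toReal with hV
  have hV0 : 0 ≤ V := ENNReal.toReal_nonneg
  have hVe : volume B = ENNReal.ofReal V := (ENNReal.ofReal_toReal hBf).symm
  -- Where `h < θ₀κ'`, the truncation and the error `κ'w` are each at most `κ'γc/4`, and the mean is
  -- at least `κ'γc`, so the negative part is at least `κ'γc/2`. The choice of `ε` makes the
  -- right-hand side `2 Cm ε κ'` equal to `δ` times this.
  set ε : ℝ := δ * γ * c / (4 * Cm) with hε
  have hε0 : 0 < ε := by positivity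
  obtain ⟨β, hβ0, hβ1, key⟩ := exists_level_lintegral_grad_le (B := B) Metric.isOpen_ball
    Metric.isOpen_ball rfl hBf hC hε0
  set θ₀ := γ * c / 4 with hθ₀
  have hθ₀0 : 0 < θ₀ := by positivity
  -- Since `κ' ≥ βκ`, the factor `m` ensures both that the source, integrated over the box of volume
  -- `V`, is at most `εκ'`, and that `θκ ≤ θ₀κ'`.
  set m := min 1 (min (ε / (V + 1)) θ₀) with hm
  have hm0 : 0 < m := by positivity
  have hm1 : m ≤ 1 := min_le_left _ _
  have hm2 : m ≤ ε / (V + 1) := (min_le_right _ _).trans (min_le_left _ _)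
  have hm3 : m ≤ θ₀ := (min_le_right _ _).trans (min_le_right _ _)
  refine ⟨β * m, by positivity, by nlinarith, fun h H s κ hms hh hH hE hP hκ hs hv => ?_⟩
  have hs1 : s ≤ β * κ := hs.trans (by
    have : 0 < β * κ := by positivity
    nlinarith)
  obtain ⟨κ', hκ1, hκ2, hgrad⟩ := key h H s κ hms hH hE hκ hs1
  have hκ' : 0 < κ' := lt_of_lt_of_le (by positivity) hκ1
  have hsV : s * V ≤ ε * κ' := by
    rcases le_or_gt s 0 with h0 | h0
    · have : s * V ≤ 0 := mul_nonpos_of_nonpos_of_nonneg h0 hV0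
      exact this.trans (by positivity)
    · have h1 : s ≤ m * κ' := hs.trans (by
        calc β * m * κ = m * (β * κ) := by ring
          _ ≤ m * κ' := by gcongr)
      have h2 : m * (V + 1) ≤ ε := (le_div_iff₀ (by positivity)).1 hm2
      calc s * V ≤ m * κ' * (V + 1) := by gcongr; linarith
        _ = m * (V + 1) * κ' := by ring
        _ ≤ ε * κ' := by gcongr
  set A := cyl (d := d) (1 / 2) (-1 - (1 / 2) ^ 2, 0, 0) ∩ B with hA
  have hBm : MeasurableSet B := measurableSet_box
  have hAm : MeasurableSet A := measurableSet_cyl.inter hBm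
  have hmin : AEStronglyMeasurable (fun z => min (h z) κ') (volume.restrict B) :=
    hms.inf aestronglyMeasurable_const
  have hmean : ∀ z ∈ cyl (d := d) 1 0, γ * κ' * c ≤ localMean A (fun ζ => min (h ζ) κ') z := by
    intro z hz
    refine le_localMean hγ hΓ inter_subset_left hAm hκ' (hmin.mono_set inter_subset_right) ?_
      (fun z => min_le_right _ _) (hv.trans (measure_mono ?_)) hz
    · filter_upwards [ae_restrict_of_ae_restrict_of_subset (inter_subset_right : A ⊆ B) hh] with z hz
      exact le_min hz hκ'.le
    · refine inter_subset_inter_left _ fun z hz => ?_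
      exact le_min (hκ2.trans hz) le_rfl
  have hcylB : cyl (d := d) 1 0 ⊆ B := by
    intro z hz
    obtain ⟨⟨h1, h2⟩, h3, h4⟩ := mem_comp_box.1 hz
    simp only [smul_zero, sub_zero, Prod.fst_zero, Prod.snd_zero] at h1 h2 h3 h4
    norm_num at h1 h3
    exact mem_box.2 ⟨⟨by linarith, h2⟩, by linarith, by linarith⟩
  set D : Set (Ph d) := {z | h z < θ₀ * κ'} with hD
  have hDm : NullMeasurableSet D (volume.restrict (cyl 1 0)) :=
    nullMeasurableSet_lt (hms.mono_set hcylB).aemeasurable aemeasurable_const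
  have hlow : ENNReal.ofReal (κ' * γ * c / 2) * volume (D ∩ cyl 1 0) ≤
      ∫⁻ z in cyl 1 0, ENNReal.ofReal (-(min (h z) κ' -
          localMean A (fun ζ => min (h ζ) κ') z + κ' * w)) := by
    rw [← Measure.restrict_apply' (μ := volume) measurableSet_cyl, ← lintegral_indicator_const₀ hDm]
    refine lintegral_mono_ae ((ae_restrict_iff' measurableSet_cyl).2
      (Eventually.of_forall fun z hz => ?_))
    by_cases hzD : z ∈ D
    · rw [indicator_of_mem hzD]
      refine ENNReal.ofReal_le_ofReal ?_
      have h1 : min (h z) κ' ≤ θ₀ * κ' := (min_le_left _ _).trans (le_of_lt hzD)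
      have h2 := hmean z hz
      have h3 : κ' * w ≤ κ' * (γ * c / 4) := by gcongr
      rw [hθ₀] at h1
      linarith
    · rw [indicator_of_notMem hzD]; exact zero_le
  have hup : ENNReal.ofReal Cm * ∫⁻ z in B, (‖H κ' z‖ₑ + ENNReal.ofReal s) ≤
      ENNReal.ofReal (Cm * (2 * ε * κ')) := by
    rw [lintegral_add_right _ measurable_const, setLIntegral_const, hVe, ← ENNReal.ofReal_mul' hV0,
      ENNReal.ofReal_mul hCm.le]
    gcongr
    calc _ ≤ ENNReal.ofReal (ε * κ') + ENNReal.ofReal (ε * κ') := by gcongr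
      _ = _ := by
        rw [← ENNReal.ofReal_add (by positivity) (by positivity)]; congr 1; ring
  have hfin := (hlow.trans (hP κ' hκ')).trans hup
  have e : Cm * (2 * ε * κ') = κ' * γ * c / 2 * δ := by
    rw [hε]; field_simp; ring
  rw [e, ENNReal.ofReal_mul (by positivity)] at hfin
  have := (ENNReal.mul_le_mul_iff_right (ENNReal.ofReal_pos.2 (by positivity)).ne'
    ENNReal.ofReal_ne_top).1 hfin
  refine (measure_mono (inter_subset_inter_left _ fun z hz => ?_)).trans this
  simp only [mem_ofPred_eq] at hz ⊢
  refine lt_of_lt_of_le hz ?_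
  calc β * m * κ = m * (β * κ) := by ring
    _ ≤ θ₀ * κ' := by gcongr

/-! ### Rescaling: expansion of positivity at all scales. -/

theorem ae_restrict_dil {Ω B : Set (Ph d)} {z₀ : Ph d} {ρ : ℝ} (hρ : 0 < ρ)
    (hB : dil z₀ ρ '' B ⊆ Ω) {P : Ph d → Prop} (h : ∀ᵐ z ∂volume.restrict Ω, P z) :
    ∀ᵐ z ∂volume.restrict B, P (dil z₀ ρ z) := by
  rw [← (measurableEmbedding_dil z₀ hρ).ae_map_iff, map_dil_restrict z₀ hρ]
  exact Measure.ae_smul_measure (ae_restrict_of_ae_restrict_of_subset hB h) _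

theorem aestronglyMeasurable_dil {E : Type*} [TopologicalSpace E] {Ω B : Set (Ph d)} {z₀ : Ph d}
    {ρ : ℝ} (hρ : 0 < ρ) (hB : dil z₀ ρ '' B ⊆ Ω) {F : Ph d → E}
    (h : AEStronglyMeasurable F (volume.restrict Ω)) :
    AEStronglyMeasurable (fun z => F (dil z₀ ρ z)) (volume.restrict B) := by
  refine AEStronglyMeasurable.comp_aemeasurable (f := dil z₀ ρ) ?_
    (measurableEmbedding_dil z₀ hρ).measurable.aemeasurable
  rw [map_dil_restrict z₀ hρ]
  exact (h.mono_set hB).smul_measure _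

theorem eLpNorm_two_dil {B : Set (Ph d)} {z₀ : Ph d} {ρ : ℝ} (hρ : 0 < ρ)
    (F : Ph d → EuclideanSpace ℝ (Fin d)) :
    eLpNorm (fun z => F (dil z₀ ρ z)) 2 (volume.restrict B) =
      ENNReal.ofReal ((ρ ^ (2 * d + 1))⁻¹) * eLpNorm F 2 (volume.restrict (dil z₀ ρ '' B)) := by
  have := (measurableEmbedding_dil z₀ hρ).eLpNorm_map_measure (g := F) (p := 2)
    (μ := volume.restrict B)
  rw [map_dil_restrict z₀ hρ, eLpNorm_smul_measure_of_ne_top (by norm_num)] at this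
  rw [show (fun z => F (dil z₀ ρ z)) = F ∘ dil z₀ ρ from rfl, ← this, smul_eq_mul]
  congr 1
  rw [ENNReal.ofReal_rpow_of_nonneg (by positivity) (by norm_num)]
  congr 1
  rw [show ρ ^ (4 * d + 2) = (ρ ^ (2 * d + 1)) ^ 2 by ring, ← inv_pow]
  norm_num
  rw [← Real.sqrt_eq_rpow, Real.sqrt_inv, Real.sqrt_sq (by positivity)]

theorem volume_preimage_dil (z₀ : Ph d) {ρ : ℝ} (hρ : 0 < ρ) (X : Set (Ph d)) :
    volume (dil z₀ ρ ⁻¹' X) = ENNReal.ofReal ((ρ ^ (4 * d + 2))⁻¹) * volume X := by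
  rw [← (measurableEmbedding_dil z₀ hρ).map_apply, map_dil z₀ hρ]; rfl

theorem dil_comp (z₀ z y : Ph d) (ρ : ℝ) : dil z₀ ρ (comp z y) = comp (dil z₀ ρ z) (scale ρ y) := by
  simp only [dil, comp, scale]
  ext1
  · simp only; ring
  · ext1 <;> · simp only; module

theorem dil_image_cyl (z₀ z : Ph d) {ρ r : ℝ} (hρ : 0 < ρ) :
    dil z₀ ρ '' cyl r z = cyl (ρ * r) (dil z₀ ρ z) := by
  have h := dil_image_box (dil z₀ ρ z) hρ (-r ^ 2) 0 (r ^ 3) r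
  rw [cyl, image_image, cyl]
  have e : (-(ρ * r) ^ 2 : ℝ) = ρ ^ 2 * -r ^ 2 := by ring
  rw [e, mul_pow ρ r 3]
  rw [mul_zero] at h
  rw [← h]
  refine image_congr fun y _ => dil_comp _ _ _ _


/-- The local energy estimate for a truncation, after rescaling. -/
theorem KDGMinus.eLpNorm_grad_le {pc Cp Cm a b : ℝ} {ϖ : ℝ → ℝ}
    {Ωx Ωv : Set (EuclideanSpace ℝ (Fin d))} {f S : Ph d → ℝ}
    (h : KDGMinus pc Cp Cm ϖ a b Ωx Ωv f S) (hCm : 0 < Cm)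
    (hf : ∀ᵐ z ∂volume.restrict (domain a b Ωx Ωv), 0 ≤ f z) {s : ℝ} (hs : 0 ≤ s)
    (hS : eLpNorm S ∞ (volume.restrict (domain a b Ωx Ωv)) ≤ ENNReal.ofReal s)
    {z₀ : Ph d} {ρ R τ κ : ℝ} (hρ : 0 < ρ) (hρ1 : ρ ≤ 1) (hR : 1 < R) (hτ : 0 < τ) (hτ1 : τ < 1)
    (hκ : 0 < κ) (hsκ : s ≤ κ)
    (hsub : comp z₀ '' box d (ρ ^ 2 * (-3 / 2)) 0 (16 * R * ρ ^ 3) (4 * R * ρ) ⊆ domain a b Ωx Ωv)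
    {H : Ph d → EuclideanSpace ℝ (Fin d)}
    (hH : HasWeakGradV (box d (-3 / 2 + τ) 0 (8 * R) (2 * R)) (fun z => min (f (dil z₀ ρ z)) κ) H) :
    eLpNorm H 2 (volume.restrict (box d (-3 / 2 + τ) 0 (8 * R) (2 * R))) ≤
      ENNReal.ofReal (Cm * (1 / √τ + 1) *
        √(3 / 2 * ((16 * R) ^ d * (4 * R) ^ d) * unitVol d) * κ) := by
  set Ω := domain a b Ωx Ωv with hΩ
  set B := box d (-3 / 2 + τ) 0 (8 * R) (2 * R) with hB
  have hR0 : 0 < R := by linarith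
  have hV := unitVol_pos (d := d)
  set W := 3 / 2 * ((16 * R) ^ d * (4 * R) ^ d) * unitVol d with hW
  have hW0 : 0 < W := by positivity
  have hst : 0 < √τ := Real.sqrt_pos.2 hτ
  obtain ⟨G, hG, hGe⟩ := h.gradient κ
  set ext := comp z₀ '' box d (0 - 3 / 2 * ρ ^ 2) 0 (16 * R * ρ ^ 3) (4 * R * ρ) with hext
  set int := comp z₀ '' box d (0 - (3 / 2 - τ) * ρ ^ 2) 0 (8 * R * ρ ^ 3) (2 * R * ρ) with hint
  have hext' : ext ⊆ Ω := by
    convert hsub using 4; ring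
  have hBint : dil z₀ ρ '' B = int := by
    rw [hB, dil_image_box z₀ hρ, hint]
    congr 2 <;> ring
  have hmono : int ⊆ ext := by
    intro z hz
    obtain ⟨⟨h1, h2⟩, h3, h4⟩ := mem_comp_box.1 hz
    have : 0 < ρ ^ 2 := by positivity
    have : 0 < R * ρ ^ 3 := by positivity
    have : 0 < R * ρ := by positivity
    refine mem_comp_box.2 ⟨⟨by nlinarith, h2⟩, by linarith, by linarith⟩
  have hdB : dil z₀ ρ '' B ⊆ Ω := hBint.subset.trans (hmono.trans hext')
  have key := hGe z₀ 0 ((3 / 2 - τ) * ρ ^ 2) (3 / 2 * ρ ^ 2) (8 * R * ρ ^ 3) (16 * R * ρ ^ 3)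
    (2 * R * ρ) (4 * R * ρ) (by have : 0 < 3 / 2 - τ := by linarith
                                positivity)
    (by have : 0 < ρ ^ 2 := by positivity
        nlinarith) (by positivity)
    (by have : 0 < R * ρ ^ 3 := by positivity
        linarith) (by positivity)
    (by have : 0 < R * ρ := by positivity
        linarith) hext'
  rw [← hext, ← hint] at key
  have hvol : volume ext ^ (1 / 2 : ℝ) = ENNReal.ofReal (√W * ρ ^ (2 * d + 1)) := by
    rw [hext, volume_comp_box _ (by positivity) (by positivity),
      ENNReal.ofReal_rpow_of_nonneg (by
        have : 0 ≤ (0 - (0 - 3 / 2 * ρ ^ 2)) := by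
          have : 0 < ρ ^ 2 := by positivity
          linarith
        positivity) (by norm_num), ← Real.sqrt_eq_rpow]
    congr 1
    have : (0 - (0 - 3 / 2 * ρ ^ 2)) * ((16 * R * ρ ^ 3) ^ d * (4 * R * ρ) ^ d) * unitVol d =
        W * (ρ ^ (2 * d + 1)) ^ 2 := by
      rw [hW]; simp only [mul_pow]; ring
    rw [this, Real.sqrt_mul hW0.le, Real.sqrt_sq (by positivity)]
  have hbd : ∀ (w : Ph d → ℝ) (m : ℝ), (∀ᵐ z ∂volume.restrict Ω, ‖w z‖ ≤ m) →
      eLpNorm w 2 (volume.restrict ext) ≤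
        ENNReal.ofReal (√W * ρ ^ (2 * d + 1)) * ENNReal.ofReal m := by
    intro w m hw
    have := eLpNorm_le_of_ae_bound (p := 2) (ae_restrict_of_ae_restrict_of_subset hext' hw)
    rw [Measure.restrict_apply_univ] at this
    rw [← hvol]
    convert this using 3
    norm_num
  have b1 := hbd (fun z => max (κ - f z) 0) κ (by
    filter_upwards [hf] with z hz
    rw [Real.norm_of_nonneg (le_max_right _ _)]
    exact max_le (by linarith) hκ.le)
  have b2 := hbd ({z | f z ≤ κ}.indicator S) κ (by
    filter_upwards [ae_abs_le_of_eLpNorm_top_le hs hS] with z hz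
    exact (norm_indicator_le_norm_self _ _).trans (hz.trans hsκ))
  -- Only the gap in time, `τρ²`, is narrow; the gaps in `x` and `v` are worth at least `ρ`.
  have he : √τ * ρ ≤ min (√(3 / 2 * ρ ^ 2 - (3 / 2 - τ) * ρ ^ 2))
      (min (√((16 * R * ρ ^ 3 - 8 * R * ρ ^ 3) / (4 * R * ρ))) (4 * R * ρ - 2 * R * ρ)) := by
    have hτs : √τ ≤ 1 := Real.sqrt_le_one.2 hτ1.le
    refine le_min (le_of_eq ?_) (le_min ?_ ?_)
    · have : 3 / 2 * ρ ^ 2 - (3 / 2 - τ) * ρ ^ 2 = τ * ρ ^ 2 := by ring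
      rw [this, Real.sqrt_mul hτ.le, Real.sqrt_sq hρ.le]
    · have : (16 * R * ρ ^ 3 - 8 * R * ρ ^ 3) / (4 * R * ρ) = 2 * ρ ^ 2 := by
        field_simp; ring
      rw [this]
      refine Real.le_sqrt_of_sq_le ?_
      rw [mul_pow, Real.sq_sqrt hτ.le]
      have : 0 < ρ ^ 2 := by positivity
      nlinarith
    · have : ρ < R * ρ := by nlinarith
      nlinarith
  have hinv : (min (√(3 / 2 * ρ ^ 2 - (3 / 2 - τ) * ρ ^ 2))
      (min (√((16 * R * ρ ^ 3 - 8 * R * ρ ^ 3) / (4 * R * ρ))) (4 * R * ρ - 2 * R * ρ)))⁻¹ ≤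
      1 / (√τ * ρ) := by
    rw [one_div]
    exact inv_anti₀ (by positivity) he
  have hGint : eLpNorm G 2 (volume.restrict int) ≤
      ENNReal.ofReal (Cm * (1 / √τ + 1) * √W * κ * ρ ^ (2 * d + 1) / ρ) := by
    refine key.trans ?_
    calc _ ≤ ENNReal.ofReal Cm * (ENNReal.ofReal (1 / (√τ * ρ)) *
          (ENNReal.ofReal (√W * ρ ^ (2 * d + 1)) * ENNReal.ofReal κ) +
          ENNReal.ofReal (√W * ρ ^ (2 * d + 1)) * ENNReal.ofReal κ) := by gcongr
      _ = ENNReal.ofReal (Cm * (1 / (√τ * ρ) * (√W * ρ ^ (2 * d + 1) * κ) +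
          √W * ρ ^ (2 * d + 1) * κ)) := by
        rw [← ENNReal.ofReal_mul (by positivity), ← ENNReal.ofReal_mul (by positivity),
          ← ENNReal.ofReal_add (by positivity) (by positivity), ← ENNReal.ofReal_mul hCm.le]
      _ ≤ _ := by
        refine ENNReal.ofReal_le_ofReal ?_
        have h1 : 1 ≤ 1 / ρ := (one_le_div hρ).2 hρ1
        calc Cm * (1 / (√τ * ρ) * (√W * ρ ^ (2 * d + 1) * κ) + √W * ρ ^ (2 * d + 1) * κ)
            = Cm * √W * κ * ρ ^ (2 * d + 1) * (1 / √τ * (1 / ρ) + 1) := by field_simp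
          _ ≤ Cm * √W * κ * ρ ^ (2 * d + 1) * (1 / √τ * (1 / ρ) + 1 / ρ) := by gcongr
          _ = _ := by ring
  have hBf : volume B ≠ ∞ := by
    rw [hB, volume_box (by linarith) (by linarith)]; exact ENNReal.ofReal_ne_top
  have hfinB : IsFiniteMeasure (volume.restrict B) := ⟨by simpa using hBf.lt_top⟩
  have hGs : AEStronglyMeasurable (fun z => G (dil z₀ ρ z)) (volume.restrict B) :=
    aestronglyMeasurable_dil hρ hdB hG.2.aestronglyMeasurable
  have hG2 : eLpNorm (fun z => G (dil z₀ ρ z)) 2 (volume.restrict B) ≤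
      ENNReal.ofReal (Cm * (1 / √τ + 1) * √W * κ / ρ) := by
    rw [eLpNorm_two_dil hρ, hBint]
    refine (mul_le_mul_right hGint _).trans (le_of_eq ?_)
    rw [← ENNReal.ofReal_mul (by positivity)]
    congr 1
    field_simp
  have hGm : MemLp (fun z => G (dil z₀ ρ z)) 2 (volume.restrict B) :=
    ⟨hGs, hG2.trans_lt ENNReal.ofReal_lt_top⟩
  have hGi : IntegrableOn (fun z => -(ρ • G (dil z₀ ρ z))) B volume :=
    ((hGm.integrable (by norm_num)).smul ρ).neg
  have efun : (fun z => κ - max (κ - f (dil z₀ ρ z)) 0) = fun z => min (f (dil z₀ ρ z)) κ := by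
    ext1 z
    rcases le_total (f (dil z₀ ρ z)) κ with h1 | h1
    · rw [min_eq_left h1, max_eq_left (by linarith)]; ring
    · rw [min_eq_right h1, max_eq_right (by linarith)]; ring
  have hWG := hG.const_sub_dil (B := B) hρ hdB κ (by rw [efun]; exact hH.1) hGi.locallyIntegrableOn
  rw [efun] at hWG
  -- The gradient `H` and the rescaled gradient of the energy estimate are separate witnesses;
  -- uniqueness identifies them.
  have hae : ∀ᵐ z ∂volume.restrict B, H z = -(ρ • G (dil z₀ ρ z)) :=
    HasWeakGradV.ae_eq Metric.isOpen_ball Metric.isOpen_ball hH hWG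
  rw [eLpNorm_congr_ae hae]
  have e2 : (fun z => -(ρ • G (dil z₀ ρ z))) = (-ρ) • fun z => G (dil z₀ ρ z) := by
    ext1 z; simp
  rw [e2, eLpNorm_const_smul]
  have e3 : ‖-ρ‖ₑ = ENNReal.ofReal ρ := by
    rw [enorm_neg, Real.enorm_eq_ofReal hρ.le]
  rw [e3]
  refine (mul_le_mul_right hG2 _).trans (le_of_eq ?_)
  rw [← ENNReal.ofReal_mul hρ.le]
  congr 1
  field_simp

/-- The past cylinder starts at time `-3/2`, the earliest time available, whereas the energy
estimate needs a gap `τ` in time. The slice given up has duration at most `τ` and sections inside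
products of unit balls. -/
theorem volume_cyl_sdiff_box_le {R τ : ℝ} (hR : 1 < R) :
    volume (cyl (d := d) (1 / 2) (-1 - (1 / 2) ^ 2, 0, 0) \ box d (-3 / 2 + τ) 0 (8 * R) (2 * R)) ≤
      ENNReal.ofReal (τ * unitVol d) := by
  have hsubset : cyl (d := d) (1 / 2) (-1 - (1 / 2) ^ 2, 0, 0) \
      box d (-3 / 2 + τ) 0 (8 * R) (2 * R) ⊆ comp (-1 - (1 / 2) ^ 2, 0, 0) ''
        box d (-(1 / 2) ^ 2) (-(1 / 2) ^ 2 + τ) 1 1 := by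
    rintro z ⟨hz, hzB⟩
    obtain ⟨⟨h1, h2⟩, h3, h4⟩ := mem_comp_box.1 hz
    refine mem_comp_box.2 ⟨⟨h1, ?_⟩, h3.trans (by norm_num), h4.trans (by norm_num)⟩
    simp only [smul_zero, sub_zero] at h1 h2 h3 h4 ⊢
    by_contra hlt
    refine hzB (mem_box.2 ⟨⟨by linarith, by linarith⟩, ?_, by linarith⟩)
    refine h3.trans ?_
    norm_num; linarith
  refine (measure_mono hsubset).trans ?_
  rw [volume_comp_box _ one_pos one_pos]
  refine ENNReal.ofReal_le_ofReal (le_of_eq ?_)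
  simp only [one_pow, mul_one, add_sub_cancel_left]

/-- Expansion of positivity in measure. -/
theorem KDGMinus.exists_expansion (d : ℕ) {pc Cp Cm : ℝ} {ϖ : ℝ → ℝ} (hCm : 0 < Cm)
    (hϖ : Tendsto ϖ atTop (𝓝 0)) {c δ : ℝ} (hc : 0 < c) (hδ : 0 < δ) :
    ∃ R θ : ℝ, 1 < R ∧ 0 < θ ∧ θ < 1 ∧
      ∀ (a b : ℝ) (Ωx Ωv : Set (EuclideanSpace ℝ (Fin d))) (f S : Ph d → ℝ), IsOpen Ωx → IsOpen Ωv →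
      KDGMinus pc Cp Cm ϖ a b Ωx Ωv f S →
      (∀ᵐ z ∂volume.restrict (domain a b Ωx Ωv), 0 ≤ f z) → ∀ s : ℝ, 0 ≤ s →
      eLpNorm S ∞ (volume.restrict (domain a b Ωx Ωv)) ≤ ENNReal.ofReal s →
      ∀ (z₀ : Ph d) (ρ κ : ℝ), 0 < ρ → ρ ≤ 1 →
      comp z₀ '' box d (ρ ^ 2 * (-3 / 2)) 0 (16 * R * ρ ^ 3) (4 * R * ρ) ⊆ domain a b Ωx Ωv →
      0 < κ → s ≤ θ * κ →
      ENNReal.ofReal (c * ρ ^ (4 * d + 2)) ≤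
        volume ({z | κ ≤ f z} ∩ cyl (ρ / 2) (comp z₀ (-(5 / 4) * ρ ^ 2, 0, 0))) →
      volume ({z | f z < θ * κ} ∩ cyl ρ z₀) ≤ ENNReal.ofReal (δ * ρ ^ (4 * d + 2)) := by
  obtain ⟨γ, Γ, hγ, hΓ⟩ := exists_Gam_bounds d
  have hV := unitVol_pos (d := d)
  set τ := min (1 / 8) (c / (2 * unitVol d)) with hτ
  have hτ0 : 0 < τ := by positivity
  have hτ1 : τ ≤ 1 / 8 := min_le_left _ _
  have hτ2 : τ * unitVol d ≤ c / 2 := by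
    have := (le_div_iff₀ (by positivity)).1 (min_le_right (1 / 8) (c / (2 * unitVol d)))
    rw [← hτ] at this
    linarith
  -- The cut leaves measure `c/2` in the past cylinder, so `ϖ(R)` is compared with `γ(c/2)/4`.
  obtain ⟨R, hR1, hR2⟩ := ((eventually_gt_atTop 1).and
    (hϖ.eventually_le_const (show 0 < γ * (c / 2) / 4 by positivity))).exists
  set C := Cm * (1 / √τ + 1) * √(3 / 2 * ((16 * R) ^ d * (4 * R) ^ d) * unitVol d) with hC
  have hst : 0 < √τ := Real.sqrt_pos.2 hτ0
  have hC0 : 0 < C := by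
    have : 0 < R := by linarith
    positivity
  obtain ⟨θ, hθ0, hθ1, key⟩ := exists_unit_expansion hγ hΓ (T := -3 / 2 + τ) (w := ϖ R) hR1
    (by linarith) (half_pos hc) hδ hC0 hCm hR2
  refine ⟨R, θ, hR1, hθ0, hθ1, fun a b Ωx Ωv f S hx hv h hf s hs hS z₀ ρ κ hρ hρ1 hsub hκ hsκ hvol => ?_⟩
  set Ω := domain a b Ωx Ωv with hΩ
  set B := box d (-3 / 2 + τ) 0 (8 * R) (2 * R) with hB
  have hdB : dil z₀ ρ '' B ⊆ Ω := by
    rw [hB, dil_image_box z₀ hρ]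
    refine Subset.trans (fun z hz => ?_) hsub
    obtain ⟨⟨h1, h2⟩, h3, h4⟩ := mem_comp_box.1 hz
    have : 0 < ρ ^ 2 := by positivity
    have : 0 < R * ρ ^ 3 := by positivity
    have : 0 < R * ρ := by positivity
    refine mem_comp_box.2 ⟨⟨by nlinarith, by simpa using h2⟩, by linarith, by linarith⟩
  have hfB := ae_restrict_dil hρ hdB hf
  have hpo : ∀ κ : ℝ, 0 < κ → _ := fun κ hκ =>
    h.poincare R (1 / 2) (-3 / 2 + τ) hR1 (by norm_num) (by norm_num) (by norm_num; linarith)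
      (by norm_num; linarith) z₀ ρ κ hρ hκ hdB hfB
  choose! H hH1 hH2 using hpo
  have hSB : eLpNorm (fun z => S (dil z₀ ρ z)) ∞ (volume.restrict B) ≤ ENNReal.ofReal s := by
    rw [eLpNorm_exponent_top]
    refine eLpNormEssSup_le_of_ae_bound ?_
    exact ae_restrict_dil hρ hdB (ae_abs_le_of_eLpNorm_top_le hs hS)
  have hfm : AEStronglyMeasurable f (volume.restrict Ω) := by
    convert h.neg_mem.aestronglyMeasurable.neg using 1
    ext z; simp
  have hpow : (0 : ℝ) < ρ ^ (4 * d + 2) := by positivity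
  set P : Set (Ph d) := cyl (1 / 2) (-1 - (1 / 2) ^ 2, 0, 0) with hP
  have himg : dil z₀ ρ '' P = cyl (ρ / 2) (comp z₀ (-(5 / 4) * ρ ^ 2, 0, 0)) := by
    rw [hP, dil_image_cyl z₀ _ hρ]
    congr 1
    · ring
    · simp only [dil, scale, smul_zero]
      congr 2; ring
  have hinj := (measurableEmbedding_dil z₀ hρ).injective
  have hvol1 : ENNReal.ofReal c ≤ volume ({z | κ ≤ f (dil z₀ ρ z)} ∩ P) := by
    have e : dil z₀ ρ ⁻¹' ({z | κ ≤ f z} ∩ cyl (ρ / 2) (comp z₀ (-(5 / 4) * ρ ^ 2, 0, 0))) =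
        {z | κ ≤ f (dil z₀ ρ z)} ∩ P := by
      rw [preimage_inter, ← himg, preimage_image_eq _ hinj]; rfl
    rw [← e, volume_preimage_dil z₀ hρ]
    refine le_trans (le_of_eq ?_) (mul_le_mul_right hvol _)
    rw [← ENNReal.ofReal_mul (by positivity)]
    congr 1; field_simp
  have hvol2 : ENNReal.ofReal (c / 2) ≤ volume ({z | κ ≤ f (dil z₀ ρ z)} ∩ (P ∩ B)) := by
    set X := volume ({z | κ ≤ f (dil z₀ ρ z)} ∩ (P ∩ B)) with hX
    have hcut : volume (P \ B) ≤ ENNReal.ofReal (c / 2) :=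
      (volume_cyl_sdiff_box_le hR1).trans (ENNReal.ofReal_le_ofReal hτ2)
    have h1 : ENNReal.ofReal (c / 2) + ENNReal.ofReal (c / 2) ≤ X + ENNReal.ofReal (c / 2) := by
      rw [← ENNReal.ofReal_add (by positivity) (by positivity), add_halves]
      refine hvol1.trans ((measure_mono (t := ({z | κ ≤ f (dil z₀ ρ z)} ∩ (P ∩ B)) ∪ (P \ B)) ?_).trans
        ((measure_union_le _ _).trans (by gcongr)))
      rintro z ⟨h1, h2⟩
      by_cases h3 : z ∈ B
      · exact Or.inl ⟨h1, h2, h3⟩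
      · exact Or.inr ⟨h2, h3⟩
    exact (ENNReal.add_le_add_iff_right ENNReal.ofReal_ne_top).1 h1
  have hres := key (fun z => f (dil z₀ ρ z)) H s κ (aestronglyMeasurable_dil hρ hdB hfm) hfB hH1
    (fun κ' h1 h2 => h.eLpNorm_grad_le hCm hf hs hS hρ hρ1 hR1 hτ0 (by linarith) h1 h2 hsub
      (hH1 κ' h1))
    (fun κ' h1 => (hH2 κ' h1).trans (by gcongr; exact hSB)) hκ hsκ hvol2
  have himg1 : dil z₀ ρ '' cyl 1 0 = cyl ρ z₀ := by
    rw [dil_image_cyl z₀ _ hρ]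
    congr 1
    · ring
    · simp [dil, scale, comp]
  have e : dil z₀ ρ ⁻¹' ({z | f z < θ * κ} ∩ cyl ρ z₀) =
      {z | f (dil z₀ ρ z) < θ * κ} ∩ cyl 1 0 := by
    rw [preimage_inter, ← himg1, preimage_image_eq _ hinj]; rfl
  rw [← e, volume_preimage_dil z₀ hρ] at hres
  have h2 := mul_le_mul_right hres (ENNReal.ofReal (ρ ^ (4 * d + 2)))
  rw [← mul_assoc, ← ENNReal.ofReal_mul hpow.le, mul_inv_cancel₀ hpow.ne', ENNReal.ofReal_one, one_mul,
    ← ENNReal.ofReal_mul hpow.le] at h2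
  rwa [mul_comm δ]


/-! ### Chains of cylinders along free trajectories. -/

/-- The point at time `τ` on the free trajectory through `z`. -/
def ray (z : Ph d) (τ : ℝ) : Ph d := comp z (τ - z.1, 0, 0)

theorem ray_eq (z : Ph d) (τ : ℝ) : ray z τ = (τ, z.2.1 + (τ - z.1) • z.2.2, z.2.2) := by
  simp [ray, comp]

theorem comp_ray (z : Ph d) (τ h : ℝ) : comp (ray z τ) (h, 0, 0) = ray z (τ + h) := by
  rw [ray, ray, comp_assoc]
  congr 1
  simp only [comp, smul_zero, add_zero]
  congr 1
  ring

theorem mem_comp_ray_box {z y : Ph d} {τ a b p q : ℝ} :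
    y ∈ comp (ray z τ) '' box d a b p q ↔ (τ + a < y.1 ∧ y.1 ≤ τ + b) ∧
      ‖y.2.1 - z.2.1 - (y.1 - z.1) • z.2.2‖ < p ∧ ‖y.2.2 - z.2.2‖ < q := by
  rw [mem_comp_box, ray_eq]
  have e : y.2.1 - (z.2.1 + (τ - z.1) • z.2.2) - (y.1 - τ) • z.2.2 =
      y.2.1 - z.2.1 - (y.1 - z.1) • z.2.2 := by module
  simp only [e, lt_sub_iff_add_lt', sub_le_iff_le_add']

theorem mem_cyl_ray {z y : Ph d} {τ r : ℝ} :
    y ∈ cyl r (ray z τ) ↔ (τ - r ^ 2 < y.1 ∧ y.1 ≤ τ) ∧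
      ‖y.2.1 - z.2.1 - (y.1 - z.1) • z.2.2‖ < r ^ 3 ∧ ‖y.2.2 - z.2.2‖ < r := by
  rw [cyl, mem_comp_ray_box, ← sub_eq_add_neg, add_zero]

/-- Expansion of positivity in measure for `f` in `Ω`, with source of size `s`. -/
def Expands (c δ R θ s : ℝ) (Ω : Set (Ph d)) (f : Ph d → ℝ) : Prop :=
  ∀ (z₀ : Ph d) (ρ κ : ℝ), 0 < ρ → ρ ≤ 1 →
    comp z₀ '' box d (ρ ^ 2 * (-3 / 2)) 0 (16 * R * ρ ^ 3) (4 * R * ρ) ⊆ Ω → 0 < κ → s ≤ θ * κ →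
    ENNReal.ofReal (c * ρ ^ (4 * d + 2)) ≤
      volume ({z | κ ≤ f z} ∩ cyl (ρ / 2) (comp z₀ (-(5 / 4) * ρ ^ 2, 0, 0))) →
    volume ({z | f z < θ * κ} ∩ cyl ρ z₀) ≤ ENNReal.ofReal (δ * ρ ^ (4 * d + 2))

/-- Turns the conclusion of one expansion into the density hypothesis of the next. -/
theorem half_volume_cyl_le {f : Ph d → ℝ} {κ δ ρ : ℝ} {z : Ph d} (hρ : 0 < ρ)
    (hδ : δ ≤ unitVol d / 2)
    (h : volume ({z | f z < κ} ∩ cyl ρ z) ≤ ENNReal.ofReal (δ * ρ ^ (4 * d + 2))) :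
    ENNReal.ofReal (unitVol d / 2 * ρ ^ (4 * d + 2)) ≤ volume ({z | κ ≤ f z} ∩ cyl ρ z) := by
  have hV := unitVol_pos (d := d)
  have hp : 0 < ρ ^ (4 * d + 2) := by positivity
  have h1 : ENNReal.ofReal (unitVol d / 2 * ρ ^ (4 * d + 2)) +
      ENNReal.ofReal (unitVol d / 2 * ρ ^ (4 * d + 2)) ≤
      volume ({z | κ ≤ f z} ∩ cyl ρ z) + ENNReal.ofReal (unitVol d / 2 * ρ ^ (4 * d + 2)) := by
    rw [← ENNReal.ofReal_add (by positivity) (by positivity), ← add_mul, add_halves, ← volume_cyl z hρ]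
    refine (measure_mono (t := ({z | κ ≤ f z} ∩ cyl ρ z) ∪ ({z | f z < κ} ∩ cyl ρ z)) ?_).trans
      ((measure_union_le _ _).trans ?_)
    · intro y hy
      rcases le_or_gt κ (f y) with h | h
      · exact Or.inl ⟨h, hy⟩
      · exact Or.inr ⟨h, hy⟩
    · gcongr
      exact h.trans (by gcongr)
  exact (ENNReal.add_le_add_iff_right ENNReal.ofReal_ne_top).1 h1

/-- Iterated expansion of positivity along a free trajectory, the radius being doubled at each step. -/
theorem Expands.iterate {c δ R θ s : ℝ} {Ω : Set (Ph d)} {f : Ph d → ℝ} (h : Expands c δ R θ s Ω f)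
    (hδ : δ ≤ unitVol d / 2) (hc : c * 2 ^ (4 * d + 2) ≤ unitVol d / 2) (hθ : 0 < θ) (hθ1 : θ < 1)
    {z : Ph d} {β ρ M : ℝ} {n : ℕ} (hρ : 0 < ρ) (hn : 2 ^ n * ρ ≤ 1)
    (hsub : ∀ j < n, comp (ray z (β + ρ ^ 2 * (5 * 4 ^ (j + 1) - 2) / 3)) ''
      box d ((2 ^ (j + 1) * ρ) ^ 2 * (-3 / 2)) 0 (16 * R * (2 ^ (j + 1) * ρ) ^ 3)
        (4 * R * (2 ^ (j + 1) * ρ)) ⊆ Ω)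
    (hM : 0 < M) (h0 : ENNReal.ofReal (c * (2 * ρ) ^ (4 * d + 2)) ≤
      volume ({z | M ≤ f z} ∩ cyl ρ (ray z (β + ρ ^ 2)))) (j : ℕ) (hj : j < n)
    (hs : s ≤ θ ^ (j + 1) * M) :
    volume ({y | f y < θ ^ (j + 1) * M} ∩
        cyl (2 ^ (j + 1) * ρ) (ray z (β + ρ ^ 2 * (5 * 4 ^ (j + 1) - 2) / 3))) ≤
      ENNReal.ofReal (δ * (2 ^ (j + 1) * ρ) ^ (4 * d + 2)) := by
  have h4 (i : ℕ) : ((2 : ℝ) ^ i) ^ 2 = 4 ^ i := by rw [← pow_mul, mul_comm, pow_mul]; norm_num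
  have hradius : 2 ^ (j + 1) * ρ ≤ 1 :=
    le_trans (mul_le_mul_of_nonneg_right (pow_le_pow_right₀ one_le_two hj) hρ.le) hn
  -- The times `T_j = β + ρ²(5·4^j - 2)/3` satisfy `T_0 = β + ρ²` and `T_{j+1} = T_j +
  -- (5/4)(2^{j+1}ρ)²`, so the past cylinder of each expansion is the cylinder filled by the
  -- preceding one.
  have hpast : cyl (2 ^ (j + 1) * ρ / 2) (comp (ray z (β + ρ ^ 2 * (5 * 4 ^ (j + 1) - 2) / 3))
      (-(5 / 4) * (2 ^ (j + 1) * ρ) ^ 2, 0, 0)) =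
      cyl (2 ^ j * ρ) (ray z (β + ρ ^ 2 * (5 * 4 ^ j - 2) / 3)) := by
    rw [comp_ray]
    congr 2
    · ring
    · rw [mul_pow, h4]; ring
  induction j with
  | zero =>
    have := h _ (2 ^ (0 + 1) * ρ) M (by positivity) hradius (hsub 0 hj) hM (by simpa using hs)
    rw [hpast] at this
    simp only [zero_add, pow_one, pow_zero, one_mul, mul_one] at this ⊢
    refine this (h0.trans (le_of_eq ?_))
    congr 4; ring
  | succ j ih =>
    have hs' : s ≤ θ ^ (j + 1) * M := by
      refine hs.trans (mul_le_mul_of_nonneg_right ?_ hM.le)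
      exact pow_le_pow_of_le_one hθ.le hθ1.le (by omega)
    have h1 := half_volume_cyl_le (by positivity) hδ (ih (by omega) hs' (le_trans (mul_le_mul_of_nonneg_right
      (pow_le_pow_right₀ one_le_two (by omega)) hρ.le) hn) (by
        rw [comp_ray]
        congr 2
        · ring
        · rw [mul_pow, h4]; ring))
    have := h _ (2 ^ (j + 1 + 1) * ρ) (θ ^ (j + 1) * M) (by positivity) hradius (hsub (j + 1) hj)
      (by positivity) (by rw [← mul_assoc, ← pow_succ']; exact hs)
    rw [hpast, ← mul_assoc, ← pow_succ'] at this
    refine this (le_trans ?_ h1)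
    refine ENNReal.ofReal_le_ofReal ?_
    have e : c * (2 ^ (j + 1 + 1) * ρ) ^ (4 * d + 2) =
        c * 2 ^ (4 * d + 2) * (2 ^ (j + 1) * ρ) ^ (4 * d + 2) := by
      rw [mul_assoc, ← mul_pow]; congr 2; ring
    rw [e]
    gcongr

/-- Choice of the initial radius of a chain of cylinders which ends exactly at time `0`. -/
theorem exists_chain_radius {t r β : ℝ} (ht : t ≤ -1 / 2) (hr : 0 < r) (hr1 : r ≤ 1 / 8)
    (hβ : β = max (-1) (t - r ^ 2)) :
    ∃ (n : ℕ) (ρ : ℝ), 1 ≤ n ∧ 2 * r ≤ ρ ∧ ρ ≤ 5 * r ∧ β + ρ ^ 2 * (5 * 4 ^ n - 2) / 3 = 0 ∧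
      1 / 2 ≤ 2 ^ n * ρ ∧ 2 ^ n * ρ ≤ 1 ∧ 2 ^ n * r ≤ 1 := by
  have hB1 : -β ≤ 1 := by rw [hβ]; linarith [le_max_left (-1) (t - r ^ 2)]
  have hB2 : 1 / 2 ≤ -β := by
    have : β ≤ -1 / 2 := hβ ▸ max_le (by norm_num) (by nlinarith)
    linarith
  set B := -β with hB
  have hr2 : 0 < r ^ 2 := by positivity
  have hY : (4 : ℝ) ≤ 3 * B / (20 * r ^ 2) := by
    rw [le_div_iff₀ (by positivity)]; nlinarith
  -- `ρ` below is fixed by the requirement that the chain end at time `0`. The lower bound on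
  -- `3B/(20r²)` then gives `ρ ≥ 2r` and the upper one gives `ρ ≤ 5r`.
  obtain ⟨n, hn1, hn2⟩ := exists_nat_pow_near (by linarith : (1 : ℝ) ≤ 3 * B / (20 * r ^ 2))
    (by norm_num : (1 : ℝ) < 4)
  have hn : 1 ≤ n := by
    by_contra hn
    obtain rfl : n = 0 := by omega
    norm_num at hn2
    linarith
  have hq : (4 : ℝ) ≤ 4 ^ n := by
    calc (4 : ℝ) = 4 ^ 1 := by norm_num
      _ ≤ 4 ^ n := pow_le_pow_right₀ (by norm_num) hn
  rw [pow_succ (4 : ℝ) n] at hn2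
  have hsq : ((2 : ℝ) ^ n) ^ 2 = 4 ^ n := by rw [← pow_mul, mul_comm, pow_mul]; norm_num
  rw [le_div_iff₀ (by positivity)] at hn1
  rw [div_lt_iff₀ (by positivity)] at hn2
  set q : ℝ := 4 ^ n with hqd
  have hq5 : 0 < 5 * q - 2 := by linarith
  set ρ := √(3 * B / (5 * q - 2)) with hρd
  have hρ0 : 0 ≤ ρ := Real.sqrt_nonneg _
  have hρ2 : ρ ^ 2 = 3 * B / (5 * q - 2) := Real.sq_sqrt (by positivity)
  have hρ3 : ρ ^ 2 * (5 * q - 2) = 3 * B := by rw [hρ2]; field_simp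
  have h2q : ρ ^ 2 * q * 5 - ρ ^ 2 * 2 = 3 * B := by linarith
  have hρq : ρ ^ 2 * 4 ≤ ρ ^ 2 * q := by gcongr
  refine ⟨n, ρ, hn, ?_, ?_, by linarith, ?_, ?_, ?_⟩
  · refine abs_le_of_sq_le_sq' ?_ hρ0 |>.2
    rw [hρ2, le_div_iff₀ hq5]
    nlinarith
  · refine abs_le_of_sq_le_sq' ?_ (by positivity) |>.2
    rw [hρ2, div_le_iff₀ hq5]
    have : r ^ 2 * 4 ≤ r ^ 2 * q := by gcongr
    nlinarith
  · refine abs_le_of_sq_le_sq' ?_ (by positivity) |>.2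
    rw [mul_pow, hsq]
    nlinarith
  · refine abs_le_of_sq_le_sq' ?_ (by positivity) |>.2
    rw [mul_pow, hsq]
    nlinarith
  · refine abs_le_of_sq_le_sq' ?_ (by positivity) |>.2
    rw [mul_pow, hsq]
    nlinarith


/-- The points in question occur after time `max (-1) (z.1 - r²)` and within a duration `2r²`,
whereas the cylinder starts at that time and lasts `ρ² ≥ 4r²`. -/
theorem inter_ocyl_subset_cyl_ray {z : Ph d} {r ρ : ℝ} (hr : 0 < r) (h : 2 * r ≤ ρ) :
    {y | -1 < y.1} ∩ ocyl r z ⊆ cyl ρ (ray z (max (-1) (z.1 - r ^ 2) + ρ ^ 2)) := by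
  rintro y ⟨h0, h1, h2, h3⟩
  simp only [mem_ofPred_eq] at h0
  have h4 := abs_lt.1 h1
  refine mem_cyl_ray.2 ⟨⟨?_, ?_⟩, h2.trans_le ?_, h3.trans_le (by linarith)⟩
  · rw [add_sub_cancel_right]
    exact max_lt h0 (by linarith)
  · have := le_max_right (-1) (z.1 - r ^ 2)
    nlinarith
  · gcongr; linarith

/-- The cylinder starts at `β + 2ρ² > -1` and ends at `β + 6ρ² ≤ z.1 + 150r²`; the integer `13` is
the least whose square exceeds `150`. -/
theorem cyl_ray_subset_ocyl {z : Ph d} {r ρ β : ℝ} (hr : 0 < r) (hz : -1 < z.1)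
    (hβ : β = max (-1) (z.1 - r ^ 2)) (h : 2 * r ≤ ρ) (h' : ρ ≤ 5 * r) :
    cyl (2 * ρ) (ray z (β + ρ ^ 2 * 6)) ⊆ {y | -1 < y.1} ∩ ocyl (13 * r) z := by
  intro y hy
  obtain ⟨⟨h1, h2⟩, h3, h4⟩ := mem_cyl_ray.1 hy
  have hb1 : -1 ≤ β := hβ ▸ le_max_left _ _
  have hb2 : z.1 - r ^ 2 ≤ β := hβ ▸ le_max_right _ _
  have hr2 : 0 < r ^ 2 := by positivity
  have hb3 : β ≤ z.1 := hβ ▸ max_le hz.le (by linarith)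
  have hρ : ρ ^ 2 ≤ 25 * r ^ 2 := by nlinarith
  have hρ0 : 0 < ρ ^ 2 := by nlinarith
  refine ⟨?_, ?_, h3.trans_le ?_, h4.trans_le (by linarith)⟩
  · simp only [mem_ofPred_eq]; linarith
  · rw [abs_lt]; constructor <;> nlinarith
  · exact pow_le_pow_left₀ (by linarith) (by linarith) 3

theorem norm_add_smul_le {x v : EuclideanSpace ℝ (Fin d)} {τ : ℝ} :
    ‖x + τ • v‖ ≤ ‖x‖ + |τ| * ‖v‖ :=
  (norm_add_le _ _).trans (by rw [norm_smul, Real.norm_eq_abs])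

theorem norm_fst_lt_of_transport {y z : Ph d} {p : ℝ} (ht : |y.1 - z.1| ≤ 1) (hx : ‖z.2.1‖ ≤ 1 / 500)
    (hv : ‖z.2.2‖ ≤ 1 / 500) (hp : ‖y.2.1 - z.2.1 - (y.1 - z.1) • z.2.2‖ < p) :
    ‖y.2.1‖ < p + 1 / 250 := by
  have e : y.2.1 = (y.2.1 - z.2.1 - (y.1 - z.1) • z.2.2) + (z.2.1 + (y.1 - z.1) • z.2.2) := by module
  have h5 := (norm_add_le (y.2.1 - z.2.1 - (y.1 - z.1) • z.2.2) (z.2.1 + (y.1 - z.1) • z.2.2)).trans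
    (add_le_add_right norm_add_smul_le _)
  rw [← e] at h5
  have h7 : |y.1 - z.1| * ‖z.2.2‖ ≤ 1 * (1 / 500) := by gcongr
  linarith

theorem norm_snd_lt_of_transport {y z : Ph d} {q : ℝ} (hv : ‖z.2.2‖ ≤ 1 / 500)
    (hq : ‖y.2.2 - z.2.2‖ < q) : ‖y.2.2‖ < q + 1 / 250 := by
  have h5 : ‖y.2.2‖ ≤ ‖y.2.2 - z.2.2‖ + ‖z.2.2‖ := by simpa using norm_add_le (y.2.2 - z.2.2) z.2.2
  linarith

/-- The box of step `j` starts at time `β + ρ²(2·4^j - 2)/3 ≥ β`, with equality for `j = 0`, so the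
initial time is never crossed. Its radii are at most `16R` and `4R`, and the trajectory drifts by
little. -/
theorem comp_ray_box_subset {z : Ph d} {R R₀ β ρ : ℝ} {n j : ℕ} (hR : 1 < R)
    (hR₀ : R₀ = 16 * R + 10) (hz : -1 < z.1) (hz1 : z.1 ≤ -1 / 2) (hx : ‖z.2.1‖ ≤ 1 / 500)
    (hv : ‖z.2.2‖ ≤ 1 / 500) (hβ : -1 ≤ β) (hρ : 0 < ρ) (hρn : 2 ^ n * ρ ≤ 1)
    (hend : β + ρ ^ 2 * (5 * 4 ^ n - 2) / 3 = 0) (hj : j < n) :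
    comp (ray z (β + ρ ^ 2 * (5 * 4 ^ (j + 1) - 2) / 3)) ''
      box d ((2 ^ (j + 1) * ρ) ^ 2 * (-3 / 2)) 0 (16 * R * (2 ^ (j + 1) * ρ) ^ 3)
        (4 * R * (2 ^ (j + 1) * ρ)) ⊆ box d (-1) 0 R₀ R₀ := by
  intro y hy
  obtain ⟨⟨h1, h2⟩, h3, h4⟩ := mem_comp_ray_box.1 hy
  have hρj : 2 ^ (j + 1) * ρ ≤ 1 :=
    le_trans (mul_le_mul_of_nonneg_right (pow_le_pow_right₀ one_le_two hj) hρ.le) hρn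
  have hρj0 : 0 < 2 ^ (j + 1) * ρ := by positivity
  have hq : (1 : ℝ) ≤ 4 ^ j := one_le_pow₀ (by norm_num)
  have hq' : (4 : ℝ) ^ (j + 1) ≤ 4 ^ n := pow_le_pow_right₀ (by norm_num) hj
  have hsq : (2 ^ (j + 1) * ρ) ^ 2 = 4 * 4 ^ j * ρ ^ 2 := by
    have : ((2 : ℝ) ^ (j + 1)) ^ 2 = 4 * 4 ^ j := by
      rw [← pow_mul, mul_comm (j + 1), pow_mul]; norm_num [pow_succ, mul_comm]
    rw [mul_pow, this]
  have ht1 : -1 < y.1 := by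
    rw [hsq, pow_succ (4 : ℝ) j] at h1
    have : ρ ^ 2 * 1 ≤ ρ ^ 2 * 4 ^ j := by gcongr
    linarith
  have ht2 : y.1 ≤ 0 := by
    have : ρ ^ 2 * (5 * 4 ^ (j + 1) - 2) ≤ ρ ^ 2 * (5 * 4 ^ n - 2) := by gcongr
    linarith
  have hcube : 16 * R * (2 ^ (j + 1) * ρ) ^ 3 ≤ 16 * R * 1 := by
    gcongr; exact pow_le_one₀ hρj0.le hρj
  have hlin : 4 * R * (2 ^ (j + 1) * ρ) ≤ 4 * R * 1 := by gcongr
  have h5 := norm_fst_lt_of_transport (abs_le.2 ⟨by linarith, by linarith⟩) hx hv h3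
  have h6 := norm_snd_lt_of_transport hv h4
  exact mem_box.2 ⟨⟨ht1, ht2⟩, by linarith, by linarith⟩

/-- A set of positive density at scale `r` on which `f ≥ M`: expansion of positivity fills a
neighbouring cylinder of comparable size, and, followed up to time `0`, bounds `M` in terms of
lower bounds of `f` near the origin. -/
theorem Expands.chain {c c₀ δ R R₀ θ s K : ℝ} {f : Ph d → ℝ}
    (h : Expands c δ R θ s (box d (-1) 0 R₀ R₀) f) (hR : 1 < R) (hR₀ : R₀ = 16 * R + 10)
    (hδ : δ ≤ unitVol d / 2) (hδ0 : 0 ≤ δ)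
    (hc : c * 2 ^ (4 * d + 2) ≤ unitVol d / 2) (hc0 : 0 ≤ c)
    (hcc : c * 10 ^ (4 * d + 2) ≤ c₀) (hθ : 0 < θ) (hθ1 : θ < 1)
    (hDG : ∀ M : ℝ, 0 < M → s ≤ M → ∀ z ∈ box d (-1) 0 R₀ R₀, cyl (1 / 2) z ⊆ box d (-1) 0 R₀ R₀ →
      volume ({y | f y < M} ∩ cyl (1 / 2) z) ≤ ENNReal.ofReal δ →
      ∀ᵐ y ∂volume.restrict (cyl (1 / 4) z), M / 2 ≤ f y)
    (hK : ∀ m : ℝ, (∀ᵐ y ∂volume.restrict (cyl (1 / 1000) (0 : Ph d)), m ≤ f y) → m ≤ K)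
    (hK0 : 0 < K) (hsK : s ≤ K) {z : Ph d} (hz : -1 < z.1) (hz1 : z.1 ≤ -1 / 2)
    (hx : ‖z.2.1‖ ≤ 1 / 500) (hv : ‖z.2.2‖ ≤ 1 / 500) {r M : ℝ} (hr : 0 < r) (hr1 : r ≤ 1 / 8)
    (hM : 0 < M) (hsM : s ≤ θ * M) {E : Set (Ph d)} (hE : E ⊆ {y | M ≤ f y} ∩ {y | -1 < y.1})
    (hvol : ENNReal.ofReal (c₀ * r ^ (4 * d + 2)) ≤ volume (E ∩ ocyl r z)) :
    ENNReal.ofReal (unitVol d / 2 * r ^ (4 * d + 2)) ≤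
        volume ({y | θ * M ≤ f y} ∩ ({y | -1 < y.1} ∩ ocyl (13 * r) z)) ∧
      ∃ n : ℕ, 2 ^ n * r ≤ 1 ∧ θ ^ n * M ≤ 2 * K := by
  obtain ⟨β, hβ⟩ : ∃ β, β = max (-1) (z.1 - r ^ 2) := ⟨_, rfl⟩
  obtain ⟨n, ρ, hn, hρ1, hρ2, hend, hρn1, hρn2, hrn⟩ := exists_chain_radius hz1 hr hr1 hβ
  have hρ : 0 < ρ := by linarith
  have hb1 : -1 ≤ β := hβ ▸ le_max_left _ _
  have hV := unitVol_pos (d := d)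
  have hsub : ∀ j < n, comp (ray z (β + ρ ^ 2 * (5 * 4 ^ (j + 1) - 2) / 3)) ''
      box d ((2 ^ (j + 1) * ρ) ^ 2 * (-3 / 2)) 0 (16 * R * (2 ^ (j + 1) * ρ) ^ 3)
        (4 * R * (2 ^ (j + 1) * ρ)) ⊆ box d (-1) 0 R₀ R₀ := by
    intro j hj
    exact comp_ray_box_subset hR hR₀ hz hz1 hx hv hb1 hρ hρn2 hend hj
  have h0 : ENNReal.ofReal (c * (2 * ρ) ^ (4 * d + 2)) ≤
      volume ({y | M ≤ f y} ∩ cyl ρ (ray z (β + ρ ^ 2))) := by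
    refine le_trans (ENNReal.ofReal_le_ofReal ?_) (hvol.trans (measure_mono ?_))
    · calc c * (2 * ρ) ^ (4 * d + 2) ≤ c * (10 * r) ^ (4 * d + 2) :=
          mul_le_mul_of_nonneg_left (pow_le_pow_left₀ (by positivity) (by linarith) _) hc0
        _ = c * 10 ^ (4 * d + 2) * r ^ (4 * d + 2) := by rw [mul_pow, mul_assoc]
        _ ≤ c₀ * r ^ (4 * d + 2) := by gcongr
    · rintro y ⟨hy1, hy2⟩
      exact ⟨(hE hy1).1, hβ ▸ inter_ocyl_subset_cyl_ray hr hρ1 ⟨(hE hy1).2, hy2⟩⟩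
  have hiter := h.iterate hδ hc hθ hθ1 hρ hρn2 hsub hM h0
  constructor
  · have h1 := hiter 0 (by omega) (by simpa using hsM)
    have h2 := half_volume_cyl_le (by positivity) hδ h1
    simp only [zero_add, pow_one] at h2
    refine le_trans (ENNReal.ofReal_le_ofReal ?_) (h2.trans (measure_mono ?_))
    · gcongr; linarith
    · refine inter_subset_inter_right _ ?_
      have e : β + ρ ^ 2 * (5 * 4 - 2) / 3 = β + ρ ^ 2 * 6 := by ring
      rw [e]
      exact cyl_ray_subset_ocyl hr hz hβ hρ1 hρ2
  · refine ⟨n, hrn, ?_⟩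
    -- If `θ^n M > 2K`, the source is below this level and the last cylinder, at time `0` and of
    -- radius at least `1/2`, feeds the De Giorgi iteration. Then `f ≥ θ^n M / 2 > K` near the
    -- origin, which `hK` forbids.
    by_contra! hcon
    have hs' : s ≤ θ ^ n * M := by linarith
    obtain ⟨m, rfl⟩ : ∃ m, n = m + 1 := ⟨n - 1, by omega⟩
    have h1 := hiter m (by omega) hs'
    rw [hend] at h1
    have h2 : cyl (1 / 2) (ray z 0) ⊆ cyl (2 ^ (m + 1) * ρ) (ray z 0) := by
      intro y hy
      obtain ⟨⟨h1, h2⟩, h3, h4⟩ := mem_cyl_ray.1 hy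
      refine mem_cyl_ray.2 ⟨⟨lt_of_le_of_lt ?_ h1, h2⟩, h3.trans_le ?_, h4.trans_le hρn1⟩ <;> gcongr
    have h3 : volume ({y | f y < θ ^ (m + 1) * M} ∩ cyl (1 / 2) (ray z 0)) ≤ ENNReal.ofReal δ := by
      refine (measure_mono (inter_subset_inter_right _ h2)).trans (h1.trans
        (ENNReal.ofReal_le_ofReal ?_))
      exact mul_le_of_le_one_right hδ0 (pow_le_one₀ (by positivity) hρn2)
    have h4 : cyl (1 / 2) (ray z 0) ⊆ box d (-1) 0 R₀ R₀ := by
      intro y hy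
      obtain ⟨⟨h1, h2⟩, h3, h4⟩ := mem_cyl_ray.1 hy
      norm_num at h1
      have h5 := norm_fst_lt_of_transport (abs_le.2 ⟨by linarith, by linarith⟩) hx hv h3
      have h6 := norm_snd_lt_of_transport hv h4
      norm_num at h5 h6
      exact mem_box.2 ⟨⟨by linarith, h2⟩, by linarith, by linarith⟩
    have h5 : ray z 0 ∈ cyl (1 / 2) (ray z 0) := by
      refine mem_cyl_ray.2 ?_
      rw [ray_eq]
      norm_num
    have h6 := hDG _ (by positivity) hs' _ (h4 h5) h4 h3
    have h7 : cyl (1 / 1000) (0 : Ph d) ⊆ cyl (1 / 4) (ray z 0) := by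
      intro y hy
      obtain ⟨⟨h1, h2⟩, h3, h4⟩ := mem_comp_box.1 hy
      simp only [Prod.fst_zero, Prod.snd_zero, sub_zero, smul_zero] at h1 h2 h3 h4
      refine mem_cyl_ray.2 ⟨⟨by norm_num at h1 ⊢; linarith, h2⟩, ?_, ?_⟩
      · have e : y.2.1 - z.2.1 - (y.1 - z.1) • z.2.2 = y.2.1 - (z.2.1 + (y.1 - z.1) • z.2.2) := by
          module
        have h5 := (norm_sub_le y.2.1 (z.2.1 + (y.1 - z.1) • z.2.2)).trans
          (add_le_add_right norm_add_smul_le _)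
        rw [← e] at h5
        norm_num at h1
        have h6 : |y.1 - z.1| ≤ 1 := abs_le.2 ⟨by linarith, by linarith⟩
        have h7 : |y.1 - z.1| * ‖z.2.2‖ ≤ 1 * (1 / 500) := by gcongr
        norm_num at h3 ⊢
        linarith
      · have := norm_sub_le y.2.2 z.2.2
        linarith
    have h8 := hK _ (ae_restrict_of_ae_restrict_of_subset h7 h6)
    linarith


/-! ### Covering argument and decay of the superlevel sets near the initial time. -/

/-- If at every scale at which `E` has density at least `c₀` the set `F` fills a neighbouring region
of comparable size, then the measure of `E` is at most half of that of `F`. -/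
theorem two_mul_measure_le_of_density {E F : Set (Ph d)} {c₀ : ℝ} (hE : volume E ≠ ∞)
    (hc₀ : c₀ = unitVol d / (4 * 65 ^ (4 * d + 2)))
    (hstep : ∀ z ∈ E, ∀ r : ℝ, 0 < r → r ≤ 1 / 8 →
      ENNReal.ofReal (c₀ * r ^ (4 * d + 2)) ≤ volume (E ∩ ocyl r z) → 520 * r ≤ 1 ∧
        ENNReal.ofReal (unitVol d / 2 * r ^ (4 * d + 2)) ≤ volume (F ∩ ocyl (13 * r) z)) :
    2 * volume E ≤ volume F := by
  have hV := unitVol_pos (d := d)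
  set N := 4 * d + 2 with hN
  have hc₀pos : 0 < c₀ := hc₀ ▸ by positivity
  have h65 : (65 : ℝ) ^ N = 5 ^ N * 13 ^ N := by rw [← mul_pow]; norm_num
  -- `65 = 5 · 13`: the region filled by `F` lies in the dilate by `13`, and the covering enlarges
  -- by `5`. The value of `c₀` makes `F` occupy at least `2a (13r)^N` where `E` occupies at most `a
  -- (13r)^N`.
  set a := c₀ * 5 ^ N with ha
  have hapos : 0 < a := by positivity
  have ha' : a * 13 ^ N = unitVol d / 4 := by
    rw [ha, hc₀, h65]; field_simp
  set E' := {z ∈ E | ∃ r : ℝ, 0 < r ∧ r ≤ 1 / 8 ∧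
    ENNReal.ofReal (c₀ * r ^ N) ≤ volume (E ∩ ocyl r z)} with hE'
  have hnull : volume (E \ E') = 0 := by
    refine measure_mono_null ?_ (measure_setOf_forall_small_density hE hc₀pos
      (by norm_num : (0 : ℝ) < 1 / 8) ?_)
    · rintro z ⟨hz, hz'⟩
      refine ⟨hz, fun r hr hr1 => ?_⟩
      by_contra! hcon
      exact hz' ⟨hz, r, hr, hr1, hcon⟩
    · have : (1 : ℝ) ≤ 13 ^ N := one_le_pow₀ (by norm_num)
      change 2 * a < unitVol d
      nlinarith
  have hEE' : volume E ≤ volume E' := by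
    calc volume E ≤ volume (E' ∪ E \ E') := measure_mono (by
          intro z hz; by_cases h : z ∈ E'; exacts [Or.inl h, Or.inr ⟨hz, h⟩])
      _ ≤ volume E' + volume (E \ E') := measure_union_le _ _
      _ = volume E' := by rw [hnull, add_zero]
  -- A critical scale: density at least `c₀` at `r` and at most `c₀` at `65r`. Otherwise density
  -- would persist at every `65^i r`, since `520 r ≤ 1` means `65 r ≤ 1/8`, and the radii would be
  -- both bounded and unbounded.
  have hsel : ∀ z ∈ E', ∃ r : ℝ, 0 < r ∧ r ≤ 1 / 8 ∧
      ENNReal.ofReal (c₀ * r ^ N) ≤ volume (E ∩ ocyl r z) ∧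
      volume (E ∩ ocyl (65 * r) z) ≤ ENNReal.ofReal (c₀ * (65 * r) ^ N) := by
    rintro z ⟨hz, r, hr, hr1, hd⟩
    by_contra! hcon
    have hall : ∀ i : ℕ, 65 ^ i * r ≤ 1 / 8 ∧
        ENNReal.ofReal (c₀ * (65 ^ i * r) ^ N) ≤ volume (E ∩ ocyl (65 ^ i * r) z) := by
      intro i
      induction i with
      | zero => simpa using ⟨by linarith, hd⟩
      | succ i ih =>
        have h1 := (hstep z hz _ (by positivity) ih.1 ih.2).1
        have h2 := hcon _ (by positivity) ih.1 ih.2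
        have e : (65 : ℝ) ^ (i + 1) * r = 65 * (65 ^ i * r) := by ring
        rw [e]
        exact ⟨by linarith, h2.le⟩
    obtain ⟨i, hi⟩ := pow_unbounded_of_one_lt (1 / 8 / r) (by norm_num : (1 : ℝ) < 65)
    rw [div_lt_iff₀ hr] at hi
    exact absurd (hall i).1 (by linarith)
  choose! r hr0 hr1 hr2 hr3 using hsel
  have key := measure_le_of_forall_ocyl (E := E) (E' := E') (F := F) (a := ENNReal.ofReal a)
    (b := 2 * ENNReal.ofReal a) (R := 2) (fun z => 13 * r z) (fun z hz => hz.1)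
    (fun z hz => by have := hr0 z hz; positivity) (fun z hz => by have := hr1 z hz; linarith)
    (fun z hz => by
      rw [← ENNReal.ofReal_mul hapos.le]
      have e : 5 * (13 * r z) = 65 * r z := by ring
      rw [e]
      refine (hr3 z hz).trans (le_of_eq ?_)
      congr 1
      change c₀ * (65 * r z) ^ N = c₀ * 5 ^ N * (13 * r z) ^ N
      rw [mul_pow, mul_pow, h65]; ring)
    (fun z hz => by
      refine le_trans (le_of_eq ?_) (hstep z hz.1 _ (hr0 z hz) (hr1 z hz) (hr2 z hz)).2
      rw [← ENNReal.ofReal_ofNat, ← ENNReal.ofReal_mul (by norm_num), ← ENNReal.ofReal_mul (by positivity)]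
      congr 1
      rw [mul_pow]
      linear_combination 2 * r z ^ N * ha')
  have hne : ENNReal.ofReal a ≠ 0 := by simpa using hapos
  rw [mul_comm 2, mul_assoc, ENNReal.mul_le_mul_iff_right hne ENNReal.ofReal_ne_top] at key
  exact (by gcongr : 2 * volume E ≤ 2 * volume E').trans key

/-- A decreasing sequence of boxes at the initial time `-1`. -/
def initialBox (d k : ℕ) : Set (Ph d) :=
  {y | (-1 < y.1 ∧ y.1 < -1 + (1 + (1 / 2) ^ k) / 1000) ∧ ‖y.2.1‖ < (1 + (1 / 2) ^ k) / 1000 ∧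
    ‖y.2.2‖ < (1 + (1 / 2) ^ k) / 1000}

theorem volume_initialBox_le (k : ℕ) : volume (initialBox d k) ≤ ENNReal.ofReal (unitVol d) := by
  have h : volume (box d (-1) 0 1 1) = ENNReal.ofReal (unitVol d) := by
    rw [volume_box one_pos one_pos]; norm_num
  rw [← h]
  have hk : ((1 : ℝ) / 2) ^ k ≤ 1 := pow_le_one₀ (by norm_num) (by norm_num)
  refine measure_mono fun y hy => ?_
  obtain ⟨⟨h1, h2⟩, h3, h4⟩ := hy
  exact mem_box.2 ⟨⟨h1, by linarith⟩, by linarith, by linarith⟩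

/-- Consecutive boxes differ by `2^{-k}/2000` in each direction, except at the common initial time.
A displacement is at most `(13³ + 13²) r`, which fits since `2^23 > 8·10^6`; hence the shift by `22`
in the levels below. -/
theorem inter_ocyl_subset_initialBox {z : Ph d} {k : ℕ} {r : ℝ} (hz : z ∈ initialBox d (k + 1))
    (hr : 0 < r) (hrk : 2 ^ (k + 23) * r ≤ 1) :
    {y | -1 < y.1} ∩ ocyl (13 * r) z ⊆ initialBox d k := by
  rintro y ⟨h0, h1, h2, h3⟩
  obtain ⟨⟨h4, h5⟩, h6, h7⟩ := hz
  set q : ℝ := (1 / 2) ^ k with hq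
  have hq1 : q ≤ 1 := pow_le_one₀ (by norm_num) (by norm_num)
  have hq0 : 0 < q := by positivity
  rw [pow_succ, ← hq] at h5 h6 h7
  have hrq : 8000000 * r ≤ q := by
    rw [hq, one_div_pow, le_div_iff₀ (by positivity)]
    rw [pow_add] at hrk
    have : 0 < 2 ^ k * r := by positivity
    nlinarith
  have hr1 : r ≤ 1 := by linarith
  have hr2 : r ^ 2 ≤ r := pow_le_of_le_one hr.le hr1 (by norm_num)
  have hr3 : r ^ 3 ≤ r := pow_le_of_le_one hr.le hr1 (by norm_num)
  rw [mul_pow] at h1 h2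
  refine ⟨⟨h0, ?_⟩, ?_, ?_⟩
  · have := (abs_lt.1 h1).2
    linarith
  · have e : y.2.1 = (y.2.1 - z.2.1 - (y.1 - z.1) • z.2.2) + (z.2.1 + (y.1 - z.1) • z.2.2) := by
      module
    have h8 := (norm_add_le (y.2.1 - z.2.1 - (y.1 - z.1) • z.2.2) (z.2.1 + (y.1 - z.1) • z.2.2)).trans
      (add_le_add_right norm_add_smul_le _)
    rw [← e] at h8
    have h9 : |y.1 - z.1| * ‖z.2.2‖ ≤ 13 ^ 2 * r ^ 2 * 1 := by gcongr; linarith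
    linarith
  · have h8 : ‖y.2.2‖ ≤ ‖y.2.2 - z.2.2‖ + ‖z.2.2‖ := by simpa using norm_add_le (y.2.2 - z.2.2) z.2.2
    linarith

/-- Geometric decay of the superlevel sets in the shrinking boxes. -/
theorem Expands.measure_superlevel_le {c δ R R₀ θ s K : ℝ} {f : Ph d → ℝ}
    (h : Expands c δ R θ s (box d (-1) 0 R₀ R₀) f) (hR : 1 < R) (hR₀ : R₀ = 16 * R + 10)
    (hδ : δ ≤ unitVol d / 2) (hδ0 : 0 ≤ δ)
    (hc : c = unitVol d / (4 * 65 ^ (4 * d + 2)) / 10 ^ (4 * d + 2)) (hθ : 0 < θ) (hθ1 : θ < 1)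
    (hDG : ∀ M : ℝ, 0 < M → s ≤ M → ∀ z ∈ box d (-1) 0 R₀ R₀, cyl (1 / 2) z ⊆ box d (-1) 0 R₀ R₀ →
      volume ({y | f y < M} ∩ cyl (1 / 2) z) ≤ ENNReal.ofReal δ →
      ∀ᵐ y ∂volume.restrict (cyl (1 / 4) z), M / 2 ≤ f y)
    (hK : ∀ m : ℝ, (∀ᵐ y ∂volume.restrict (cyl (1 / 1000) (0 : Ph d)), m ≤ f y) → m ≤ K)
    (hK0 : 0 < K) (hsK : s ≤ K) (k : ℕ) :
    2 ^ k * volume ({y | 2 * K * θ⁻¹ ^ (k + 22) ≤ f y} ∩ initialBox d k) ≤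
      ENNReal.ofReal (unitVol d) := by
  have hV := unitVol_pos (d := d)
  have hθi : 1 ≤ θ⁻¹ := (one_le_inv₀ hθ).2 hθ1.le
  have hc0 : 0 < c := hc ▸ by positivity
  have hc2 : c * 2 ^ (4 * d + 2) ≤ unitVol d / 2 := by
    have h1 : (2 : ℝ) ^ (4 * d + 2) ≤ 10 ^ (4 * d + 2) :=
      pow_le_pow_left₀ (by norm_num) (by norm_num) _
    have h2 : (1 : ℝ) ≤ 65 ^ (4 * d + 2) := one_le_pow₀ (by norm_num)
    calc c * 2 ^ (4 * d + 2) ≤ c * 10 ^ (4 * d + 2) := by gcongr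
      _ = unitVol d / (4 * 65 ^ (4 * d + 2)) := by rw [hc]; field_simp
      _ ≤ unitVol d / 2 := by gcongr; linarith
  have hcc : c * 10 ^ (4 * d + 2) ≤ unitVol d / (4 * 65 ^ (4 * d + 2)) := by
    rw [hc]; exact le_of_eq (by field_simp)
  induction k with
  | zero =>
    rw [pow_zero, one_mul]
    exact (measure_mono inter_subset_right).trans (volume_initialBox_le 0)
  | succ k ih =>
    rw [pow_succ, mul_assoc]
    refine le_trans (mul_le_mul_right ?_ _) ih
    have hq1 : ((1 : ℝ) / 2) ^ (k + 1) ≤ 1 := pow_le_one₀ (by norm_num) (by norm_num)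
    refine two_mul_measure_le_of_density (((measure_mono inter_subset_right).trans
      (volume_initialBox_le (k + 1))).trans_lt ENNReal.ofReal_lt_top).ne rfl ?_
    intro z hz r hr hr1 hd
    obtain ⟨⟨h1, h2⟩, h3, h4⟩ := hz.2
    have hlev : θ * (2 * K * θ⁻¹ ^ (k + 1 + 22)) = 2 * K * θ⁻¹ ^ (k + 22) := by
      rw [show k + 1 + 22 = (k + 22) + 1 by ring, pow_succ]; field_simp
    have hlev1 : s ≤ θ * (2 * K * θ⁻¹ ^ (k + 1 + 22)) := by
      rw [hlev]
      have : 1 ≤ θ⁻¹ ^ (k + 22) := one_le_pow₀ hθi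
      nlinarith
    obtain ⟨hfill, n, hn, hθn⟩ := h.chain (c₀ := unitVol d / (4 * 65 ^ (4 * d + 2))) hR hR₀ hδ hδ0 hc2
      hc0.le hcc hθ hθ1 hDG hK hK0 hsK h1 (by linarith) (by linarith) (by linarith) hr hr1
      (M := 2 * K * θ⁻¹ ^ (k + 1 + 22)) (by positivity) hlev1
      (E := {y | 2 * K * θ⁻¹ ^ (k + 1 + 22) ≤ f y} ∩ initialBox d (k + 1))
      (fun y hy => ⟨hy.1, hy.2.1.1⟩) hd
    -- At the level `2K θ^{-(k+23)}`, the bound `θ^n M ≤ 2K` requires at least `k + 23` links, so `r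
    -- ≤ 2^{-(k+23)}`.
    have hnk : k + 23 ≤ n := by
      by_contra! hlt
      have h5 : θ ^ (k + 23) < θ ^ n := pow_lt_pow_right_of_lt_one₀ hθ hθ1 hlt
      have h6 : θ ^ (k + 23) * (2 * K * θ⁻¹ ^ (k + 1 + 22)) = 2 * K := by
        rw [show k + 1 + 22 = k + 23 by ring, inv_pow]; field_simp
      have h7 := mul_lt_mul_of_pos_right h5
        (by positivity : 0 < 2 * K * θ⁻¹ ^ (k + 1 + 22))
      linarith
    have hrk : 2 ^ (k + 23) * r ≤ 1 :=
      le_trans (mul_le_mul_of_nonneg_right (pow_le_pow_right₀ one_le_two hnk) hr.le) hn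
    refine ⟨?_, hfill.trans (measure_mono ?_)⟩
    · have : (1 : ℝ) ≤ 2 ^ k := one_le_pow₀ (by norm_num)
      rw [pow_add] at hrk
      have h8 : 1 * r ≤ 2 ^ k * r := by gcongr
      linarith
    · rw [hlev, inter_assoc]
      refine inter_subset_inter_right _ (subset_inter ?_ inter_subset_right)
      exact inter_ocyl_subset_initialBox hz.2 hr hrk

end Kinetic

/-! ### Integrability of a small power and conclusion. -/

/-- The `p`-th powers of the levels grow like `(3/2)^k` while the measures decay like `2^{-k}`: the
series has ratio `3/4` and sum `6`, and the part below `A` adds `1`. -/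
theorem MeasureTheory.setLIntegral_rpow_le_of_measure_superlevel {X : Type*} [MeasurableSpace X]
    {μ : Measure X} {Q : Set X} (hQ : MeasurableSet Q) {f : X → ℝ}
    (hf : AEStronglyMeasurable f (μ.restrict Q)) {A L p : ℝ} {V : ℝ≥0∞} (hA : 0 < A) (hL : 1 < L)
    (hp : 0 < p) (hLp : L ^ p = 3 / 2) (hV : μ Q ≤ V)
    (h : ∀ k : ℕ, 2 ^ k * μ ({x | A * L ^ k ≤ f x} ∩ Q) ≤ V) :
    ∫⁻ x in Q, ENNReal.ofReal (f x) ^ p ∂μ ≤ 7 * V * ENNReal.ofReal A ^ p := by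
  set c := ENNReal.ofReal A ^ p with hc
  have hlev (k : ℕ) : ENNReal.ofReal (A * L ^ k) ^ p = c * ENNReal.ofReal ((3 / 2) ^ k) := by
    have e : (L ^ k) ^ p = (3 / 2) ^ k := by
      rw [← hLp, ← Real.rpow_natCast, ← Real.rpow_natCast, ← Real.rpow_mul (by positivity),
        ← Real.rpow_mul (by positivity), mul_comm]
    rw [ENNReal.ofReal_mul hA.le, ENNReal.mul_rpow_of_nonneg _ _ hp.le,
      ENNReal.ofReal_rpow_of_pos (pow_pos (by positivity) k), e]
  have hpt (x : X) : ENNReal.ofReal (f x) ^ p ≤ c + ∑' k : ℕ,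
      {x | A * L ^ k ≤ f x}.indicator (fun _ => c * ENNReal.ofReal ((3 / 2) ^ (k + 1))) x := by
    rcases lt_or_ge (f x) A with hx | hx
    · exact le_add_right (ENNReal.rpow_le_rpow (ENNReal.ofReal_le_ofReal hx.le) hp.le)
    · obtain ⟨k, hk1, hk2⟩ := exists_nat_pow_near ((one_le_div hA).2 hx) hL
      rw [le_div_iff₀' hA] at hk1
      rw [div_lt_iff₀' hA] at hk2
      refine le_add_left (le_trans ?_ (ENNReal.le_tsum k))
      rw [indicator_of_mem (by exact hk1), ← hlev]
      exact ENNReal.rpow_le_rpow (ENNReal.ofReal_le_ofReal hk2.le) hp.le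
  have hmeas (k : ℕ) : NullMeasurableSet {x | A * L ^ k ≤ f x} (μ.restrict Q) :=
    nullMeasurableSet_le aemeasurable_const hf.aemeasurable
  have hbd (k : ℕ) : μ ({x | A * L ^ k ≤ f x} ∩ Q) ≤ V * ENNReal.ofReal ((1 / 2) ^ k) := by
    have h2 : ENNReal.ofReal ((1 / 2) ^ k) * 2 ^ k = 1 := by
      rw [← ENNReal.ofReal_ofNat, ← ENNReal.ofReal_pow (by norm_num),
        ← ENNReal.ofReal_mul (by positivity), ← mul_pow]
      norm_num
    calc μ ({x | A * L ^ k ≤ f x} ∩ Q)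
        = ENNReal.ofReal ((1 / 2) ^ k) * (2 ^ k * μ ({x | A * L ^ k ≤ f x} ∩ Q)) := by
          rw [← mul_assoc, h2, one_mul]
      _ ≤ ENNReal.ofReal ((1 / 2) ^ k) * V := by gcongr; exact h k
      _ = _ := mul_comm _ _
  have hsum : ∑' k : ℕ, ENNReal.ofReal (3 / 2 * (3 / 4) ^ k) = 6 := by
    rw [← ENNReal.ofReal_tsum_of_nonneg (fun k => by positivity)
      ((summable_geometric_of_lt_one (by norm_num) (by norm_num)).mul_left _), tsum_mul_left,
      tsum_geometric_of_lt_one (by norm_num) (by norm_num)]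
    norm_num
  calc ∫⁻ x in Q, ENNReal.ofReal (f x) ^ p ∂μ
      ≤ ∫⁻ x in Q, (c + ∑' k : ℕ, {x | A * L ^ k ≤ f x}.indicator
          (fun _ => c * ENNReal.ofReal ((3 / 2) ^ (k + 1))) x) ∂μ := lintegral_mono hpt
    _ = c * μ Q + ∑' k : ℕ, c * ENNReal.ofReal ((3 / 2) ^ (k + 1)) * μ ({x | A * L ^ k ≤ f x} ∩ Q) := by
        rw [lintegral_add_left measurable_const, setLIntegral_const,
          lintegral_tsum (fun k => aemeasurable_const.indicator₀ (hmeas k))]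
        congr 1
        refine tsum_congr fun k => ?_
        rw [lintegral_indicator_const₀ (hmeas k), Measure.restrict_apply' hQ]
    _ ≤ c * V + ∑' k : ℕ, c * V * ENNReal.ofReal (3 / 2 * (3 / 4) ^ k) := by
        refine add_le_add (by gcongr) (ENNReal.tsum_le_tsum fun k => ?_)
        calc c * ENNReal.ofReal ((3 / 2) ^ (k + 1)) * μ ({x | A * L ^ k ≤ f x} ∩ Q)
            ≤ c * ENNReal.ofReal ((3 / 2) ^ (k + 1)) * (V * ENNReal.ofReal ((1 / 2) ^ k)) := by
              gcongr; exact hbd k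
          _ = c * V * (ENNReal.ofReal ((3 / 2) ^ (k + 1)) * ENNReal.ofReal ((1 / 2) ^ k)) := by ring
          _ = _ := by
              have e : (3 / 2 : ℝ) ^ (k + 1) * (1 / 2) ^ k = 3 / 2 * (3 / 4) ^ k := by
                rw [pow_succ, mul_right_comm, ← mul_pow, mul_comm]; norm_num
              rw [← ENNReal.ofReal_mul (by positivity), e]
    _ = 7 * V * c := by
        rw [ENNReal.tsum_mul_left, hsum]; ring

namespace Kinetic

variable {d : ℕ}

/-- The weak Harnack inequality, with a number `K` instead of the essential infimum. -/
theorem exists_weak_harnack (d : ℕ) {pc Cp Cm : ℝ} {ϖ : ℝ → ℝ} (hpc : 2 < pc) (hCp : 1 ≤ Cp)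
    (hCm : 0 < Cm) (hϖ : Tendsto ϖ atTop (𝓝 0)) :
    ∃ R₀ C p : ℝ, 1 < R₀ ∧ 0 < C ∧ 0 < p ∧ ∀ f S : Ph d → ℝ,
      KDGMinus pc Cp Cm ϖ (-1) 0 (Metric.ball 0 R₀) (Metric.ball 0 R₀) f S →
      (∀ᵐ z ∂volume.restrict (box d (-1) 0 R₀ R₀), 0 ≤ f z) → ∀ s K : ℝ, 0 ≤ s →
      eLpNorm S ∞ (volume.restrict (box d (-1) 0 R₀ R₀)) ≤ ENNReal.ofReal s → 0 < K → s ≤ K →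
      (∀ m : ℝ, (∀ᵐ z ∂volume.restrict (cyl (1 / 1000) (0 : Ph d)), m ≤ f z) → m ≤ K) →
      (∫⁻ z in cyl (1 / 1000) (-1 + (1 / 1000) ^ 2, 0, 0), ENNReal.ofReal (f z) ^ p) ^ (1 / p) ≤
        ENNReal.ofReal C * ENNReal.ofReal K := by
  have hV := unitVol_pos (d := d)
  obtain ⟨δ₁, hδ₁, hDG⟩ := KDGPlus.exists_lower_bound (d := d) hpc hCp
  set δ := min δ₁ (unitVol d / 2) with hδ
  have hδ0 : 0 < δ := lt_min hδ₁ (by positivity)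
  -- The density threshold of the covering argument, divided by `10^(4d+2)` because a chain starts
  -- with the radius `2ρ ≤ 10r`.
  set c := unitVol d / (4 * 65 ^ (4 * d + 2)) / 10 ^ (4 * d + 2) with hc
  obtain ⟨R, θ, hR, hθ, hθ1, hex⟩ := KDGMinus.exists_expansion d (pc := pc) (Cp := Cp) hCm hϖ
    (c := c) (δ := δ) (by positivity) hδ0
  have hL : 1 < θ⁻¹ := (one_lt_inv₀ hθ).2 hθ1
  set p := Real.log (3 / 2) / Real.log θ⁻¹ with hpd
  have hlog : 0 < Real.log θ⁻¹ := Real.log_pos hL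
  have hp : 0 < p := div_pos (Real.log_pos (by norm_num)) hlog
  have hLp : θ⁻¹ ^ p = 3 / 2 := by
    rw [Real.rpow_def_of_pos (by positivity), hpd, mul_div_cancel₀ _ hlog.ne', Real.exp_log (by norm_num)]
  refine ⟨16 * R + 10, (7 * unitVol d) ^ (1 / p) * (2 * θ⁻¹ ^ 22), p, by linarith, by positivity, hp,
    fun f S h hf s K hs hS hK0 hsK hK => ?_⟩
  have hexp : Expands c δ R θ s (box d (-1) 0 (16 * R + 10) (16 * R + 10)) f :=
    hex _ _ _ _ f S Metric.isOpen_ball Metric.isOpen_ball h hf s hs hS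
  have hdecay := hexp.measure_superlevel_le hR rfl (min_le_right _ _) hδ0.le hc hθ hθ1
    (fun M hM hsM z hz hzs hvol => hDG _ _ _ _ f S h.neg_mem hf s M hM hs hsM hS z hz hzs
      (hvol.trans (ENNReal.ofReal_le_ofReal (min_le_left _ _)))) hK hK0 hsK
  have hpast (k : ℕ) : cyl (1 / 1000) (-1 + (1 / 1000) ^ 2, 0, 0) ⊆ initialBox d k := by
    intro y hy
    obtain ⟨⟨h1, h2⟩, h3, h4⟩ := mem_comp_box.1 hy
    have hk : (0 : ℝ) < (1 / 2) ^ k := by positivity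
    simp only [sub_zero, smul_zero] at h1 h2 h3 h4
    refine ⟨⟨by linarith, by linarith⟩, by linarith, by linarith⟩
  have hsub : cyl (1 / 1000) (-1 + (1 / 1000) ^ 2, 0, 0) ⊆ box d (-1) 0 (16 * R + 10) (16 * R + 10) := by
    intro y hy
    obtain ⟨⟨h1, h2⟩, h3, h4⟩ := hpast 0 hy
    norm_num at h2 h3 h4
    exact mem_box.2 ⟨⟨h1, by linarith⟩, by linarith, by linarith⟩
  have hfm : AEStronglyMeasurable f (volume.restrict (box d (-1) 0 (16 * R + 10) (16 * R + 10))) := by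
    have hm := h.neg_mem.aestronglyMeasurable.neg
    rwa [show (-fun z => -f z) = f by ext z; simp] at hm
  have hint := setLIntegral_rpow_le_of_measure_superlevel
    (Q := cyl (d := d) (1 / 1000) (-1 + (1 / 1000) ^ 2, 0, 0)) (μ := volume) measurableSet_cyl
    (hfm.mono_measure (Measure.restrict_mono hsub le_rfl)) (A := 2 * K * θ⁻¹ ^ 22) (L := θ⁻¹)
    (V := ENNReal.ofReal (unitVol d)) (by positivity) hL hp hLp
    ((measure_mono (hpast 0)).trans (volume_initialBox_le 0)) (fun k => by
      refine le_trans (mul_le_mul_right (measure_mono (inter_subset_inter ?_ (hpast k))) _) (hdecay k)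
      intro y hy
      simp only [mem_ofPred_eq] at hy ⊢
      rwa [pow_add, mul_comm (θ⁻¹ ^ k), ← mul_assoc])
  refine (ENNReal.rpow_le_rpow hint (by positivity)).trans (le_of_eq ?_)
  rw [ENNReal.mul_rpow_of_nonneg _ _ (by positivity), ← ENNReal.rpow_mul, mul_one_div_cancel hp.ne',
    ENNReal.rpow_one, ← ENNReal.ofReal_ofNat, ← ENNReal.ofReal_mul (by norm_num),
    ENNReal.ofReal_rpow_of_pos (by positivity), ← ENNReal.ofReal_mul (by positivity),
    ← ENNReal.ofReal_mul (by positivity)]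
  congr 1
  ring

end Kinetic

theorem theoremt (d : ℕ) (hd : 1 ≤ d) (pc Cp Cm : ℝ) (hpc : 2 < pc) (hCp : 1 ≤ Cp) (hCm : 0 < Cm)
    (ϖ : ℝ → ℝ) (hϖ : Tendsto ϖ atTop (𝓝 0)) :
    ∃ R₀ ω C p : ℝ, 1 < R₀ ∧ 0 < ω ∧ ω < 1 ∧ 0 < C ∧ 0 < p ∧
      ∀ f S : Kinetic.Ph d → ℝ,
        MemLp S ∞ (volume.restrict (Kinetic.box d (-1) 0 R₀ R₀)) →
        Kinetic.KDGMinus pc Cp Cm ϖ (-1) 0 (Metric.ball 0 R₀) (Metric.ball 0 R₀) f S →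
        (∀ᵐ z ∂(volume.restrict (Kinetic.box d (-1) 0 R₀ R₀)), 0 ≤ f z) →
        (∫⁻ z in Kinetic.cyl ω (-1 + ω ^ 2, 0, 0), ENNReal.ofReal (f z) ^ p) ^ (1 / p) ≤
          ENNReal.ofReal C *
            (essInf (fun z => ENNReal.ofReal (f z)) (volume.restrict (Kinetic.cyl ω 0)) +
              eLpNorm S ∞ (volume.restrict (Kinetic.box d (-1) 0 R₀ R₀))) := by
  obtain ⟨R₀, C, p, hR₀, hC, hp, key⟩ := Kinetic.exists_weak_harnack d hpc hCp hCm hϖ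
  refine ⟨R₀, 1 / 1000, C, p, hR₀, by norm_num, by norm_num, hC, hp, fun f S hS h hf => ?_⟩
  set e := essInf (fun z => ENNReal.ofReal (f z)) (volume.restrict (Kinetic.cyl (1 / 1000) 0)) with he
  set s := eLpNorm S ∞ (volume.restrict (Kinetic.box d (-1) 0 R₀ R₀)) with hs
  have hs' : s ≠ ∞ := hS.2.ne
  by_cases hetop : e = ∞
  · rw [hetop, top_add, ENNReal.mul_top (by simpa using hC)]
    exact le_top
  -- `K` has to be positive, whereas the essential infimum and the source may both vanish; the added
  -- `ε / C` costs `ε` in the end.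
  refine ENNReal.le_of_forall_pos_le_add fun ε hε _ => ?_
  have hεC : 0 < (ε : ℝ) / C := div_pos hε hC
  refine (key f S h hf s.toReal (e.toReal + s.toReal + ε / C) ENNReal.toReal_nonneg
    (ENNReal.ofReal_toReal hs').ge (by positivity)
    (by linarith [ENNReal.toReal_nonneg (a := e)]) fun m hm => ?_).trans (le_of_eq ?_)
  · have hme : ENNReal.ofReal m ≤ e :=
      le_essInf_of_ae_le _ (hm.mono fun z hz => ENNReal.ofReal_le_ofReal hz)
    have := (ENNReal.ofReal_le_iff_le_toReal hetop).1 hme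
    linarith [ENNReal.toReal_nonneg (a := s)]
  · rw [ENNReal.ofReal_add (by positivity) hεC.le, ENNReal.ofReal_add (by positivity) (by positivity),
      ENNReal.ofReal_toReal hetop, ENNReal.ofReal_toReal hs', mul_add, ← ENNReal.ofReal_mul hC.le,
      mul_div_cancel₀ _ hC.ne', ENNReal.ofReal_coe_nnreal]
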